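/- Identify $\mathbb R^7$ with the imaginary octonions, with orthonormal basis $e_1,\dots,e_7$ and product $uv=-\langle u,v\rangle+u\times v$, where $\langle u\times v,w\rangle$ is the alternating $3$-form $-e^{125}-e^{136}-e^{147}-e^{237}+e^{246}-e^{345}+e^{567}$. Let $G_2\subset SO(7)$ be the group preserving $\times$, $\mathfrak g_2$ its Lie algebra, and $SO(4)\subset G_2$ the subgroup preserving $\mathbb R^7=\mathbb R^4\oplus\mathbb R^3$ ($\mathbb R^3$ spanned by $e_5,e_6,e_7$). An associative $3$-plane is a $3$-dimensional subspace closed under $\times$; every $2$-plane $E\subset\mathbb R^7$ lies in a unique associative $3$-plane $E_+$. For a smooth immersion $\phi:\mathbb R^2\to\mathbb R^7$ (a simply connected surface) the extended Gauss map is $\Gamma(m)=(d\phi(T_m\mathbb R^2))_+\in G_2/SO(4)$. The surface is nondegenerate if $\Gamma$ is an immersion, and $G_2/SO(4)$-abelian if the bundle $\Gamma^*\mathcal W$ of coassociative $4$-planes $\Gamma(m)^\perp$, with the connection obtained by differentiating sections in $\mathbb R^7$ and projecting orthogonally, is flat. A $G_2$-adapted frame of $\phi$ is a smooth map $F=(e_1,\dots,e_7):\mathbb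 R^2\to G_2$ such that $e_5,e_6,e_7$ span $\Gamma$. Write elements of $\mathfrak g_2\ltimes\mathbb R^7$ as $8\times 8$ matrices, let $S=\mathrm{diag}(-I_4,I_3,1)$ and let $\hat{\mathfrak p}=\{\xi\in\mathfrak g_2\ltimes\mathbb R^7: S\xi S=-\xi\}$. Let $$a_1=\begin{pmatrix}1&0&0&0\\0&0&0&0\\0&0&1&0\end{pmatrix},\quad a_2=\begin{pmatrix}0&0&0&0\\0&0&0&1\\0&0&1&0\end{pmatrix},\quad b_i=\begin{pmatrix}0&-{}^ta_i&0\\a_i&0&0\\0&0&0\end{pmatrix}\in\hat{\mathfrak p}.$$ A solution of the affine extension of the $G_2/SO(4)$-system is a pair $(x,v)$ of a smooth local diffeomorphism $x=(x_1,x_2):\mathbb R^2\to\mathbb R^2$ (i.e. $x_1,x_2$ are local coordinates) and a smooth map $v:\mathbb R^2\to\hat{\mathfrak p}$ such that for every $\lambda\in\mathbb C$ the one-form $$\theta_\lambda=\sum_{i=1}^2(\lambda b_i+[b_i,v])\,dx_i$$ is flat: $d\theta_\lambda+\theta_\lambda\wedge\theta_\lambda=0$. Smooth maps $F:\mathbb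 R^2\to G_2$ and $\phi:\mathbb R^2\to\mathbb R^7$ integrate $(x,v)$ if $\Phi=\begin{pmatrix}F&\phi\\0&1\end{pmatrix}$ satisfies $d\Phi=\Phi\,\theta_1$. Then nondegenerate $G_2/SO(4)$-abelian surfaces $\phi:\mathbb R^2\to\mathbb R^7$ are equivalent to such families of flat connections, in the following sense. 1. A smooth immersion $\phi:\mathbb R^2\to\mathbb R^7$ is nondegenerate and $G_2/SO(4)$-abelian if and only if there are a solution $(x,v)$ and a $G_2$-adapted frame $F$ of $\phi$ such that $(F,\phi)$ integrates $(x,v)$. 2. Every solution $(x,v)$ is integrated by some $(F,\phi)$. Whenever $(F,\phi)$ integrates $(x,v)$, the map $\phi$ is an immersion if and only if the ($\mathbb R^7$-valued, $\lambda$-independent) translation part of $\theta_\lambda$ is injective at every point; in that case $F$ is a $G_2$-adapted frame of $\phi$, and $\phi$ is nondegenerate and $G_2/SO(4)$-abelian. 3. Let $(F,\phi)$ integrate the solution $(x,v)$ with family $\theta_\lambda$ and let $(F',\phi')$ integrate the solution $(x',v')$ with family $\theta'_\lambda$, where $\phi$ is an immersion. Then $\phi'=g\phi+c$ for some $g\in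 G_2$, $c\in\mathbb R^7$ if and only if there is a constant $k\in SO(4)$ (acting trivially on the last coordinate of $\mathbb R^8$) with $\theta'_\lambda=k^{-1}\theta_\lambda k$ for all $\lambda\in\mathbb C$. -/

import Mathlib

open scoped ContDiff
open scoped Matrix.Norms.Elementwise

noncomputable section

namespace G2Surface

/-- The parameter domain `ℝ²`. -/
abbrev R2 : Type := EuclideanSpace ℝ (Fin 2)

/-- `ℝ⁷`, identified with the imaginary octonions; the basis vector `e_{i+1}` has index `i`. -/
abbrev R7 : Type := EuclideanSpace ℝ (Fin 7)

/-- Real `7 × 7` matrices. -/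
abbrev Mat7 : Type := Matrix (Fin 7) (Fin 7) ℝ

/-- `8 × 8` matrices, in which affine transformations of `ℝ⁷` (and their Lie algebra) live; the
last row and column have index `Sum.inr ()`. -/
abbrev Mat8 (𝕜 : Type) : Type := Matrix (Fin 7 ⊕ Unit) (Fin 7 ⊕ Unit) 𝕜

/-! ### The octonionic product, the group `G₂` and its Lie algebra -/

/-- The cross product `u × v = Im (u v)` of imaginary octonions, for the multiplication table with
`e₁e₂ = -e₅`, `e₁e₃ = -e₆`, `e₁e₄ = -e₇`, `e₂e₃ = -e₇`, `e₂e₄ = e₆`, `e₃e₄ = -e₅`, `e₅e₆ = e₇`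
(the other products of distinct `e_i, e_j` follow because `⟨e_i e_j, e_k⟩` is alternating).
The octonionic product is `u v = -⟨u, v⟩ + u × v`. -/
def cross (u v : R7) : R7 :=
  !₂[- (u 1 * v 4 - u 4 * v 1) - (u 2 * v 5 - u 5 * v 2) - (u 3 * v 6 - u 6 * v 3),
     (u 0 * v 4 - u 4 * v 0) - (u 2 * v 6 - u 6 * v 2) + (u 3 * v 5 - u 5 * v 3),
     (u 0 * v 5 - u 5 * v 0) + (u 1 * v 6 - u 6 * v 1) - (u 3 * v 4 - u 4 * v 3),
     (u 0 * v 6 - u 6 * v 0) - (u 1 * v 5 - u 5 * v 1) + (u 2 * v 4 - u 4 * v 2),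
     - (u 0 * v 1 - u 1 * v 0) - (u 2 * v 3 - u 3 * v 2) + (u 5 * v 6 - u 6 * v 5),
     - (u 0 * v 2 - u 2 * v 0) + (u 1 * v 3 - u 3 * v 1) - (u 4 * v 6 - u 6 * v 4),
     - (u 0 * v 3 - u 3 * v 0) - (u 1 * v 2 - u 2 * v 1) + (u 4 * v 5 - u 5 * v 4)]

/-- The action of a matrix on `ℝ⁷`. -/
abbrev act (A : Mat7) (u : R7) : R7 := Matrix.toEuclideanLin A u

/-- `G₂ ⊂ SO(7)`: the automorphisms of the octonions, acting on the imaginary octonions. -/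
def G2 : Set Mat7 :=
  {g | g ∈ Matrix.orthogonalGroup (Fin 7) ℝ ∧
    ∀ u v : R7, act g (cross u v) = cross (act g u) (act g v)}

/-- The Lie algebra of `G₂`: the derivations of the octonions. -/
def g2 : Set Mat7 :=
  {A | A.transpose = -A ∧ ∀ u v : R7, act A (cross u v) = cross (act A u) v + cross u (act A v)}

/-- The reflection `diag(-I₄, I₃)`. -/
def S7 : Mat7 := Matrix.diagonal ![-1, -1, -1, -1, 1, 1, 1]

/-- `SO(4) ⊂ G₂`: the elements of `G₂` that preserve the splitting `ℝ⁷ = ℝ⁴ ⊕ ℝ³`. -/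
def K : Set Mat7 := {k | k ∈ G2 ∧ S7 * k = k * S7}

/-! ### The affine extension -/

/-- The affine transformation `y ↦ A y + c` as an `8 × 8` matrix. -/
def affineMatrix (A : Mat7) (c : R7) : Mat8 ℝ :=
  Matrix.fromBlocks A (Matrix.replicateCol Unit c.ofLp) 0 1

/-- The Lie algebra of `G₂ ⋉ ℝ⁷`. -/
def affineG2 : Set (Mat8 ℝ) :=
  {ξ | ∃ A ∈ g2, ∃ c : R7, ξ = Matrix.fromBlocks A (Matrix.replicateCol Unit c.ofLp) 0 0}

/-- The matrix `S = diag(-I₄, I₃, 1)`. -/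
def S8 : Mat8 ℝ := Matrix.fromBlocks S7 0 0 1

/-- `p̂`: the `-1`-eigenspace of `ξ ↦ S ξ S` on the Lie algebra of `G₂ ⋉ ℝ⁷`. -/
def pHat : Set (Mat8 ℝ) := {ξ | ξ ∈ affineG2 ∧ S8 * ξ * S8 = -ξ}

/-- The `3 × 4` matrices `a₁`, `a₂`. -/
def a : Fin 2 → Matrix (Fin 3) (Fin 4) ℝ :=
  ![!![1, 0, 0, 0; 0, 0, 0, 0; 0, 0, 1, 0],
    !![0, 0, 0, 0; 0, 0, 0, 1; 0, 0, 1, 0]]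

/-- The commuting matrices `b₁`, `b₂` in `p̂`: the linear part of `b_i` has the blocks
`0`, `-ᵗa_i`, `a_i`, `0` with respect to `ℝ⁷ = ℝ⁴ ⊕ ℝ³`, and the translation part is zero. -/
def b (i : Fin 2) : Mat8 ℝ :=
  Matrix.fromBlocks
    (Matrix.reindex finSumFinEquiv finSumFinEquiv
      (Matrix.fromBlocks 0 (-(a i).transpose) (a i) 0) : Matrix (Fin (4 + 3)) (Fin (4 + 3)) ℝ)
    0 0 0

/-- The matrix-valued one-form `θ_lam = ∑ᵢ (lam bᵢ + [bᵢ, v]) dxᵢ` on `ℝ²`, evaluated at the point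
`m` on the tangent vector `u`. -/
def theta {𝕜 : Type} [RCLike 𝕜] (x : R2 → R2) (v : R2 → Mat8 ℝ) (lam : 𝕜) (m u : R2) : Mat8 𝕜 :=
  ∑ i : Fin 2, algebraMap ℝ 𝕜 (fderiv ℝ x m u i) •
    (lam • (b i).map (algebraMap ℝ 𝕜) + ⁅b i, v m⁆.map (algebraMap ℝ 𝕜))

/-- Flatness `dη + η ∧ η = 0` of a matrix-valued one-form `η` on `ℝ²`, evaluated on pairs of
constant vector fields. -/
def IsFlatConnection (η : R2 → R2 → Mat8 ℂ) : Prop :=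
  ∀ m u w : R2,
    fderiv ℝ (fun p => η p w) m u - fderiv ℝ (fun p => η p u) m w + ⁅η m u, η m w⁆ = 0

/-- The affine extension of the `G₂/SO(4)`-system: `v` is a smooth `p̂`-valued map, `x = (x₁, x₂)`
is a local diffeomorphism (so that `x₁, x₂` are local coordinates near every point), and the
connections `θ_lam` are flat for all complex `lam`. -/
structure IsAffineSystem (x : R2 → R2) (v : R2 → Mat8 ℝ) : Prop where
  smooth_x : ContDiff ℝ ∞ x
  smooth_v : ContDiff ℝ ∞ v
  coordinates : ∀ m, Function.Bijective (fderiv ℝ x m)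
  mem_pHat : ∀ m, v m ∈ pHat
  flat : ∀ lam : ℂ, IsFlatConnection (theta x v lam)

/-! ### Surfaces in `ℝ⁷` -/

/-- A smooth immersion of `ℝ²` into `ℝ⁷`. -/
def IsImmersedSurface (φ : R2 → R7) : Prop :=
  ContDiff ℝ ∞ φ ∧ ∀ m, Function.Injective (fderiv ℝ φ m)

/-- The Gauss map: the tangent plane of the surface as a subspace of `ℝ⁷`. -/
def gaussMap (φ : R2 → R7) (m : R2) : Submodule ℝ R7 :=
  LinearMap.range (fderiv ℝ φ m : R2 →ₗ[ℝ] R7)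

/-- Associative 3-planes: `ℝ 1 ⊕ V` is a (quaternion) subalgebra of the octonions. -/
def IsAssociative (V : Submodule ℝ R7) : Prop :=
  Module.finrank ℝ V = 3 ∧ ∀ u ∈ V, ∀ v ∈ V, cross u v ∈ V

/-- For a 2-plane `E` this is the unique associative 3-plane `E₊` that contains `E`. -/
def assocExtension (E : Submodule ℝ R7) : Submodule ℝ R7 :=
  sInf {V | IsAssociative V ∧ E ≤ V}

/-- The extended Gauss map, with values in the associative 3-planes. -/
def extGauss (φ : R2 → R7) (m : R2) : Submodule ℝ R7 := assocExtension (gaussMap φ m)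

/-- Nondegeneracy: the extended Gauss map is an immersion. The Grassmannian carries its usual smooth
structure, as the submanifold of `End(ℝ⁷)` formed by the orthogonal projections. -/
def IsNondegenerate (φ : R2 → R7) : Prop :=
  ∀ m, Function.Injective (fderiv ℝ (fun p => (extGauss φ p).starProjection) m)

/-- The natural covariant derivative, in the direction of the constant vector field `u`, of a
section `s` of a bundle `W` of subspaces of `ℝ⁷`: differentiate in `ℝ⁷` and project to `W`. -/
def covDeriv (W : R2 → Submodule ℝ R7) (u : R2) (s : R2 → R7) (m : R2) : R7 :=
  (W m).starProjection (fderiv ℝ s m u)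

/-- The natural connection of the bundle `W` has zero curvature: the covariant derivatives of
smooth sections along the (commuting) constant vector fields commute. -/
def IsFlatBundle (W : R2 → Submodule ℝ R7) : Prop :=
  ∀ s : R2 → R7, ContDiff ℝ ∞ s → (∀ m, s m ∈ W m) →
    ∀ u w m : R2, covDeriv W u (covDeriv W w s) m = covDeriv W w (covDeriv W u s) m

/-- `G₂/SO(4)`-abelian: the pullback by the extended Gauss map of the tautological bundle of
coassociative 4-planes (the orthogonal complements of the associative 3-planes) is flat. -/
def IsAbelian (φ : R2 → R7) : Prop := IsFlatBundle fun m => (extGauss φ m).orthogonal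

/-- A `G₂`-adapted frame of the surface: the columns `e₁, …, e₇` of `F` form an element of `G₂` and
`e₅, e₆, e₇` span the associative extension of the tangent plane. -/
structure IsAdaptedFrame (F : R2 → Mat7) (φ : R2 → R7) : Prop where
  smooth : ContDiff ℝ ∞ F
  mem_G2 : ∀ m, F m ∈ G2
  span_eq : ∀ m, Submodule.span ℝ
    (Set.range fun j : Fin 3 => (WithLp.toLp 2 fun i => F m i (Fin.natAdd 4 j) : R7)) = extGauss φ m

/-- The map `φ` and the `G₂`-frame `F` are obtained by integrating the real one-form `θ₁` defined
by `x` and `v`: the affine frame `Φ = (F, φ)` satisfies `dΦ = Φ θ₁`. -/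
structure Integrates (F : R2 → Mat7) (φ : R2 → R7) (x : R2 → R2) (v : R2 → Mat8 ℝ) : Prop where
  smooth_F : ContDiff ℝ ∞ F
  smooth_φ : ContDiff ℝ ∞ φ
  mem_G2 : ∀ m, F m ∈ G2
  eqn : ∀ m u, fderiv ℝ (fun p => affineMatrix (F p) (φ p)) m u =
    affineMatrix (F m) (φ m) * theta x v (1 : ℝ) m u

/-- The translation part of the one-forms `θ_lam` (it does not depend on `lam`) is injective at
every point. -/
def HasInjectiveTranslationPart (x : R2 → R2) (v : R2 → Mat8 ℝ) : Prop :=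
  ∀ m u, (∀ j : Fin 7, theta x v (1 : ℝ) m u (Sum.inl j) (Sum.inr ()) = 0) → u = 0

/-- Two maps into `ℝ⁷` differ by an element of `G₂ ⋉ ℝ⁷`. -/
def AreCongruent (φ φ' : R2 → R7) : Prop := ∃ g ∈ G2, ∃ c : R7, ∀ m, φ' m = act g (φ m) + c

/-- Two families `θ_lam`, `θ'_lam` are conjugate by a constant `k ∈ SO(4)`:
`θ'_lam = k⁻¹ θ_lam k` for all `lam`. -/
def ConjugateFamilies (x : R2 → R2) (v : R2 → Mat8 ℝ) (x' : R2 → R2) (v' : R2 → Mat8 ℝ) : Prop :=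
  ∃ k ∈ K, ∀ (lam : ℂ) (m u : R2),
    (affineMatrix k 0).map (algebraMap ℝ ℂ) * theta x' v' lam m u =
      theta x v lam m u * (affineMatrix k 0).map (algebraMap ℝ ℂ)

end G2Surface

end

/-! Conjugation by `S7` splits `𝔤₂ = 𝔨 ⊕ 𝔭` with `𝔨 = 𝔰𝔬(4)`, and almost every step compares the
even and odd parts of an identity. The symmetric space G₂/SO(4) has rank two: `b₁, b₂` span a
maximal abelian subspace 𝔞 of 𝔭, with six positive restricted roots, each of multiplicity one. Thus
`𝔭 = 𝔞 ⊕ ℝ⁶`, `𝔨 = ℝ⁶`, and bracketing with `bᵢ` exchanges the two copies of ℝ⁶, up to sign, by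
multiplication with the root values (`lie_b7_pMat`, `lie_b7_kMat`). Hence 𝔞 has zero centralizer and
zero normalizer in 𝔨, and two independent commuting elements of 𝔭 span an SO(4)-conjugate of 𝔞
(`exists_conj_tCoord_eq_zero`).

For an adapted frame `F`, the derivative of the extended Gauss map is the odd part of `F⁻¹dF`. The
curvature of the coassociative bundle is, up to a factor and conjugation by `F`, the bracket of the
two odd components, acting on ℝ⁴. Since 𝔰𝔬(4) acts faithfully on ℝ⁴, a surface is nondegenerate and
abelian exactly when the odd components commute and are independent, that is, span a conjugate of 𝔞
at each point.

From solutions to surfaces: `θ₁` is flat, so `dΦ = Φθ₁` can be integrated by the Frobenius theorem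
(`exists_solution_of_isIntegrable`). Its odd linear part `∑ bⱼ dxⱼ` is commuting and independent,
and its translation part lies in ℝ³. Flatness at `λ = 1` implies flatness for all `λ`, by parity
(`flat_family_iff`).

From surfaces to solutions: the abelian condition gives a frame with purely odd `F⁻¹dF`
(`exists_parallel_frame`), and a smooth SO(4)-gauge moves the odd part into 𝔞
(`exists_torus_gauge`). The odd Maurer–Cartan equation then has two consequences. Its 𝔞-component
says that the coefficients of the `bⱼ` are closed, hence equal to `dxⱼ`. Its root components are a
symmetry condition which says that the even part is `[∑ bⱼ dxⱼ, v]`. The symmetry of the second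
derivatives of `φ` produces the translation part of `v` in the same way, because the nonzero weights
of 𝔞 on ℝ⁷ are, up to sign, roots.

Uniqueness: frames of congruent surfaces differ by a map `k` into SO(4). Comparison of odd parts
shows that `k` normalizes 𝔞; this normalizer has zero Lie algebra, so `k` is constant
(`conjugateFamilies_of_areCongruent`). -/

set_option maxSynthPendingDepth 5

noncomputable section

namespace G2Surface

/-! ### Linear ordinary differential equations by Picard iteration -/

section LinearODE

open Set MeasureTheory

variable {E : Type*} [NormedAddCommGroup E] [NormedSpace ℝ E]

/-- The iterated integrals of the Picard iteration for `y' = A y`. -/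
def picardTerm (A : ℝ → E →L[ℝ] E) (y₀ : E) : ℕ → ℝ → E
  | 0 => fun _ => y₀
  | n + 1 => fun t => ∫ s in (0 : ℝ)..t, A s (picardTerm A y₀ n s)

theorem continuous_picardTerm {A : ℝ → E →L[ℝ] E} (hA : Continuous A) (y₀ : E) (n : ℕ) :
    Continuous (picardTerm A y₀ n) := by
  induction n with
  | zero => exact continuous_const
  | succ n ih =>
    exact intervalIntegral.continuous_primitive
      (fun a b => (hA.clm_apply ih).intervalIntegrable a b) 0

theorem hasDerivAt_picardTerm_succ [CompleteSpace E] {A : ℝ → E →L[ℝ] E} (hA : Continuous A)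
    (y₀ : E) (n : ℕ) (t : ℝ) :
    HasDerivAt (picardTerm A y₀ (n + 1)) (A t (picardTerm A y₀ n t)) t :=
  (hA.clm_apply (continuous_picardTerm hA y₀ n)).integral_hasStrictDerivAt 0 t |>.hasDerivAt

/-- Repeated integration of powers of `|s|` produces the factorial, so the Picard series converges
for every bound `M`, with no smallness condition. The open interval `(-1, 2)` contains `[0, 1]`, so
termwise differentiation also covers the endpoints. -/
theorem norm_picardTerm_le {A : ℝ → E →L[ℝ] E} (y₀ : E) {M : ℝ}
    (hM : ∀ t ∈ Ioo (-1 : ℝ) 2, ‖A t‖ ≤ M) (n : ℕ) {t : ℝ} (ht : t ∈ Ioo (-1 : ℝ) 2) :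
    ‖picardTerm A y₀ n t‖ ≤ ‖y₀‖ * ((M * |t|) ^ n / n.factorial) := by
  have hM0 : 0 ≤ M := (norm_nonneg _).trans (hM 0 (by norm_num))
  induction n generalizing t with
  | zero => simp [picardTerm]
  | succ n ih =>
    have hsub : uIoc 0 t ⊆ Ioo (-1 : ℝ) 2 := by
      intro s hs
      rw [mem_uIoc] at hs
      rcases hs with hs | hs
      · exact ⟨by linarith [hs.1], by linarith [hs.2, ht.2]⟩
      · exact ⟨by linarith [hs.1, ht.1], by linarith [hs.2]⟩
    have h1 : ‖picardTerm A y₀ (n + 1) t‖ ≤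
        ∫ s in uIoc 0 t, M * (‖y₀‖ * ((M * |s - 0|) ^ n / n.factorial)) := by
      refine (intervalIntegral.norm_intervalIntegral_eq _ _ _ _).trans_le ?_
      refine norm_integral_le_of_norm_le ?_ ?_
      · refine (Continuous.integrableOn_uIcc (by fun_prop)).mono_set uIoc_subset_uIcc
      · refine (ae_restrict_iff' measurableSet_uIoc).2 (Filter.Eventually.of_forall fun s hs => ?_)
        refine (ContinuousLinearMap.le_opNorm _ _).trans ?_
        rw [sub_zero]
        exact mul_le_mul (hM s (hsub hs)) (ih (hsub hs)) (norm_nonneg _) hM0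
    refine h1.trans_eq ?_
    have h2 : ∀ s : ℝ, M * (‖y₀‖ * ((M * |s - 0|) ^ n / n.factorial)) =
        (M ^ (n + 1) * ‖y₀‖ / n.factorial) * |s - 0| ^ n := by
      intro s; rw [mul_pow]; ring
    simp_rw [h2]
    rw [integral_const_mul, integral_pow_abs_sub_uIoc, sub_zero, Nat.factorial_succ, mul_pow]
    have : (n.factorial : ℝ) ≠ 0 := by positivity
    have : ((n : ℝ) + 1) ≠ 0 := by positivity
    push_cast
    field_simp

/-- Linear ODEs with continuous coefficients have solutions on `[0, 1]`. -/
theorem exists_linearODE_solution [CompleteSpace E] {A : ℝ → E →L[ℝ] E} (hA : Continuous A)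
    (y₀ : E) :
    ∃ y : ℝ → E, y 0 = y₀ ∧ ∀ t ∈ Icc (0 : ℝ) 1, HasDerivAt y (A t (y t)) t := by
  obtain ⟨M, hM⟩ : ∃ M, ∀ t ∈ Icc (-1 : ℝ) 2, ‖A t‖ ≤ M :=
    isCompact_Icc.exists_bound_of_continuousOn hA.continuousOn
  have hM' : ∀ t ∈ Ioo (-1 : ℝ) 2, ‖A t‖ ≤ M := fun t ht => hM t (Ioo_subset_Icc_self ht)
  have hM0 : 0 ≤ M := (norm_nonneg _).trans (hM 0 (by norm_num))
  have hb : ∀ n, ∀ t ∈ Ioo (-1 : ℝ) 2,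
      ‖picardTerm A y₀ n t‖ ≤ ‖y₀‖ * ((M * 2) ^ n / n.factorial) := by
    intro n t ht
    refine (norm_picardTerm_le y₀ hM' n ht).trans ?_
    have : |t| ≤ 2 := abs_le.2 ⟨by linarith [ht.1], ht.2.le⟩
    gcongr
  have hsum : Summable fun n : ℕ => ‖y₀‖ * ((M * 2) ^ n / n.factorial) :=
    (Real.summable_pow_div_factorial (M * 2)).mul_left _
  have hs : ∀ t ∈ Ioo (-1 : ℝ) 2, Summable fun n => picardTerm A y₀ n t := fun t ht =>
    Summable.of_norm_bounded hsum fun n => hb n t ht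
  refine ⟨fun t => y₀ + ∑' n, picardTerm A y₀ (n + 1) t, ?_, ?_⟩
  · simp [picardTerm]
  · intro t ht
    have ht' : t ∈ Ioo (-1 : ℝ) 2 := ⟨by linarith [ht.1], by linarith [ht.2]⟩
    have h0 : (0 : ℝ) ∈ Ioo (-1 : ℝ) 2 := by norm_num
    have hd := hasDerivAt_tsum_of_isPreconnected (hsum.mul_left M) isOpen_Ioo
      isPreconnected_Ioo (g := fun n => picardTerm A y₀ (n + 1))
      (g' := fun n t => A t (picardTerm A y₀ n t))
      (fun n t _ => hasDerivAt_picardTerm_succ hA y₀ n t)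
      (fun n t ht => (ContinuousLinearMap.le_opNorm _ _).trans
        (mul_le_mul (hM' t ht) (hb n t ht) (norm_nonneg _) hM0))
      h0 ((summable_nat_add_iff 1).2 (hs 0 h0)) ht'
    refine (hd.const_add y₀).congr_deriv ?_
    -- The differentiated series is `A t` applied to the whole Picard series, whose zeroth term is
    -- `y₀`.
    rw [← (A t).map_tsum (hs t ht'), (hs t ht').tsum_eq_zero_add]
    rfl

end LinearODE

/-! ### The Frobenius theorem for linear systems -/

section Frobenius

open Set Filter Topology Asymptotics

variable {V E : Type*} [NormedAddCommGroup V] [NormedSpace ℝ V]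
  [NormedAddCommGroup E] [NormedSpace ℝ E]

/-- A differentiable map that vanishes at the origin and whose derivative is bounded by a continuous
multiple of the map itself vanishes identically. -/
theorem eq_zero_of_norm_fderiv_le {f : V → E} {C : V → ℝ} (hf : Differentiable ℝ f)
    (hC : Continuous C) (h0 : f 0 = 0) (h : ∀ m, ‖fderiv ℝ f m‖ ≤ C m * ‖f m‖) (m : V) :
    f m = 0 := by
  obtain ⟨B, hB⟩ : ∃ B, ∀ t ∈ Icc (0 : ℝ) 1, ‖C (t • m)‖ ≤ B :=
    isCompact_Icc.exists_bound_of_continuousOn (Continuous.continuousOn (by fun_prop))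
  have hd : ∀ t : ℝ, HasDerivAt (fun t : ℝ => f (t • m)) (fderiv ℝ f (t • m) m) t := by
    intro t
    have h1 : HasDerivAt (fun t : ℝ => t • m) m t := by
      simpa using (hasDerivAt_id t).smul_const m
    exact (hf (t • m)).hasFDerivAt.comp_hasDerivAt t h1
  have := eq_zero_of_abs_deriv_le_mul_abs_self_of_eq_zero_right (a := 0) (b := 1) (K := B * ‖m‖)
    (f := fun t : ℝ => f (t • m)) (f' := fun t => fderiv ℝ f (t • m) m)
    (fun t _ => (hd t).continuousAt.continuousWithinAt)
    (fun t _ => (hd t).hasDerivWithinAt) (by simpa using h0) ?_ 1 (by simp)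
  · simpa using this
  · intro t ht
    calc ‖fderiv ℝ f (t • m) m‖ ≤ ‖fderiv ℝ f (t • m)‖ * ‖m‖ := ContinuousLinearMap.le_opNorm _ _
      _ ≤ (C (t • m) * ‖f (t • m)‖) * ‖m‖ := by gcongr; exact h _
      _ ≤ (B * ‖f (t • m)‖) * ‖m‖ := by
        gcongr
        exact (le_abs_self _).trans (hB t (Ico_subset_Icc_self ht))
      _ = B * ‖m‖ * ‖f (t • m)‖ := by ring

/-- Uniqueness for linear systems, by Grönwall along the rays from the origin. -/
theorem eq_zero_of_linear_fderiv {f : V → E} {L : V → V →L[ℝ] E →L[ℝ] E}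
    (hf : Differentiable ℝ f) (hL : Continuous L) (h0 : f 0 = 0)
    (h : ∀ m u, fderiv ℝ f m u = L m u (f m)) (m : V) : f m = 0 := by
  refine eq_zero_of_norm_fderiv_le hf hL.norm h0 (fun m => ?_) m
  refine ContinuousLinearMap.opNorm_le_bound _ (by positivity) fun u => ?_
  rw [h, mul_right_comm]
  exact (L m).le_opNorm₂ u (f m)

/-- Curvature of the linear system `dY(u) = Θ(u) Y` vanishes. -/
def IsIntegrable (Θ : V → V →L[ℝ] E →L[ℝ] E) : Prop :=
  ∀ m u w, fderiv ℝ Θ m u w - fderiv ℝ Θ m w u = Θ m u ∘L Θ m w - Θ m w ∘L Θ m u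

/-- Two applications of the mean value inequality; the sharp factor 1/2 is not needed. The bound is
uniform on a ball because it is used along a whole ray at once. -/
theorem norm_taylor_le {F : Type*} [NormedAddCommGroup F] [NormedSpace ℝ F] {f : V → F}
    (hf : ContDiff ℝ 2 f) {R B : ℝ} (hB : ∀ z ∈ Metric.closedBall (0 : V) R,
      ‖fderiv ℝ (fderiv ℝ f) z‖ ≤ B) {p q : V} (hp : p ∈ Metric.closedBall (0 : V) R)
    (hq : q ∈ Metric.closedBall (0 : V) R) :
    ‖f q - f p - fderiv ℝ f p (q - p)‖ ≤ B * ‖q - p‖ * ‖q - p‖ := by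
  have hconv := convex_closedBall (0 : V) R
  have hseg : segment ℝ p q ⊆ Metric.closedBall (0 : V) R := hconv.segment_subset hp hq
  have hd1 : Differentiable ℝ f := hf.differentiable (by norm_num)
  have hd2 : Differentiable ℝ (fderiv ℝ f) :=
    (hf.fderiv_right (m := 1) (by norm_num)).differentiable (by norm_num)
  have hB0 : 0 ≤ B := (norm_nonneg _).trans (hB p hp)
  refine (convex_segment p q).norm_image_sub_le_of_norm_fderiv_le' (𝕜 := ℝ)
    (fun x _ => hd1 x) (fun x hx => ?_) (left_mem_segment ℝ p q) (right_mem_segment ℝ p q)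
  have h1 := hconv.norm_image_sub_le_of_norm_fderiv_le (𝕜 := ℝ) (fun x _ => hd2 x) hB hp
    (hseg hx)
  refine h1.trans ?_
  gcongr
  obtain ⟨s, t, hs, ht, hst, rfl⟩ := hx
  have : s • p + t • q - p = t • (q - p) := by
    rw [← eq_sub_iff_add_eq] at hst; subst hst; module
  rw [this, norm_smul, Real.norm_of_nonneg ht]
  exact mul_le_of_le_one_left (norm_nonneg _) (by linarith)

theorem gronwallBound_zero_left {K : ℝ} (hK : K ≠ 0) (ε x : ℝ) :
    gronwallBound 0 K ε x = ε * ((Real.exp (K * x) - 1) / K) := by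
  rw [gronwallBound_of_K_ne_0 hK]; ring

/-- The main estimate for the radial solutions `Y m` of an integrable linear system. -/
theorem exists_radial_bound [FiniteDimensional ℝ V] {Θ : V → V →L[ℝ] E →L[ℝ] E}
    (hΘ : ContDiff ℝ 2 Θ) (hflat : IsIntegrable Θ) {Y : V → ℝ → E} {y₀ : E}
    (hY0 : ∀ m, Y m 0 = y₀)
    (hY : ∀ m, ∀ t ∈ Icc (0 : ℝ) 1, HasDerivAt (Y m) (Θ (t • m) m (Y m t)) t) (m : V) :
    ∃ C, ∀ h : V, ‖h‖ ≤ 1 →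
      ‖Y (m + h) 1 - Y m 1 - Θ m h (Y m 1)‖ ≤ C * (‖h‖ * ‖h‖) := by
  have : ProperSpace V := FiniteDimensional.proper ℝ V
  have hd1 : Differentiable ℝ Θ := hΘ.differentiable (by norm_num)
  have hc1 : ContDiff ℝ 1 (fderiv ℝ Θ) := hΘ.fderiv_right (by norm_num)
  have hc2 : Continuous (fderiv ℝ (fderiv ℝ Θ)) := (hc1.continuous_fderiv (by norm_num))
  -- The rays to `m` and to `m + h` with `‖h‖ ≤ 1` stay in the ball of radius `R`.
  set R := ‖m‖ + 1 with hR
  have hR1 : 1 ≤ R := by simp [hR]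
  have hcomp := isCompact_closedBall (0 : V) R
  obtain ⟨B0, hB0⟩ := hcomp.exists_bound_of_continuousOn hΘ.continuous.continuousOn
  obtain ⟨B1, hB1⟩ := hcomp.exists_bound_of_continuousOn hc1.continuous.continuousOn
  obtain ⟨B2, hB2⟩ := hcomp.exists_bound_of_continuousOn hc2.continuousOn
  obtain ⟨N, hN⟩ : ∃ N, ∀ t ∈ Icc (0 : ℝ) 1, ‖Y m t‖ ≤ N :=
    isCompact_Icc.exists_bound_of_continuousOn
      fun t ht => (hY m t ht).continuousAt.continuousWithinAt
  set M := max (max B0 B1) (max B2 1) with hMdef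
  have hM1 : 1 ≤ M := (le_max_right _ _).trans (le_max_right _ _)
  have hM0 : 0 < M := by linarith
  have hN0 : 0 ≤ N := (norm_nonneg _).trans (hN 0 (by simp))
  replace hB0 : ∀ z ∈ Metric.closedBall (0 : V) R, ‖Θ z‖ ≤ M := fun z hz =>
    (hB0 z hz).trans ((le_max_left _ _).trans (le_max_left _ _))
  replace hB1 : ∀ z ∈ Metric.closedBall (0 : V) R, ‖fderiv ℝ Θ z‖ ≤ M := fun z hz =>
    (hB1 z hz).trans ((le_max_right _ _).trans (le_max_left _ _))
  replace hB2 : ∀ z ∈ Metric.closedBall (0 : V) R, ‖fderiv ℝ (fderiv ℝ Θ) z‖ ≤ M := fun z hz =>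
    (hB2 z hz).trans ((le_max_left _ _).trans (le_max_right _ _))
  set ε := (M + M * R + 2 * M * R * M) * N with hε
  set K := M * R with hK
  have hK0 : K ≠ 0 := by positivity
  refine ⟨ε * ((Real.exp (K * 1) - 1) / K), fun h hh => ?_⟩
  -- For an integrable system `t • Θ (t • m) h (Y m t)` is the first variation of the radial
  -- solution in the direction `h`, so `W` should be of second order in `h`.
  set W : ℝ → E := fun t => Y (m + h) t - Y m t - t • Θ (t • m) h (Y m t) with hW
  set W' : ℝ → E := fun t => Θ (t • (m + h)) (m + h) (Y (m + h) t) - Θ (t • m) m (Y m t) -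
    (t • (fderiv ℝ Θ (t • m) m h (Y m t) + Θ (t • m) h (Θ (t • m) m (Y m t))) +
      Θ (t • m) h (Y m t)) with hW'
  have hWd : ∀ t ∈ Icc (0 : ℝ) 1, HasDerivAt W (W' t) t := by
    intro t ht
    have h1 : HasDerivAt (fun t : ℝ => t • m) m t := by
      simpa using (hasDerivAt_id t).smul_const m
    have h2 : HasDerivAt (fun t : ℝ => Θ (t • m)) (fderiv ℝ Θ (t • m) m) t :=
      (hd1 (t • m)).hasFDerivAt.comp_hasDerivAt t h1
    have h3 : HasDerivAt (fun t : ℝ => Θ (t • m) h) (fderiv ℝ Θ (t • m) m h) t := by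
      simpa using h2.clm_apply (hasDerivAt_const t h)
    have h4 := (hasDerivAt_id t).smul (h3.clm_apply (hY m t ht))
    refine (((hY (m + h) t ht).sub (hY m t ht)).sub h4).congr_deriv ?_
    simp [hW']
  have hWb : ∀ t ∈ Ico (0 : ℝ) 1, ‖W' t‖ ≤ K * ‖W t‖ + ε * (‖h‖ * ‖h‖) := by
    intro t ht'
    have ht := Ico_subset_Icc_self ht'
    have ht0 : |t| ≤ 1 := by rw [abs_of_nonneg ht.1]; exact ht.2
    have hmh : ‖m + h‖ ≤ R := (norm_add_le _ _).trans (by simpa [hR] using hh)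
    have hp : t • m ∈ Metric.closedBall (0 : V) R := by
      rw [mem_closedBall_zero_iff, norm_smul]
      calc |t| * ‖m‖ ≤ 1 * ‖m‖ := by gcongr
        _ ≤ R := by simp [hR]
    have hq : t • (m + h) ∈ Metric.closedBall (0 : V) R := by
      rw [mem_closedBall_zero_iff, norm_smul]
      calc |t| * ‖m + h‖ ≤ 1 * R := by gcongr
        _ = R := one_mul R
    have hqp : t • (m + h) - t • m = t • h := by module
    have hth : ‖t • h‖ ≤ ‖h‖ := by
      rw [norm_smul]; exact mul_le_of_le_one_left (norm_nonneg _) ht0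
    set p := t • m
    set q := t • (m + h)
    have hRem : ‖Θ q - Θ p - fderiv ℝ Θ p (t • h)‖ ≤ M * (‖h‖ * ‖h‖) := by
      have := norm_taylor_le hΘ hB2 hp hq
      rw [hqp] at this
      refine this.trans ?_
      rw [mul_assoc]
      gcongr
    have hLip : ‖Θ q - Θ p‖ ≤ M * ‖h‖ := by
      have := (convex_closedBall (0 : V) R).norm_image_sub_le_of_norm_fderiv_le (𝕜 := ℝ)
        (fun x _ => hd1 x) hB1 hp hq
      rw [hqp] at this
      exact this.trans (by gcongr)
    -- Integrability enters only here, to exchange `m` and `h`. With it the first-order terms of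
    -- `W'` cancel: `W` solves the linear equation along the ray to `m + h` up to an error quadratic
    -- in `h`.
    have hfl : fderiv ℝ Θ p m h = fderiv ℝ Θ p h m + Θ p m ∘L Θ p h - Θ p h ∘L Θ p m := by
      have := hflat p m h
      rw [sub_eq_iff_eq_add] at this
      rw [this]; abel
    have key : W' t = Θ q (m + h) (W t) +
        (t • fderiv ℝ Θ p h h + (Θ q - Θ p - fderiv ℝ Θ p (t • h)) (m + h) +
          t • ((Θ q h + (Θ q - Θ p) m) ∘L Θ p h)) (Y m t) := by
      have hWt : W t = Y (m + h) t - Y m t - t • Θ p h (Y m t) := rfl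
      have hWt' : W' t = Θ q (m + h) (Y (m + h) t) - Θ p m (Y m t) -
        (t • (fderiv ℝ Θ p m h (Y m t) + Θ p h (Θ p m (Y m t))) + Θ p h (Y m t)) := rfl
      rw [hWt, hWt', hfl]
      simp only [map_sub, map_add, map_smul, add_apply, sub_apply, smul_apply,
        ContinuousLinearMap.comp_apply]
      module
    rw [key]
    have e1 : ‖Θ q (m + h) (W t)‖ ≤ K * ‖W t‖ := by
      refine ((Θ q).le_opNorm₂ _ _).trans ?_
      rw [hK]
      gcongr
      exact hB0 q hq
    have e2 : ‖t • fderiv ℝ Θ p h h‖ ≤ M * (‖h‖ * ‖h‖) := by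
      rw [norm_smul]
      calc |t| * ‖fderiv ℝ Θ p h h‖ ≤ 1 * (M * ‖h‖ * ‖h‖) := by
            gcongr
            refine ((fderiv ℝ Θ p).le_opNorm₂ _ _).trans ?_
            gcongr
            exact hB1 p hp
        _ = _ := by ring
    have e3 : ‖(Θ q - Θ p - fderiv ℝ Θ p (t • h)) (m + h)‖ ≤ M * R * (‖h‖ * ‖h‖) := by
      refine (ContinuousLinearMap.le_opNorm _ _).trans ?_
      calc _ ≤ (M * (‖h‖ * ‖h‖)) * R := by gcongr
        _ = _ := by ring
    have e4 : ‖t • ((Θ q h + (Θ q - Θ p) m) ∘L Θ p h)‖ ≤ 2 * M * R * M * (‖h‖ * ‖h‖) := by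
      rw [norm_smul]
      have f1 : ‖Θ q h‖ ≤ M * ‖h‖ := ((Θ q).le_opNorm h).trans (by gcongr; exact hB0 q hq)
      have f2 : ‖Θ p h‖ ≤ M * ‖h‖ := ((Θ p).le_opNorm h).trans (by gcongr; exact hB0 p hp)
      have f3 : ‖(Θ q - Θ p) m‖ ≤ M * ‖h‖ * R :=
        ((Θ q - Θ p).le_opNorm m).trans (by gcongr; simp [hR])
      have f4 : ‖Θ q h + (Θ q - Θ p) m‖ ≤ 2 * M * R * ‖h‖ := by
        refine (norm_add_le _ _).trans ?_
        have : M * ‖h‖ ≤ M * ‖h‖ * R := le_mul_of_one_le_right (by positivity) hR1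
        linarith
      calc |t| * ‖(Θ q h + (Θ q - Θ p) m) ∘L Θ p h‖
          ≤ 1 * ((2 * M * R * ‖h‖) * (M * ‖h‖)) := by
            gcongr
            exact (ContinuousLinearMap.opNorm_comp_le _ _).trans (by gcongr)
        _ = _ := by ring
    refine (norm_add_le _ _).trans (add_le_add e1 ?_)
    refine (ContinuousLinearMap.le_opNorm _ _).trans ?_
    calc _ ≤ (M * (‖h‖ * ‖h‖) + M * R * (‖h‖ * ‖h‖) + 2 * M * R * M * (‖h‖ * ‖h‖)) * N := by
          gcongr
          · exact norm_add₃_le.trans (by gcongr)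
          · exact hN t ht
      _ = _ := by rw [hε]; ring
  have hfin := norm_le_gronwallBound_of_norm_deriv_right_le (δ := 0)
    (fun t ht => (hWd t ht).continuousAt.continuousWithinAt)
    (fun t ht => (hWd t (Ico_subset_Icc_self ht)).hasDerivWithinAt)
    (by simp [hW, hY0]) hWb 1 (by simp)
  rw [gronwallBound_zero_left hK0] at hfin
  simp only [hW, one_smul, sub_zero] at hfin
  refine hfin.trans_eq ?_
  ring

/-- **Frobenius theorem** for linear systems: an integrable system `dY(u) = Θ(u) Y` on a
finite-dimensional space has a smooth global solution with any prescribed value at the origin. -/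
theorem exists_solution_of_isIntegrable [FiniteDimensional ℝ V] [CompleteSpace E]
    {Θ : V → V →L[ℝ] E →L[ℝ] E} (hΘ : ContDiff ℝ ∞ Θ) (hflat : IsIntegrable Θ) (y₀ : E) :
    ∃ Y : V → E, ContDiff ℝ ∞ Y ∧ Y 0 = y₀ ∧ ∀ m u, fderiv ℝ Y m u = Θ m u (Y m) := by
  have hsol : ∀ m : V, ∃ y : ℝ → E, y 0 = y₀ ∧
      ∀ t ∈ Icc (0 : ℝ) 1, HasDerivAt y (Θ (t • m) m (y t)) t := fun m =>
    exists_linearODE_solution (A := fun t => Θ (t • m) m)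
      (by have := hΘ.continuous; fun_prop) y₀
  choose Y hY0 hY using hsol
  have hder : ∀ m, HasFDerivAt (fun m => Y m 1) ((Θ m).flip (Y m 1)) m := by
    intro m
    obtain ⟨C, hC⟩ := exists_radial_bound (hΘ.of_le (by norm_cast)) hflat hY0 hY m
    rw [hasFDerivAt_iff_isLittleO_nhds_zero]
    have h1 : (fun h => Y (m + h) 1 - Y m 1 - (Θ m).flip (Y m 1) h) =O[𝓝 0]
        fun h : V => ‖h‖ * ‖h‖ := by
      refine IsBigO.of_bound C ?_
      filter_upwards [Metric.closedBall_mem_nhds (0 : V) one_pos] with h hh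
      rw [mem_closedBall_zero_iff] at hh
      simpa using hC h hh
    refine h1.trans_isLittleO ?_
    have h2 : (fun h : V => ‖h‖) =o[𝓝 0] fun _ => (1 : ℝ) := by
      rw [isLittleO_one_iff]
      simpa using (continuous_norm (E := V)).tendsto 0
    have h3 := h2.mul_isBigO (isBigO_refl (fun h : V => ‖h‖) (𝓝 0))
    simp only [one_mul] at h3
    exact h3.of_norm_right
  have hfd : ∀ m u, fderiv ℝ (fun m => Y m 1) m u = Θ m u (Y m 1) := fun m u => by
    rw [(hder m).fderiv]; rfl
  refine ⟨fun m => Y m 1, ?_, ?_, hfd⟩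
  -- The equation expresses the derivative through the solution itself, so each order of smoothness
  -- yields the next.
  · rw [contDiff_infty]
    intro n
    induction n with
    | zero =>
      exact contDiff_zero.2 (continuous_iff_continuousAt.2 fun m => (hder m).continuousAt)
    | succ n ih =>
      refine (contDiff_succ_iff_fderiv (n := (n : WithTop ℕ∞))).2
        ⟨fun m => (hder m).differentiableAt, by simp, ?_⟩
      have : fderiv ℝ (fun m => Y m 1) = fun m => (Θ m).flip (Y m 1) :=
        funext fun m => (hder m).fderiv
      rw [this]
      have hΘn : ContDiff ℝ n Θ := hΘ.of_le (by exact_mod_cast le_top)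
      have : ContDiff ℝ n fun m => (Θ m).flip :=
        (ContinuousLinearMap.flipₗᵢ ℝ V E E).contDiff.comp hΘn
      exact this.clm_apply ih
  -- On the degenerate ray `m = 0` the radial equation has zero right-hand side.
  · have hc : ∀ t ∈ Icc (0 : ℝ) 1, HasDerivWithinAt (Y 0) 0 (Icc 0 1) t := fun t ht => by
      simpa using (hY 0 t ht).hasDerivWithinAt
    have := (convex_Icc (0 : ℝ) 1).is_const_of_fderivWithin_eq_zero (𝕜 := ℝ) (f := Y 0)
      (fun t ht => (hc t ht).differentiableWithinAt) (fun t ht => by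
        ext
        rw [(hc t ht).hasFDerivWithinAt.fderivWithin (uniqueDiffOn_Icc one_pos t ht)]
        simp) (x := 1) (y := 0)
        (by simp) (by simp)
    exact this.trans (hY0 0)

end Frobenius

/-! ### Identities of the octonionic cross product -/

section Octonions

open Matrix

theorem act_apply (A : Mat7) (u : R7) (i : Fin 7) : act A u i = ∑ j, A i j * u j := rfl

theorem act_mul (A B : Mat7) (u : R7) : act (A * B) u = act A (act B u) := by
  ext i; simp [act, Matrix.mulVec_mulVec]

@[simp] theorem act_one (u : R7) : act 1 u = u := by
  ext i; simp [act]

theorem act_add (A B : Mat7) (u : R7) : act (A + B) u = act A u + act B u := by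
  simp [act]

theorem act_sub (A B : Mat7) (u : R7) : act (A - B) u = act A u - act B u := by
  simp [act]

theorem act_neg (A : Mat7) (u : R7) : act (-A) u = -act A u := by
  simp [act]

theorem act_smul (c : ℝ) (A : Mat7) (u : R7) : act (c • A) u = c • act A u := by
  simp [act]

theorem act_injective {A B : Mat7} (h : ∀ u, act A u = act B u) : A = B :=
  (Matrix.toEuclideanLin (𝕜 := ℝ) (m := Fin 7) (n := Fin 7)).injective (LinearMap.ext h)

theorem inner_eq_sum (u v : R7) : inner ℝ u v = ∑ i, u i * v i := by
  simp [PiLp.inner_apply, mul_comm]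

theorem inner_act (A : Mat7) (u v : R7) : inner ℝ (act A u) v = inner ℝ u (act Aᵀ v) := by
  simp only [inner_eq_sum, act_apply, Finset.sum_mul, Finset.mul_sum, Matrix.transpose_apply]
  rw [Finset.sum_comm]
  exact Finset.sum_congr rfl fun i _ => Finset.sum_congr rfl fun j _ => by ring

theorem cross_add_left (u u' v : R7) : cross (u + u') v = cross u v + cross u' v := by
  ext i; fin_cases i <;> simp [cross] <;> ring

theorem cross_smul_left (c : ℝ) (u v : R7) : cross (c • u) v = c • cross u v := by
  ext i; fin_cases i <;> simp [cross] <;> ring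

theorem cross_swap (u v : R7) : cross u v = -cross v u := by
  ext i; fin_cases i <;> simp [cross] <;> ring

theorem cross_add_right (u v v' : R7) : cross u (v + v') = cross u v + cross u v' := by
  rw [cross_swap, cross_add_left, cross_swap v, cross_swap v', neg_add, neg_neg, neg_neg]

theorem cross_smul_right (c : ℝ) (u v : R7) : cross u (c • v) = c • cross u v := by
  rw [cross_swap, cross_smul_left, cross_swap v, smul_neg, neg_neg]

/-- The cross product as a bilinear map. -/
def crossₗ : R7 →ₗ[ℝ] R7 →ₗ[ℝ] R7 :=
  LinearMap.mk₂ ℝ cross cross_add_left cross_smul_left cross_add_right cross_smul_right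

@[simp] theorem crossₗ_apply (u v : R7) : crossₗ u v = cross u v := rfl

@[simp] theorem cross_self (u : R7) : cross u u = 0 := by
  ext i; fin_cases i <;> simp [cross] <;> ring

theorem cross_neg_left (u v : R7) : cross (-u) v = -cross u v := (crossₗ.flip v).map_neg u

theorem cross_neg_right (u v : R7) : cross u (-v) = -cross u v := (crossₗ u).map_neg v

theorem cross_sub_left (u u' v : R7) : cross (u - u') v = cross u v - cross u' v :=
  (crossₗ.flip v).map_sub u u'

theorem cross_sub_right (u v v' : R7) : cross u (v - v') = cross u v - cross u v' :=
  (crossₗ u).map_sub v v'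

@[simp] theorem cross_zero_left (v : R7) : cross 0 v = 0 := (crossₗ.flip v).map_zero

@[simp] theorem cross_zero_right (v : R7) : cross v 0 = 0 := (crossₗ v).map_zero

/-- This is the alternating three-form of the octonions; that `u × v` is orthogonal to both factors
follows formally. -/
theorem inner_cross_cyclic (u v w : R7) : inner ℝ (cross u v) w = inner ℝ (cross v w) u := by
  simp [inner_eq_sum, Fin.sum_univ_succ, cross]; ring

theorem inner_cross_self_left (u v : R7) : inner ℝ (cross u v) u = 0 := by
  rw [inner_cross_cyclic, inner_cross_cyclic, cross_self, inner_zero_left]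

theorem inner_cross_self_right (u v : R7) : inner ℝ (cross u v) v = 0 := by
  rw [inner_cross_cyclic, cross_self, inner_zero_left]

/-- The alternative law `u(uw) = u²w`, polarized in `u`. The abstract computations with cross
products rest on it and on the alternating three-form. -/
theorem cross_cross_add (u v w : R7) : cross u (cross v w) + cross v (cross u w) =
    (-2 * inner ℝ u v) • w + inner ℝ u w • v + inner ℝ v w • u := by
  simp only [inner_eq_sum, Fin.sum_univ_seven]
  ext i; fin_cases i <;> simp [cross] <;> ring

theorem cross_cross_self (u w : R7) :
    cross u (cross u w) = (-inner ℝ u u) • w + inner ℝ u w • u := by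
  have h := cross_cross_add u u w
  have h2 : (2 : ℝ) • cross u (cross u w) = (2 : ℝ) • ((-inner ℝ u u) • w + inner ℝ u w • u) := by
    rw [two_smul, h]; module
  exact smul_right_injective _ (two_ne_zero (α := ℝ)) h2

theorem inner_cross_cross (u v w : R7) : inner ℝ (cross u v) (cross u w) =
    inner ℝ u u * inner ℝ v w - inner ℝ u v * inner ℝ u w := by
  rw [inner_cross_cyclic, inner_cross_cyclic, cross_swap, inner_neg_left, cross_cross_self,
    inner_add_left, real_inner_smul_left, real_inner_smul_left, real_inner_comm w v]
  ring

end Octonions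

/-! ### Closure properties of `G₂` and `𝔤₂` -/

section Groups

open Matrix

theorem transpose_mul_self_of_mem_G2 {g : Mat7} (hg : g ∈ G2) : gᵀ * g = 1 :=
  (Matrix.mem_orthogonalGroup_iff' _ _).1 hg.1

theorem mul_transpose_self_of_mem_G2 {g : Mat7} (hg : g ∈ G2) : g * gᵀ = 1 :=
  (Matrix.mem_orthogonalGroup_iff _ _).1 hg.1

theorem act_transpose_act {g : Mat7} (hg : g ∈ G2) (u : R7) : act gᵀ (act g u) = u := by
  rw [← act_mul, transpose_mul_self_of_mem_G2 hg, act_one]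

theorem act_act_transpose {g : Mat7} (hg : g ∈ G2) (u : R7) : act g (act gᵀ u) = u := by
  rw [← act_mul, mul_transpose_self_of_mem_G2 hg, act_one]

theorem inner_act_act {g : Mat7} (hg : g ∈ G2) (u v : R7) :
    inner ℝ (act g u) (act g v) = inner ℝ u v := by
  rw [inner_act, act_transpose_act hg]

theorem one_mem_G2 : (1 : Mat7) ∈ G2 := ⟨one_mem _, fun u v => by simp⟩

theorem mul_mem_G2 {g h : Mat7} (hg : g ∈ G2) (hh : h ∈ G2) : g * h ∈ G2 :=
  ⟨mul_mem hg.1 hh.1, fun u v => by rw [act_mul, hh.2, hg.2, act_mul, act_mul]⟩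

theorem transpose_mem_G2 {g : Mat7} (hg : g ∈ G2) : gᵀ ∈ G2 := by
  refine ⟨?_, fun u v => ?_⟩
  · rw [Matrix.mem_orthogonalGroup_iff]
    simpa using transpose_mul_self_of_mem_G2 hg
  · have h := hg.2 (act gᵀ u) (act gᵀ v)
    rw [act_act_transpose hg, act_act_transpose hg] at h
    rw [← h, act_transpose_act hg]

theorem zero_mem_g2 : (0 : Mat7) ∈ g2 := ⟨by simp, fun u v => by simp [act]⟩

theorem add_mem_g2 {A B : Mat7} (hA : A ∈ g2) (hB : B ∈ g2) : A + B ∈ g2 :=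
  ⟨by rw [Matrix.transpose_add, hA.1, hB.1, neg_add], fun u v => by
    rw [act_add, act_add, act_add, hA.2, hB.2, cross_add_left, cross_add_right]; abel⟩

theorem smul_mem_g2 (c : ℝ) {A : Mat7} (hA : A ∈ g2) : c • A ∈ g2 :=
  ⟨by rw [Matrix.transpose_smul, hA.1, smul_neg], fun u v => by
    rw [act_smul, act_smul, act_smul, hA.2, cross_smul_left, cross_smul_right, smul_add]⟩

/-- `𝔤₂` as a subspace of the space of matrices. -/
def g2Submodule : Submodule ℝ Mat7 where
  carrier := g2
  add_mem' := add_mem_g2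
  zero_mem' := zero_mem_g2
  smul_mem' c _ hA := smul_mem_g2 c hA

theorem neg_mem_g2 {A : Mat7} (hA : A ∈ g2) : -A ∈ g2 := g2Submodule.neg_mem hA

theorem sub_mem_g2 {A B : Mat7} (hA : A ∈ g2) (hB : B ∈ g2) : A - B ∈ g2 :=
  g2Submodule.sub_mem hA hB

theorem lie_mem_g2 {A B : Mat7} (hA : A ∈ g2) (hB : B ∈ g2) : ⁅A, B⁆ ∈ g2 := by
  rw [Ring.lie_def]
  refine ⟨?_, fun u v => ?_⟩
  · rw [Matrix.transpose_sub, Matrix.transpose_mul, Matrix.transpose_mul, hA.1, hB.1]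
    simp
  · simp only [act_sub, act_mul, hA.2, hB.2, map_add, cross_sub_left, cross_sub_right]
    abel

theorem conj_mem_g2 {g A : Mat7} (hg : g ∈ G2) (hA : A ∈ g2) : gᵀ * A * g ∈ g2 := by
  refine ⟨?_, fun u v => ?_⟩
  · rw [Matrix.transpose_mul, Matrix.transpose_mul, hA.1, Matrix.transpose_transpose]
    simp [Matrix.mul_assoc]
  · have h := (transpose_mem_G2 hg).2
    simp only [act_mul, hg.2, hA.2, map_add, h, act_transpose_act hg]

theorem conj_mem_g2' {g A : Mat7} (hg : g ∈ G2) (hA : A ∈ g2) : g * A * gᵀ ∈ g2 := by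
  simpa using conj_mem_g2 (transpose_mem_G2 hg) hA

end Groups

/-! ### Restricted root decomposition of `𝔤₂` with respect to `b₁, b₂` -/

section RootCoordinates

open Matrix

/-- The linear part of `b i`. -/
def b7 (i : Fin 2) : Mat7 :=
  Matrix.reindex finSumFinEquiv finSumFinEquiv
    (Matrix.fromBlocks 0 (-(a i).transpose) (a i) 0)

/-- Coordinates on the isotropy algebra `𝔰𝔬(4)`, adapted to the root spaces of `b₁, b₂`. -/
def kMat (s : Fin 6 → ℝ) : Mat7 :=
  !![0, 2 * s 0, s 1 - s 4, -s 2 + s 3, 0, 0, 0;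
     -(2 * s 0), 0, 2 * s 2, 2 * s 1, 0, 0, 0;
     -s 1 + s 4, -(2 * s 2), 0, -s 0 + s 5, 0, 0, 0;
     s 2 - s 3, -(2 * s 1), s 0 - s 5, 0, 0, 0, 0;
     0, 0, 0, 0, 0, s 2 + s 3, s 1 + s 4;
     0, 0, 0, 0, -s 2 - s 3, 0, s 0 + s 5;
     0, 0, 0, 0, -s 1 - s 4, -s 0 - s 5, 0]

/-- Coordinates on the complement `𝔭` of `𝔰𝔬(4)` in `𝔤₂`: `h` are the coordinates on the span of
`b₁, b₂` and `t` the coordinates on the root spaces. -/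
def pMat (h : Fin 2 → ℝ) (t : Fin 6 → ℝ) : Mat7 :=
  !![0, 0, 0, 0, -h 0, t 2 + t 3, -t 1 + t 4;
     0, 0, 0, 0, 2 * t 0, -(2 * t 1), -(2 * t 2);
     0, 0, 0, 0, -t 1 - t 4, -t 0 - t 5, -h 0 - h 1;
     0, 0, 0, 0, -t 2 + t 3, -h 1, -t 0 + t 5;
     h 0, -(2 * t 0), t 1 + t 4, t 2 - t 3, 0, 0, 0;
     -t 2 - t 3, 2 * t 1, t 0 + t 5, h 1, 0, 0, 0;
     t 1 - t 4, 2 * t 2, h 0 + h 1, t 0 - t 5, 0, 0, 0]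

/-- The values of the roots on `b₁` and `b₂`. -/
def root : Fin 2 → Fin 6 → ℝ := ![![1, 0, 1, 1, 2, 1], ![0, 1, 1, -1, 1, 2]]

/-- The coordinates of the `𝔰𝔬(4)`-part of an element of `𝔤₂`. -/
def kCoord : Mat7 →ₗ[ℝ] (Fin 6 → ℝ) where
  toFun A := ![A 0 1 / 2, A 1 3 / 2, A 1 2 / 2, A 4 5 - A 1 2 / 2, A 4 6 - A 1 3 / 2,
    A 5 6 - A 0 1 / 2]
  map_add' A B := by ext i; fin_cases i <;> simp <;> ring
  map_smul' c A := by ext i; fin_cases i <;> simp <;> ring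

/-- The coordinates of an element of `𝔤₂` with respect to `b₁, b₂`. -/
def hCoord : Mat7 →ₗ[ℝ] (Fin 2 → ℝ) where
  toFun A := ![A 4 0, A 5 3]
  map_add' A B := by ext i; fin_cases i <;> simp
  map_smul' c A := by ext i; fin_cases i <;> simp

/-- The coordinates of the `𝔭`-part of an element of `𝔤₂` along the root spaces. -/
def tCoord : Mat7 →ₗ[ℝ] (Fin 6 → ℝ) where
  toFun A := ![A 1 4 / 2, -A 1 5 / 2, -A 1 6 / 2, A 0 5 + A 1 6 / 2, A 0 6 - A 1 5 / 2,
    A 3 6 + A 1 4 / 2]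
  map_add' A B := by ext i; fin_cases i <;> simp <;> ring
  map_smul' c A := by ext i; fin_cases i <;> simp <;> ring

theorem b7_eq_pMat (i : Fin 2) : b7 i = pMat (Pi.single i 1) 0 := by
  fin_cases i <;> ext j k <;> fin_cases j <;> fin_cases k <;>
    simp [b7, pMat, a, finSumFinEquiv, Fin.addCases]

theorem kMat_mem_g2 (s : Fin 6 → ℝ) : kMat s ∈ g2 := by
  refine ⟨?_, fun u v => ?_⟩
  · ext j k; fin_cases j <;> fin_cases k <;> simp [kMat] <;> ring
  · ext j
    fin_cases j <;> simp [act_apply, Fin.sum_univ_seven, kMat, cross] <;> ring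

theorem pMat_mem_g2 (h : Fin 2 → ℝ) (t : Fin 6 → ℝ) : pMat h t ∈ g2 := by
  refine ⟨?_, fun u v => ?_⟩
  · ext j k; fin_cases j <;> fin_cases k <;> simp [pMat] <;> ring
  · ext j
    fin_cases j <;> simp [act_apply, Fin.sum_univ_seven, pMat, cross] <;> ring

theorem apply_swap_of_mem_g2 {A : Mat7} (hA : A ∈ g2) (i j : Fin 7) : A j i = -A i j :=
  congrFun (congrFun hA.1 i) j

/-- The seven linear relations that cut out `𝔤₂` in `𝔰𝔬(7)`. -/
theorem relations_of_mem_g2 {A : Mat7} (hA : A ∈ g2) :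
    -A 1 4 - A 2 5 - A 3 6 = 0 ∧ A 0 4 - A 2 6 + A 3 5 = 0 ∧ A 0 5 + A 1 6 - A 3 4 = 0 ∧
    A 0 6 - A 1 5 + A 2 4 = 0 ∧ -A 0 1 - A 2 3 + A 5 6 = 0 ∧ -A 0 2 + A 1 3 - A 4 6 = 0 ∧
    -A 0 3 - A 1 2 + A 4 5 = 0 := by
  have hd (i j k : Fin 7) := congrArg (fun w : R7 => w k)
    (hA.2 (EuclideanSpace.single i 1) (EuclideanSpace.single j 1))
  have hs := apply_swap_of_mem_g2 hA
  refine ⟨?_, ?_, ?_, ?_, ?_, ?_, ?_⟩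
  · have h := hd 1 2 3
    simp [Matrix.mulVec, dotProduct, Fin.sum_univ_seven, cross] at h
    linarith [hs 1 4, hs 2 5, hs 3 6]
  · have h := hd 0 2 3
    simp [Matrix.mulVec, dotProduct, Fin.sum_univ_seven, cross] at h
    linarith [hs 0 4, hs 2 6, hs 3 5]
  · have h := hd 0 1 3
    simp [Matrix.mulVec, dotProduct, Fin.sum_univ_seven, cross] at h
    linarith [hs 0 5, hs 1 6, hs 3 4]
  · have h := hd 0 1 2
    simp [Matrix.mulVec, dotProduct, Fin.sum_univ_seven, cross] at h
    linarith [hs 0 6, hs 1 5, hs 2 4]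
  · have h := hd 0 2 6
    simp [Matrix.mulVec, dotProduct, Fin.sum_univ_seven, cross] at h
    linarith [hs 0 1, hs 2 3, hs 5 6]
  · have h := hd 0 1 6
    simp [Matrix.mulVec, dotProduct, Fin.sum_univ_seven, cross] at h
    linarith [hs 0 2, hs 1 3, hs 4 6]
  · have h := hd 0 1 5
    simp [Matrix.mulVec, dotProduct, Fin.sum_univ_seven, cross] at h
    linarith [hs 0 3, hs 1 2, hs 4 5]

theorem ext_of_skew {A B : Mat7} (hA : Aᵀ = -A) (hB : Bᵀ = -B)
    (h : ∀ i j, i < j → A i j = B i j) : A = B := by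
  have hs : ∀ {C : Mat7}, Cᵀ = -C → ∀ i j, C j i = -C i j := fun hC i j =>
    congrFun (congrFun hC i) j
  ext i j
  rcases lt_trichotomy i j with hij | rfl | hij
  · exact h i j hij
  · have := hs hA i i
    have := hs hB i i
    linarith
  · rw [hs hA j i, hs hB j i, h j i hij]

/-- A skew matrix has 21 free entries and the seven relations leave 14, which is the number `6 + 2 +
6` of coordinates. -/
theorem eq_kMat_add_pMat {A : Mat7} (hA : A ∈ g2) :
    A = kMat (kCoord A) + pMat (hCoord A) (tCoord A) := by
  obtain ⟨h0, h1, h2, h3, h4, h5, h6⟩ := relations_of_mem_g2 hA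
  have hs := apply_swap_of_mem_g2 hA
  refine ext_of_skew hA.1 (add_mem_g2 (kMat_mem_g2 _) (pMat_mem_g2 _ _)).1 fun i j hij => ?_
  fin_cases i <;> fin_cases j <;>
    first
    | exact absurd hij (by decide)
    | (simp [kMat, pMat, kCoord, hCoord, tCoord] <;> linarith [hs 0 4, hs 3 5])

theorem S7_mul_kMat (s : Fin 6 → ℝ) : S7 * kMat s = kMat s * S7 := by
  ext i j
  rw [S7, Matrix.diagonal_mul, Matrix.mul_diagonal]
  fin_cases i <;> fin_cases j <;> simp [kMat]

theorem S7_mul_pMat (h : Fin 2 → ℝ) (t : Fin 6 → ℝ) : S7 * pMat h t = -(pMat h t * S7) := by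
  ext i j
  rw [S7, Matrix.neg_apply, Matrix.diagonal_mul, Matrix.mul_diagonal]
  fin_cases i <;> fin_cases j <;> (simp [pMat]; try ring)

theorem S7_mul_S7 : S7 * S7 = 1 := by
  ext i j
  rw [S7, Matrix.diagonal_mul_diagonal]
  fin_cases i <;> fin_cases j <;> simp

theorem S7_mul_apply (A : Mat7) (i j : Fin 7) :
    (S7 * A) i j = ![-1, -1, -1, -1, 1, 1, 1] i * A i j := by
  rw [S7, Matrix.diagonal_mul]

theorem mul_S7_apply (A : Mat7) (i j : Fin 7) :
    (A * S7) i j = A i j * ![-1, -1, -1, -1, 1, 1, 1] j := by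
  rw [S7, Matrix.mul_diagonal]

/-- Commuting with `S7` kills the blocks between ℝ⁴ and ℝ³, from which `hCoord` and `tCoord` are
read off. -/
theorem eq_kMat {A : Mat7} (hA : A ∈ g2) (h : S7 * A = A * S7) : A = kMat (kCoord A) := by
  have hz (i j : Fin 7) := congrFun (congrFun h i) j
  simp only [S7_mul_apply, mul_S7_apply] at hz
  have h0 : hCoord A = 0 := by
    have h1 := hz 4 0
    have h2 := hz 5 3
    simp at h1 h2
    ext i; fin_cases i <;> simp [hCoord] <;> linarith
  have h1 : tCoord A = 0 := by
    have h1 := hz 1 4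
    have h2 := hz 1 5
    have h3 := hz 1 6
    have h4 := hz 0 5
    have h5 := hz 0 6
    have h6 := hz 3 6
    simp at h1 h2 h3 h4 h5 h6
    ext i; fin_cases i <;> simp [tCoord] <;> linarith
  conv_lhs => rw [eq_kMat_add_pMat hA, h0, h1]
  simp only [add_eq_left]
  ext i j; fin_cases i <;> fin_cases j <;> simp [pMat]

theorem eq_pMat {A : Mat7} (hA : A ∈ g2) (h : S7 * A = -(A * S7)) :
    A = pMat (hCoord A) (tCoord A) := by
  have hz (i j : Fin 7) := congrFun (congrFun h i) j
  simp only [S7_mul_apply, mul_S7_apply, Matrix.neg_apply] at hz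
  have h0 : kCoord A = 0 := by
    have h1 := hz 0 1
    have h2 := hz 1 3
    have h3 := hz 1 2
    have h4 := hz 4 5
    have h5 := hz 4 6
    have h6 := hz 5 6
    simp at h1 h2 h3 h4 h5 h6
    ext i; fin_cases i <;> simp [kCoord] <;> linarith
  conv_lhs => rw [eq_kMat_add_pMat hA, h0]
  simp only [add_eq_right]
  ext i j; fin_cases i <;> fin_cases j <;> simp [kMat]

theorem tCoord_pMat (h : Fin 2 → ℝ) (t : Fin 6 → ℝ) : tCoord (pMat h t) = t := by
  ext i; fin_cases i <;> simp [tCoord, pMat] <;> ring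

theorem hCoord_pMat (h : Fin 2 → ℝ) (t : Fin 6 → ℝ) : hCoord (pMat h t) = h := by
  ext i; fin_cases i <;> simp [hCoord, pMat]

theorem kCoord_kMat (s : Fin 6 → ℝ) : kCoord (kMat s) = s := by
  ext i; fin_cases i <;> simp [kCoord, kMat]

theorem kMat_add (s s' : Fin 6 → ℝ) : kMat (s + s') = kMat s + kMat s' := by
  rw [eq_kMat (add_mem_g2 (kMat_mem_g2 s) (kMat_mem_g2 s'))
    (by rw [Matrix.mul_add, Matrix.add_mul, S7_mul_kMat, S7_mul_kMat]), map_add, kCoord_kMat,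
    kCoord_kMat]

theorem kMat_smul (c : ℝ) (s : Fin 6 → ℝ) : kMat (c • s) = c • kMat s := by
  rw [eq_kMat (smul_mem_g2 c (kMat_mem_g2 s))
    (by rw [Matrix.mul_smul, Matrix.smul_mul, S7_mul_kMat]), map_smul, kCoord_kMat]

theorem kMat_zero : kMat 0 = 0 := by
  rw [← zero_smul ℝ (0 : Fin 6 → ℝ), kMat_smul, zero_smul]

theorem pMat_add (h h' : Fin 2 → ℝ) (t t' : Fin 6 → ℝ) :
    pMat (h + h') (t + t') = pMat h t + pMat h' t' := by
  rw [eq_pMat (add_mem_g2 (pMat_mem_g2 h t) (pMat_mem_g2 h' t'))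
    (by rw [Matrix.mul_add, Matrix.add_mul, S7_mul_pMat, S7_mul_pMat, neg_add]), map_add, map_add,
    hCoord_pMat, hCoord_pMat, tCoord_pMat, tCoord_pMat]

theorem pMat_smul (c : ℝ) (h : Fin 2 → ℝ) (t : Fin 6 → ℝ) :
    pMat (c • h) (c • t) = c • pMat h t := by
  rw [eq_pMat (smul_mem_g2 c (pMat_mem_g2 h t))
    (by rw [Matrix.mul_smul, Matrix.smul_mul, S7_mul_pMat, smul_neg]), map_smul, map_smul,
    hCoord_pMat, tCoord_pMat]

theorem S7_mul_mul_of_odd {A B : Mat7} (hA : S7 * A = -(A * S7)) (hB : S7 * B = -(B * S7)) :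
    S7 * (A * B) = A * B * S7 := by
  rw [← Matrix.mul_assoc, hA, Matrix.neg_mul, Matrix.mul_assoc, hB, Matrix.mul_neg, neg_neg,
    Matrix.mul_assoc]

theorem S7_mul_mul_of_odd_even {A B : Mat7} (hA : S7 * A = -(A * S7)) (hB : S7 * B = B * S7) :
    S7 * (A * B) = -(A * B * S7) := by
  rw [← Matrix.mul_assoc, hA, Matrix.neg_mul, Matrix.mul_assoc, hB, Matrix.mul_assoc]

theorem S7_mul_mul_of_even_odd {A B : Mat7} (hA : S7 * A = A * S7) (hB : S7 * B = -(B * S7)) :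
    S7 * (A * B) = -(A * B * S7) := by
  rw [← Matrix.mul_assoc, hA, Matrix.mul_assoc, hB, Matrix.mul_neg, Matrix.mul_assoc]

theorem S7_mul_mul_of_even {A B : Mat7} (hA : S7 * A = A * S7) (hB : S7 * B = B * S7) :
    S7 * (A * B) = A * B * S7 := by
  rw [← Matrix.mul_assoc, hA, Matrix.mul_assoc, hB, Matrix.mul_assoc]

theorem S7_mul_lie_of_odd {A B : Mat7} (hA : S7 * A = -(A * S7)) (hB : S7 * B = -(B * S7)) :
    S7 * ⁅A, B⁆ = ⁅A, B⁆ * S7 := by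
  rw [Ring.lie_def, Matrix.mul_sub, Matrix.sub_mul, S7_mul_mul_of_odd hA hB,
    S7_mul_mul_of_odd hB hA]

theorem S7_mul_lie_of_odd_even {A B : Mat7} (hA : S7 * A = -(A * S7)) (hB : S7 * B = B * S7) :
    S7 * ⁅A, B⁆ = -(⁅A, B⁆ * S7) := by
  rw [Ring.lie_def, Matrix.mul_sub, Matrix.sub_mul, S7_mul_mul_of_odd_even hA hB,
    S7_mul_mul_of_even_odd hB hA]
  abel

theorem S7_mul_lie_of_even {A B : Mat7} (hA : S7 * A = A * S7) (hB : S7 * B = B * S7) :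
    S7 * ⁅A, B⁆ = ⁅A, B⁆ * S7 := by
  rw [Ring.lie_def, Matrix.mul_sub, Matrix.sub_mul, S7_mul_mul_of_even hA hB,
    S7_mul_mul_of_even hB hA]

theorem b7_mem_g2 (i : Fin 2) : b7 i ∈ g2 := b7_eq_pMat i ▸ pMat_mem_g2 _ _

theorem S7_mul_b7 (i : Fin 2) : S7 * b7 i = -(b7 i * S7) := b7_eq_pMat i ▸ S7_mul_pMat _ _

/-- The bracket of two odd elements of `𝔤₂` is an even element of `𝔤₂`, so six coordinates have to
be compared instead of 49 entries. The diagonal form expresses that all restricted roots have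
multiplicity one. -/
theorem lie_b7_pMat (i : Fin 2) (h : Fin 2 → ℝ) (t : Fin 6 → ℝ) :
    ⁅b7 i, pMat h t⁆ = kMat (root i * t) := by
  rw [eq_kMat (lie_mem_g2 (b7_mem_g2 i) (pMat_mem_g2 h t))
    (S7_mul_lie_of_odd (S7_mul_b7 i) (S7_mul_pMat h t)), b7_eq_pMat, Ring.lie_def]
  congr 1
  ext r
  fin_cases i <;> fin_cases r <;>
    simp [kCoord, pMat, root] <;> ring

theorem lie_b7_kMat (i : Fin 2) (s : Fin 6 → ℝ) :
    ⁅b7 i, kMat s⁆ = pMat 0 (-(root i * s)) := by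
  rw [eq_pMat (lie_mem_g2 (b7_mem_g2 i) (kMat_mem_g2 s))
    (S7_mul_lie_of_odd_even (S7_mul_b7 i) (S7_mul_kMat s)), b7_eq_pMat, Ring.lie_def]
  congr 1
  · ext r
    fin_cases i <;> fin_cases r <;>
      simp [hCoord, pMat, kMat]
  · ext r
    fin_cases i <;> fin_cases r <;>
      simp [tCoord, pMat, kMat, root] <;> ring

end RootCoordinates

/-! ### `G₂`-frames from the Cayley–Dickson construction -/

section Frames

open Matrix

/-- The standard basis of `ℝ⁷`. -/
abbrev e (i : Fin 7) : R7 := EuclideanSpace.single i 1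

/-- The matrix with the given columns. -/
def frameMatrix (f : Fin 7 → R7) : Mat7 := Matrix.of fun i j => f j i

theorem act_frameMatrix (f : Fin 7 → R7) (u : R7) : act (frameMatrix f) u = ∑ j, u j • f j := by
  ext i
  simp only [act_apply, frameMatrix, Matrix.of_apply, WithLp.ofLp_sum, WithLp.ofLp_smul,
    Finset.sum_apply, Pi.smul_apply, smul_eq_mul]
  exact Finset.sum_congr rfl fun j _ => mul_comm _ _

@[simp] theorem act_frameMatrix_e (f : Fin 7 → R7) (j : Fin 7) : act (frameMatrix f) (e j) = f j := by
  ext i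
  simp [frameMatrix]

/-- Bilinearity reduces to basis vectors, and antisymmetry to the pairs `i < j`. -/
theorem cross_act_of_basis {A B C : Mat7}
    (h : ∀ i j, i < j → act A (cross (e i) (e j)) = cross (act B (e i)) (act C (e j)))
    (hBC : B = C) (u v : R7) : act A (cross u v) = cross (act B u) (act C v) := by
  subst hBC
  have h' : ∀ i j, act A (cross (e i) (e j)) = cross (act B (e i)) (act B (e j)) := by
    intro i j
    rcases lt_trichotomy i j with hij | rfl | hij
    · exact h i j hij
    · simp only [cross_self, map_zero]
    · rw [cross_swap, cross_swap (act B (e i)), ← h j i hij]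
      exact map_neg _ _
  have : crossₗ.compr₂ (Matrix.toEuclideanLin A) =
      crossₗ.compl₁₂ (Matrix.toEuclideanLin B) (Matrix.toEuclideanLin B) := by
    refine LinearMap.ext_basis (EuclideanSpace.basisFun (Fin 7) ℝ).toBasis
      (EuclideanSpace.basisFun (Fin 7) ℝ).toBasis fun i j => ?_
    simpa using h' i j
  exact LinearMap.congr_fun (LinearMap.congr_fun this u) v

/-- The multiplication table of the imaginary octonions, for the vectors `f`. -/
def IsOctonionBasis (f : Fin 7 → R7) : Prop :=
    cross (f 0) (f 1) = -f 4 ∧ cross (f 0) (f 2) = -f 5 ∧ cross (f 0) (f 3) = -f 6 ∧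
    cross (f 0) (f 4) = f 1 ∧ cross (f 0) (f 5) = f 2 ∧ cross (f 0) (f 6) = f 3 ∧
    cross (f 1) (f 2) = -f 6 ∧ cross (f 1) (f 3) = f 5 ∧ cross (f 1) (f 4) = -f 0 ∧
    cross (f 1) (f 5) = -f 3 ∧ cross (f 1) (f 6) = f 2 ∧ cross (f 2) (f 3) = -f 4 ∧
    cross (f 2) (f 4) = f 3 ∧ cross (f 2) (f 5) = -f 0 ∧ cross (f 2) (f 6) = -f 1 ∧
    cross (f 3) (f 4) = -f 2 ∧ cross (f 3) (f 5) = f 1 ∧ cross (f 3) (f 6) = -f 0 ∧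
    cross (f 4) (f 5) = f 6 ∧ cross (f 4) (f 6) = -f 5 ∧ cross (f 5) (f 6) = f 4

theorem frameMatrix_mem_G2 {f : Fin 7 → R7}
    (horth : ∀ i j, inner ℝ (f i) (f j) = if i = j then 1 else 0)
    (hcross : IsOctonionBasis f) : frameMatrix f ∈ G2 := by
  refine ⟨?_, cross_act_of_basis (fun i j hij => ?_) rfl⟩
  · rw [Matrix.mem_orthogonalGroup_iff']
    ext i j
    have := horth i j
    rw [inner_eq_sum] at this
    simp only [Matrix.mul_apply, Matrix.transpose_apply, frameMatrix, Matrix.of_apply, this,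
      Matrix.one_apply]
  · rw [act_frameMatrix_e, act_frameMatrix_e]
    obtain ⟨h1, h2, h3, h4, h5, h6, h7, h8, h9, h10, h11, h12, h13, h14, h15, h16, h17, h18, h19,
      h20, h21⟩ := hcross
    fin_cases i <;> fin_cases j <;>
      first
      | exact absurd hij (by decide)
      | (rw [act_frameMatrix]
         simp only [Fin.isValue, Fin.zero_eta, Fin.mk_one, Fin.reduceFinMk, h1, h2, h3, h4, h5, h6,
           h7, h8, h9, h10, h11, h12, h13, h14, h15, h16, h17, h18, h19, h20, h21]
         simp [Fin.sum_univ_seven, cross])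

/-- Left multiplications by orthogonal imaginary octonions anticommute. -/
theorem cross_cross_of_orthogonal {x y c : R7} (hyc : inner ℝ y c = 0) (hyx : inner ℝ y x = 0)
    (hcx : inner ℝ c x = 0) : cross y (cross c x) = -cross c (cross y x) := by
  have h := cross_cross_add y c x
  rw [hyc, hyx, hcx] at h
  simp only [mul_zero, zero_smul, add_zero] at h
  exact eq_neg_of_add_eq_zero_left h

theorem cross_cross_of_unit {c x : R7} (hc : inner ℝ c c = 1) (hcx : inner ℝ c x = 0) :
    cross c (cross c x) = -x := by
  rw [cross_cross_self, hc, hcx]; simp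

/-- The Cayley–Dickson rule for products within the copy `cℍ` of a quaternion algebra orthogonal to
`c`. -/
theorem cross_cross_cross_of_orthogonal {c x y : R7} (hc : inner ℝ c c = 1)
    (hcx : inner ℝ c x = 0) (hcy : inner ℝ c y = 0) (hxy : inner ℝ x y = 0)
    (hxyc : inner ℝ (cross x y) c = 0) :
    cross (cross c x) (cross c y) = -cross x y := by
  rw [cross_cross_of_orthogonal (inner_cross_self_left c x)
    (by rw [inner_cross_cyclic, hxyc]) hcy, cross_swap (cross c x),
    cross_cross_of_orthogonal (by rwa [real_inner_comm]) (by rwa [real_inner_comm]) hcx,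
    neg_neg, cross_cross_of_unit hc (by rw [real_inner_comm, cross_swap, inner_neg_left, hxyc,
      neg_zero]), cross_swap y x, neg_neg]

/-- Every triple of orthonormal vectors `x, y, c` with `c ⟂ x × y` extends to a `G₂`-frame with
`e₅ = x`, `e₆ = y` and `e₁ = c`. -/
theorem exists_G2_frame {x y c : R7} (hx : inner ℝ x x = 1) (hy : inner ℝ y y = 1)
    (hc : inner ℝ c c = 1) (hxy : inner ℝ x y = 0) (hcx : inner ℝ c x = 0)
    (hcy : inner ℝ c y = 0) (hxyc : inner ℝ (cross x y) c = 0) :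
    ∃ g ∈ G2, act g (e 4) = x ∧ act g (e 5) = y ∧ act g (e 6) = cross x y ∧ act g (e 0) = c := by
  set p := cross x y with hp
  have hyx : inner ℝ y x = 0 := by rwa [real_inner_comm]
  have hpp : inner ℝ p p = 1 := by rw [hp, inner_cross_cross, hx, hy, hxy]; ring
  have hpx : inner ℝ p x = 0 := inner_cross_self_left x y
  have hpy : inner ℝ p y = 0 := inner_cross_self_right x y
  have hxp : inner ℝ x p = 0 := by rwa [real_inner_comm]
  have hyp : inner ℝ y p = 0 := by rwa [real_inner_comm]
  have hcp : inner ℝ c p = 0 := by rwa [real_inner_comm]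
  have hxc : inner ℝ x c = 0 := by rwa [real_inner_comm]
  have hyc : inner ℝ y c = 0 := by rwa [real_inner_comm]
  have xp : cross x p = -y := cross_cross_of_unit hx hxy
  have yp : cross y p = x := by rw [hp, cross_swap x, cross_neg_right, cross_cross_of_unit hy hyx,
    neg_neg]
  have yx : cross y x = -p := cross_swap y x
  have px : cross p x = y := by rw [cross_swap, xp, neg_neg]
  have py : cross p y = -x := by rw [cross_swap, yp]
  have self {u : R7} (hu : inner ℝ u u = 1) (huc : inner ℝ u c = 0) :
      cross (cross c u) u = -c := by
    rw [cross_swap, cross_swap c, cross_neg_right, cross_cross_of_unit hu huc, neg_neg]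
  have mixed {u v : R7} (hvc : inner ℝ v c = 0) (hvu : inner ℝ v u = 0) (hcu : inner ℝ c u = 0) :
      cross (cross c u) v = cross c (cross v u) := by
    rw [cross_swap, cross_cross_of_orthogonal hvc hvu hcu, neg_neg]
  have d1 : cross (cross c x) (cross c y) = -p :=
    cross_cross_cross_of_orthogonal hc hcx hcy hxy hxyc
  have d2 : cross (cross c x) (cross c p) = y := by
    rw [cross_cross_cross_of_orthogonal hc hcx hcp hxp (by rw [xp, inner_neg_left, hyc, neg_zero]),
      xp, neg_neg]
  have d3 : cross (cross c y) (cross c p) = -x := by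
    rw [cross_cross_cross_of_orthogonal hc hcy hcp hyp (by rw [yp, hxc]), yp]
  have hB {u v : R7} (hcu : inner ℝ c u = 0) (hcv : inner ℝ c v = 0) :
      inner ℝ (cross c u) (cross c v) = inner ℝ u v := by
    rw [inner_cross_cross, hc, hcu, hcv]; ring
  have hBs {u v : R7} (h : inner ℝ (cross u v) c = 0) : inner ℝ (cross c u) v = 0 := by
    rw [inner_cross_cyclic, h]
  have hBs' {u v : R7} (h : inner ℝ (cross u v) c = 0) : inner ℝ v (cross c u) = 0 := by
    rw [real_inner_comm, hBs h]
  have c1 : cross c (cross c x) = -x := cross_cross_of_unit hc hcx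
  have c2 : cross c (cross c y) = -y := cross_cross_of_unit hc hcy
  have c3 : cross c (cross c p) = -p := cross_cross_of_unit hc hcp
  -- The vectors `x, y, p` span the imaginary part of a quaternion algebra, and the first four
  -- columns are its double by `c`; the table prescribes `e₂ = e₁ × e₅`, `e₃ = e₁ × e₆`, `e₄ = e₁ ×
  -- e₇`.
  refine ⟨frameMatrix ![c, cross c x, cross c y, cross c p, x, y, p], ?_, ?_, ?_, ?_, ?_⟩
  · have hl (u : R7) : inner ℝ (cross c u) c = 0 := inner_cross_self_left c u
    have hl' (u : R7) : inner ℝ c (cross c u) = 0 := by rw [real_inner_comm, hl]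
    refine frameMatrix_mem_G2 ?_ ?_
    · intro i j
      fin_cases i <;> fin_cases j <;>
        simp [hc, hx, hy, hpp, hxy, hyx, hpx, hpy, hxp, hyp, hcx, hcy, hcp, hxc, hyc, hxyc, hB, hl,
          hl', hBs, hBs', xp, yp, yx, px, py, ← hp, -inner_self_eq_norm_sq_to_K]
    · simp [IsOctonionBasis, c1, c2, c3, d1, d2, d3, self hx hxc, self hy hyc, self hpp hxyc,
        mixed hyc hyx hcx, mixed hxyc hpx hcx, mixed hxc hxy hcy, mixed hxyc hpy hcy,
        mixed hxc hxp hcp, mixed hyc hyp hcp, xp, yp, yx, px, py, ← hp, cross_neg_right]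
  all_goals simp

end Frames

/-! ### Associative planes and their reflections -/

section Planes

open Matrix Module

theorem act_map_sum {ι : Type*} (A : Mat7) (s : Finset ι) (u : ι → R7) :
    act A (∑ i ∈ s, u i) = ∑ i ∈ s, act A (u i) := map_sum (Matrix.toEuclideanLin A) u s

theorem act_map_smul (A : Mat7) (c : ℝ) (u : R7) : act A (c • u) = c • act A u :=
  map_smul (Matrix.toEuclideanLin A) c u

theorem act_map_add (A : Mat7) (u v : R7) : act A (u + v) = act A u + act A v :=
  map_add (Matrix.toEuclideanLin A) u v

theorem act_map_sub (A : Mat7) (u v : R7) : act A (u - v) = act A u - act A v :=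
  map_sub (Matrix.toEuclideanLin A) u v

theorem act_map_neg (A : Mat7) (u : R7) : act A (-u) = -act A u :=
  map_neg (Matrix.toEuclideanLin A) u

/-- The span of the last three columns of a frame. -/
def framePlane (F : Mat7) : Submodule ℝ R7 :=
  Submodule.span ℝ (Set.range fun j : Fin 3 => (WithLp.toLp 2 fun i => F i (Fin.natAdd 4 j) : R7))

theorem column_eq_act (F : Mat7) (j : Fin 7) : (WithLp.toLp 2 fun i => F i j : R7) = act F (e j) := by
  ext i; simp

theorem S7_mem_G2 : S7 ∈ G2 := by
  refine ⟨?_, fun u v => ?_⟩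
  · rw [Matrix.mem_orthogonalGroup_iff, S7, Matrix.diagonal_transpose]
    exact S7_mul_S7
  · ext j
    fin_cases j <;> simp [S7, Matrix.mulVec_diagonal, cross] <;> ring

theorem transpose_S7 : S7ᵀ = S7 := Matrix.diagonal_transpose _

theorem act_S7_apply (u : R7) (i : Fin 7) : act S7 u i = ![-1, -1, -1, -1, 1, 1, 1] i * u i := by
  simp [S7, Matrix.mulVec_diagonal]

theorem act_S7_eq_self_iff (u : R7) :
    act S7 u = u ↔ u 0 = 0 ∧ u 1 = 0 ∧ u 2 = 0 ∧ u 3 = 0 := by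
  constructor
  · intro h
    have h' (i : Fin 7) := congrArg (fun w : R7 => w i) h
    simp only [act_S7_apply] at h'
    have h0 := h' 0
    have h1 := h' 1
    have h2 := h' 2
    have h3 := h' 3
    simp at h0 h1 h2 h3
    exact ⟨by linarith, by linarith, by linarith, by linarith⟩
  · rintro ⟨h0, h1, h2, h3⟩
    ext i
    rw [act_S7_apply]
    fin_cases i <;> simp [h0, h1, h2, h3]

theorem act_S7_eq_neg_iff (u : R7) : act S7 u = -u ↔ u 4 = 0 ∧ u 5 = 0 ∧ u 6 = 0 := by
  constructor
  · intro h
    have h' (i : Fin 7) := congrArg (fun w : R7 => w i) h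
    simp only [act_S7_apply] at h'
    have h0 := h' 4
    have h1 := h' 5
    have h2 := h' 6
    simp at h0 h1 h2
    exact ⟨by linarith, by linarith, by linarith⟩
  · rintro ⟨h0, h1, h2⟩
    ext i
    rw [act_S7_apply]
    fin_cases i <;> simp [h0, h1, h2]

/-- The reflection in the plane of a frame. -/
def reflection (F : Mat7) : Mat7 := F * S7 * Fᵀ

/-- In the frame `F` the plane is the fixed space of `S7`; membership becomes an equation to which
parity arguments apply. -/
theorem mem_framePlane_iff {F : Mat7} (hF : F ∈ G2) (w : R7) :
    w ∈ framePlane F ↔ act S7 (act Fᵀ w) = act Fᵀ w := by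
  constructor
  · intro hw
    induction hw using Submodule.span_induction with
    | mem x hx =>
      obtain ⟨j, rfl⟩ := hx
      simp only [column_eq_act]
      rw [act_transpose_act hF, act_S7_eq_self_iff]
      fin_cases j <;> simp
    | zero => simp
    | add x y _ _ hx hy => simp only [map_add, hx, hy]
    | smul c x _ hx => simp only [map_smul, hx]
  · intro h
    obtain ⟨h0, h1, h2, h3⟩ := (act_S7_eq_self_iff _).1 h
    rw [← act_act_transpose hF w]
    set y := act Fᵀ w
    have hy : y = ∑ j : Fin 3, y (Fin.natAdd 4 j) • e (Fin.natAdd 4 j) := by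
      ext i
      rw [Fin.sum_univ_three]
      fin_cases i <;> simp [h0, h1, h2, h3, Fin.ext_iff]
    rw [hy, act_map_sum]
    refine Submodule.sum_mem _ fun j _ => ?_
    rw [act_map_smul]
    refine Submodule.smul_mem _ _ (Submodule.subset_span ⟨j, ?_⟩)
    simp only [column_eq_act]

theorem act_e_mem_framePlane {F : Mat7} (j : Fin 3) : act F (e (Fin.natAdd 4 j)) ∈ framePlane F :=
  Submodule.subset_span ⟨j, column_eq_act _ _⟩

theorem inner_e (i j : Fin 7) : inner ℝ (e i) (e j) = if i = j then (1 : ℝ) else 0 := by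
  rw [EuclideanSpace.inner_single_left]
  simp

theorem finrank_framePlane {F : Mat7} (hF : F ∈ G2) : finrank ℝ (framePlane F) = 3 := by
  have ho : Orthonormal ℝ fun j : Fin 3 => (WithLp.toLp 2 fun i => F i (Fin.natAdd 4 j) : R7) := by
    rw [orthonormal_iff_ite]
    intro i j
    rw [column_eq_act, column_eq_act, inner_act_act hF, inner_e]
    fin_cases i <;> fin_cases j <;> simp
  rw [framePlane, finrank_span_eq_card ho.linearIndependent, Fintype.card_fin]

/-- Since `S7` is an automorphism of the cross product, its fixed space is closed under the product.
-/
theorem isAssociative_framePlane {F : Mat7} (hF : F ∈ G2) : IsAssociative (framePlane F) := by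
  refine ⟨finrank_framePlane hF, fun u hu v hv => ?_⟩
  rw [mem_framePlane_iff hF] at hu hv ⊢
  rw [(transpose_mem_G2 hF).2, S7_mem_G2.2, hu, hv]

theorem orthonormal_cross {u v : R7} (hu : inner ℝ u u = 1) (hv : inner ℝ v v = 1)
    (huv : inner ℝ u v = 0) : Orthonormal ℝ ![u, v, cross u v] := by
  have hp : inner ℝ (cross u v) (cross u v) = 1 := by rw [inner_cross_cross, hu, hv, huv]; ring
  have h1 := inner_cross_self_left u v
  have h2 := inner_cross_self_right u v
  rw [orthonormal_iff_ite]
  intro i j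
  fin_cases i <;> fin_cases j <;>
    simp [hu, hv, huv, hp, h1, h2, real_inner_comm u v, real_inner_comm (cross u v),
      -inner_self_eq_norm_sq_to_K]

theorem exists_orthonormal_of_finrank_eq_two {E : Submodule ℝ R7} (hE : finrank ℝ E = 2) :
    ∃ u ∈ E, ∃ v ∈ E, inner ℝ u u = 1 ∧ inner ℝ v v = 1 ∧ inner ℝ u v = 0 ∧
      E = Submodule.span ℝ {u, v} := by
  let b := (stdOrthonormalBasis ℝ E).reindex (finCongr hE)
  have ho := orthonormal_iff_ite.1 b.orthonormal
  refine ⟨b 0, (b 0).2, b 1, (b 1).2, ho 0 0, ho 1 1, ho 0 1, ?_⟩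
  have h := b.toBasis.span_eq
  have h2 := congrArg (Submodule.map E.subtype) h
  rw [Submodule.map_span, Submodule.map_top, Submodule.range_subtype] at h2
  refine h2.symm.trans ?_
  congr 1
  ext x
  simp [eq_comm]

/-- An associative plane containing orthonormal `u, v` contains the orthonormal triple `u, v, u × v`
and is spanned by it. The infimum is therefore taken over a single plane. -/
theorem assocExtension_eq {V E : Submodule ℝ R7} (hV : IsAssociative V) (hEV : E ≤ V)
    (hE : finrank ℝ E = 2) : assocExtension E = V := by
  obtain ⟨u, hu, v, hv, huu, hvv, huv, -⟩ := exists_orthonormal_of_finrank_eq_two hE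
  have hspan : ∀ V', IsAssociative V' → E ≤ V' →
      Submodule.span ℝ (Set.range ![u, v, cross u v]) = V' := by
    intro V' hV' hEV'
    refine Submodule.eq_of_le_of_finrank_eq ?_ ?_
    · rw [Submodule.span_le]
      rintro _ ⟨i, rfl⟩
      fin_cases i
      · exact hEV' hu
      · exact hEV' hv
      · exact hV'.2 u (hEV' hu) v (hEV' hv)
    · rw [finrank_span_eq_card (orthonormal_cross huu hvv huv).linearIndependent, hV'.1,
        Fintype.card_fin]
  refine le_antisymm (sInf_le ⟨hV, hEV⟩) (le_sInf ?_)
  rintro V' ⟨hV', hEV'⟩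
  rw [← hspan V hV hEV, hspan V' hV' hEV']

/-- For `c` any unit vector in the four-dimensional complement of `u, v, u × v` will do. -/
theorem exists_G2_frame_of_orthonormal {u v : R7} (hu : inner ℝ u u = 1) (hv : inner ℝ v v = 1)
    (huv : inner ℝ u v = 0) :
    ∃ g ∈ G2, act g (e 4) = u ∧ act g (e 5) = v ∧ act g (e 6) = cross u v := by
  obtain ⟨c, hc, hcu, hcv, hcp⟩ : ∃ c : R7, inner ℝ c c = 1 ∧ inner ℝ c u = 0 ∧
      inner ℝ c v = 0 ∧ inner ℝ (cross u v) c = 0 := by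
    set P := Submodule.span ℝ (Set.range ![u, v, cross u v])
    have h3 : finrank ℝ P = 3 := by
      rw [finrank_span_eq_card (orthonormal_cross hu hv huv).linearIndependent, Fintype.card_fin]
    have h4 : Pᗮ ≠ ⊥ := by
      intro hbot
      have := Submodule.finrank_add_finrank_orthogonal P
      rw [hbot, h3] at this
      simp at this
    obtain ⟨c, hcP, hc0⟩ := Submodule.exists_mem_ne_zero_of_ne_bot h4
    have hm (i : Fin 3) : inner ℝ (![u, v, cross u v] i) c = 0 :=
      (Submodule.mem_orthogonal P c).1 hcP _ (Submodule.subset_span ⟨i, rfl⟩)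
    have h0 := hm 0
    have h1 := hm 1
    have h2 := hm 2
    simp only [Fin.isValue, Matrix.cons_val] at h0 h1 h2
    refine ⟨(‖c‖⁻¹ : ℝ) • c, ?_, ?_, ?_, ?_⟩
    · rw [real_inner_smul_left, real_inner_smul_right, real_inner_self_eq_norm_sq]
      field_simp
    · rw [real_inner_smul_left, real_inner_comm, h0, mul_zero]
    · rw [real_inner_smul_left, real_inner_comm, h1, mul_zero]
    · rw [real_inner_smul_right, h2, mul_zero]
  obtain ⟨g, hg, h4, h5, h6, -⟩ := exists_G2_frame hu hv hc huv hcu hcv hcp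
  exact ⟨g, hg, h4, h5, h6⟩

/-- The action of matrices on `ℝ⁷`, as continuous linear maps. -/
def actL : Mat7 →L[ℝ] (R7 →L[ℝ] R7) :=
  LinearMap.toContinuousLinearMap
    (LinearMap.toContinuousLinearMap.toLinearMap ∘ₗ (Matrix.toEuclideanLin (𝕜 := ℝ)).toLinearMap)

@[simp] theorem actL_apply (A : Mat7) (u : R7) : actL A u = act A u := rfl

theorem actL_injective : Function.Injective actL := fun A B h =>
  act_injective fun u => by rw [← actL_apply, h, actL_apply]

/-- Through this formula nondegeneracy and curvature become statements about the matrix-valued map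
`reflection`, an involution. -/
theorem starProjection_framePlane {F : Mat7} (hF : F ∈ G2) :
    (framePlane F).starProjection = actL ((1 / 2 : ℝ) • (1 + reflection F)) := by
  ext1 w
  have hSS (u : R7) : act S7 (act S7 u) = u := by rw [← act_mul, S7_mul_S7, act_one]
  have hw : act ((1 / 2 : ℝ) • (1 + reflection F)) w =
      (1 / 2 : ℝ) • (w + act F (act S7 (act Fᵀ w))) := by
    rw [act_smul, act_add, act_one, reflection, act_mul, act_mul]
  rw [actL_apply, hw]
  refine Submodule.eq_starProjection_of_mem_of_inner_eq_zero (K := framePlane F) ?_ fun y hy => ?_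
  · rw [mem_framePlane_iff hF, act_map_smul, act_map_smul, act_map_add, act_transpose_act hF,
      act_map_add, hSS,
      add_comm]
  · rw [mem_framePlane_iff hF] at hy
    have h1 : inner ℝ (act F (act S7 (act Fᵀ w))) y = inner ℝ w y := by
      rw [inner_act, inner_act, transpose_S7, hy, inner_act, Matrix.transpose_transpose,
        act_act_transpose hF]
    rw [inner_sub_left, real_inner_smul_left, inner_add_left, h1]
    ring

end Planes

/-! ### Partial derivatives on the parameter plane -/

section Calculus

variable {E F G : Type*} [NormedAddCommGroup E] [NormedSpace ℝ E] [NormedAddCommGroup F]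
  [NormedSpace ℝ F] [NormedAddCommGroup G] [NormedSpace ℝ G]

/-- A bilinear map between finite-dimensional spaces, as a continuous bilinear map. -/
def toBilinL [FiniteDimensional ℝ E] [FiniteDimensional ℝ F] (B : E →ₗ[ℝ] F →ₗ[ℝ] G) :
    E →L[ℝ] F →L[ℝ] G :=
  LinearMap.toContinuousLinearMap (LinearMap.toContinuousLinearMap.toLinearMap ∘ₗ B)

/-- The standard basis of the parameter domain. -/
abbrev E2 (i : Fin 2) : R2 := EuclideanSpace.single i 1

/-- The partial derivatives of a map on the parameter domain. -/
def pd (i : Fin 2) (f : R2 → E) (m : R2) : E := fderiv ℝ f m (E2 i)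

theorem R2_eq (u : R2) : u = u 0 • E2 0 + u 1 • E2 1 := by
  ext i; fin_cases i <;> simp

theorem fderiv_eq_pd (f : R2 → E) (m u : R2) :
    fderiv ℝ f m u = u 0 • pd 0 f m + u 1 • pd 1 f m := by
  conv_lhs => rw [R2_eq u]
  rw [map_add, map_smul, map_smul]
  rfl

theorem differentiable_infty {f : R2 → E} (hf : ContDiff ℝ ∞ f) : Differentiable ℝ f :=
  hf.differentiable (by norm_cast)

theorem pd_bilin (B : E →L[ℝ] F →L[ℝ] G) {f : R2 → E} {g : R2 → F}
    (hf : Differentiable ℝ f) (hg : Differentiable ℝ g) (i : Fin 2) (m : R2) :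
    pd i (fun p => B (f p) (g p)) m = B (pd i f m) (g m) + B (f m) (pd i g m) := by
  rw [pd, B.fderiv_of_bilinear (hf m) (hg m)]
  simp [add_comm, pd]

theorem fderiv_clm (L : E →L[ℝ] F) {f : R2 → E} (hf : Differentiable ℝ f) (m u : R2) :
    fderiv ℝ (fun p => L (f p)) m u = L (fderiv ℝ f m u) := by
  have := (L.hasFDerivAt.comp m (hf m).hasFDerivAt).fderiv
  simp only [Function.comp_def] at this
  rw [this]; rfl

theorem pd_clm (L : E →L[ℝ] F) {f : R2 → E} (hf : Differentiable ℝ f) (i : Fin 2) (m : R2) :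
    pd i (fun p => L (f p)) m = L (pd i f m) := fderiv_clm L hf m _

theorem contDiff_pd {f : R2 → E} (hf : ContDiff ℝ ∞ f) (i : Fin 2) : ContDiff ℝ ∞ (pd i f) :=
  (hf.fderiv_right (m := ∞) (by norm_cast)).clm_apply contDiff_const

theorem pd_comm {f : R2 → E} (hf : ContDiff ℝ ∞ f) (i j : Fin 2) (m : R2) :
    pd i (pd j f) m = pd j (pd i f) m := by
  have hd : Differentiable ℝ (fderiv ℝ f) :=
    differentiable_infty (hf.fderiv_right (m := ∞) (by norm_cast))
  have h (i j : Fin 2) : pd i (pd j f) m = fderiv ℝ (fderiv ℝ f) m (E2 i) (E2 j) :=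
    fderiv_clm (ContinuousLinearMap.apply ℝ E (E2 j)) hd m (E2 i)
  rw [h, h]
  exact (hf.contDiffAt.isSymmSndFDerivAt (by simp; norm_cast)) _ _

theorem eq_of_pd_eq_zero {f : R2 → E} (hf : Differentiable ℝ f) (h : ∀ i m, pd i f m = 0)
    (m : R2) : f m = f 0 :=
  is_const_of_fderiv_eq_zero hf (fun m => ContinuousLinearMap.ext fun u => by
    rw [fderiv_eq_pd, h, h]; simp) m 0

theorem pd_add {f g : R2 → E} (hf : Differentiable ℝ f) (hg : Differentiable ℝ g) (i : Fin 2)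
    (m : R2) : pd i (fun p => f p + g p) m = pd i f m + pd i g m := by
  rw [pd, fderiv_fun_add (hf m) (hg m)]; rfl

theorem pd_sub {f g : R2 → E} (hf : Differentiable ℝ f) (hg : Differentiable ℝ g) (i : Fin 2)
    (m : R2) : pd i (fun p => f p - g p) m = pd i f m - pd i g m := by
  rw [pd, fderiv_fun_sub (hf m) (hg m)]; rfl

theorem pd_const (c : E) (i : Fin 2) (m : R2) : pd i (fun _ => c) m = 0 := by
  rw [pd, fderiv_const_apply]; rfl

theorem pd_smul {c : R2 → ℝ} {f : R2 → E} (hc : Differentiable ℝ c) (hf : Differentiable ℝ f)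
    (i : Fin 2) (m : R2) : pd i (fun p => c p • f p) m = pd i c m • f m + c m • pd i f m :=
  pd_bilin (ContinuousLinearMap.lsmul ℝ ℝ) hc hf i m

end Calculus

/-! ### Calculus of matrix-valued maps, with products treated as bilinear maps -/

section MatrixCalculus

set_option linter.unusedSectionVars false

open Matrix

variable {n : Type*} [Fintype n] [DecidableEq n] {A B : R2 → Matrix n n ℝ}

/-- Matrix multiplication as a continuous bilinear map. -/
def mulL (n : Type*) [Fintype n] [DecidableEq n] :
    Matrix n n ℝ →L[ℝ] Matrix n n ℝ →L[ℝ] Matrix n n ℝ := toBilinL (LinearMap.mul ℝ (Matrix n n ℝ))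

/-- Transposition as a continuous linear map. -/
def transposeL (n : Type*) [Fintype n] : Matrix n n ℝ →L[ℝ] Matrix n n ℝ :=
  LinearMap.toContinuousLinearMap (Matrix.transposeLinearEquiv n n ℝ ℝ).toLinearMap

theorem contDiff_matrix_iff {A : R2 → Matrix n n ℝ} {k : WithTop ℕ∞} :
    ContDiff ℝ k A ↔ ∀ i j, ContDiff ℝ k fun p => A p i j :=
  ⟨fun h i j => contDiff_pi.1 (contDiff_pi.1 h i) j,
    fun h => contDiff_pi.2 fun i => contDiff_pi.2 fun j => h i j⟩

theorem differentiable_matrix_iff {A : R2 → Matrix n n ℝ} :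
    Differentiable ℝ A ↔ ∀ i j, Differentiable ℝ fun p => A p i j :=
  ⟨fun h i j => differentiable_pi.1 (differentiable_pi.1 h i) j,
    fun h => differentiable_pi.2 fun i => differentiable_pi.2 fun j => h i j⟩

theorem pd_matrix_apply (hA : Differentiable ℝ A) (i : Fin 2) (m : R2) (j k : n) :
    pd i A m j k = pd i (fun p => A p j k) m := by
  have h1 := fderiv_pi (𝕜 := ℝ) (x := m) (φ := fun j p => A p j)
    (fun j => differentiable_pi.1 hA j m)
  have h2 := fderiv_pi (𝕜 := ℝ) (x := m) (φ := fun k p => A p j k)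
    (fun k => differentiable_pi.1 (differentiable_pi.1 hA j) k m)
  change (fderiv ℝ (fun p j => A p j) m (E2 i)) j k = _
  erw [h1]
  change (fderiv ℝ (fun p k => A p j k) m (E2 i)) k = _
  erw [h2]
  rfl

theorem contDiff_matrix_mul {k : WithTop ℕ∞} (hA : ContDiff ℝ k A) (hB : ContDiff ℝ k B) :
    ContDiff ℝ k fun p => A p * B p := by
  rw [contDiff_matrix_iff] at *
  intro i j
  simp only [Matrix.mul_apply]
  exact ContDiff.sum fun l _ => (hA i l).mul (hB l j)

theorem contDiff_matrix_transpose {k : WithTop ℕ∞} (hA : ContDiff ℝ k A) :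
    ContDiff ℝ k fun p => (A p)ᵀ := by
  rw [contDiff_matrix_iff] at *
  exact fun i j => hA j i

theorem contDiff_matrix_add {k : WithTop ℕ∞} (hA : ContDiff ℝ k A) (hB : ContDiff ℝ k B) :
    ContDiff ℝ k fun p => A p + B p := hA.add hB

theorem contDiff_matrix_sub {k : WithTop ℕ∞} (hA : ContDiff ℝ k A) (hB : ContDiff ℝ k B) :
    ContDiff ℝ k fun p => A p - B p := hA.sub hB

theorem contDiff_matrix_neg {k : WithTop ℕ∞} (hA : ContDiff ℝ k A) :
    ContDiff ℝ k fun p => -A p := hA.neg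

theorem contDiff_matrix_smul {k : WithTop ℕ∞} {c : R2 → ℝ} (hc : ContDiff ℝ k c)
    (hA : ContDiff ℝ k A) : ContDiff ℝ k fun p => c p • A p := by
  rw [contDiff_matrix_iff] at *
  exact fun i j => hc.mul (hA i j)

theorem contDiff_matrix_lie {k : WithTop ℕ∞} (hA : ContDiff ℝ k A) (hB : ContDiff ℝ k B) :
    ContDiff ℝ k fun p => ⁅A p, B p⁆ :=
  contDiff_matrix_sub (contDiff_matrix_mul hA hB) (contDiff_matrix_mul hB hA)

theorem differentiable_matrix_mul (hA : Differentiable ℝ A) (hB : Differentiable ℝ B) :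
    Differentiable ℝ fun p => A p * B p := by
  rw [differentiable_matrix_iff] at *
  intro i j
  simp only [Matrix.mul_apply]
  exact Differentiable.fun_sum fun l _ => (hA i l).mul (hB l j)

theorem differentiable_matrix_transpose (hA : Differentiable ℝ A) :
    Differentiable ℝ fun p => (A p)ᵀ := by
  rw [differentiable_matrix_iff] at *
  exact fun i j => hA j i

theorem pd_mul (hA : Differentiable ℝ A) (hB : Differentiable ℝ B) (i : Fin 2) (m : R2) :
    pd i (fun p => A p * B p) m = pd i A m * B m + A m * pd i B m :=
  pd_bilin (mulL n) hA hB i m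

theorem pd_transpose (hA : Differentiable ℝ A) (i : Fin 2) (m : R2) :
    pd i (fun p => (A p)ᵀ) m = (pd i A m)ᵀ := pd_clm (transposeL n) hA i m

theorem pd_matrix_add (hA : Differentiable ℝ A) (hB : Differentiable ℝ B) (i : Fin 2) (m : R2) :
    pd i (fun p => A p + B p) m = pd i A m + pd i B m := pd_add hA hB i m

theorem pd_matrix_sub (hA : Differentiable ℝ A) (hB : Differentiable ℝ B) (i : Fin 2) (m : R2) :
    pd i (fun p => A p - B p) m = pd i A m - pd i B m := pd_sub hA hB i m

theorem pd_matrix_const (C : Matrix n n ℝ) (i : Fin 2) (m : R2) : pd i (fun _ => C) m = 0 :=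
  pd_const C i m

theorem pd_matrix_smul {c : R2 → ℝ} (hc : Differentiable ℝ c) (hA : Differentiable ℝ A)
    (i : Fin 2) (m : R2) : pd i (fun p => c p • A p) m = pd i c m • A m + c m • pd i A m :=
  pd_smul hc hA i m

theorem pd_matrix_const_smul (c : ℝ) (hA : Differentiable ℝ A)
    (i : Fin 2) (m : R2) : pd i (fun p => c • A p) m = c • pd i A m :=
  (pd_matrix_smul (differentiable_const c) hA i m).trans (by rw [pd_const]; simp)

theorem pd_const_mul (C : Matrix n n ℝ) (hA : Differentiable ℝ A) (i : Fin 2) (m : R2) :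
    pd i (fun p => C * A p) m = C * pd i A m := by
  rw [pd_mul (differentiable_const C) hA, pd_matrix_const, Matrix.zero_mul, zero_add]

theorem pd_mul_const (hA : Differentiable ℝ A) (C : Matrix n n ℝ) (i : Fin 2) (m : R2) :
    pd i (fun p => A p * C) m = pd i A m * C := by
  rw [pd_mul hA (differentiable_const C), pd_matrix_const, Matrix.mul_zero, add_zero]

theorem pd_lie (hA : Differentiable ℝ A) (hB : Differentiable ℝ B) (i : Fin 2) (m : R2) :
    pd i (fun p => ⁅A p, B p⁆) m = ⁅pd i A m, B m⁆ + ⁅A m, pd i B m⁆ := by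
  simp only [Ring.lie_def]
  rw [pd_matrix_sub (differentiable_matrix_mul hA hB) (differentiable_matrix_mul hB hA),
    pd_mul hA hB, pd_mul hB hA]
  abel

theorem fderiv_matrix_eq_pd (A : R2 → Matrix n n ℝ) (m u : R2) :
    fderiv ℝ A m u = u 0 • pd 0 A m + u 1 • pd 1 A m := fderiv_eq_pd A m u

theorem contDiff_act {A : R2 → Mat7} {y : R2 → R7} {k : WithTop ℕ∞} (hA : ContDiff ℝ k A)
    (hy : ContDiff ℝ k y) : ContDiff ℝ k fun p => act (A p) (y p) := by
  rw [contDiff_matrix_iff] at hA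
  rw [contDiff_euclidean] at *
  intro i
  simp only [act_apply]
  exact ContDiff.sum fun l _ => (hA i l).mul (hy l)

theorem pd_act {A : R2 → Mat7} {y : R2 → R7} (hA : Differentiable ℝ A)
    (hy : Differentiable ℝ y) (i : Fin 2) (m : R2) : pd i (fun p => act (A p) (y p)) m =
      act (pd i A m) (y m) + act (A m) (pd i y m) :=
  pd_bilin actL hA hy i m

theorem differentiable_act {A : R2 → Mat7} {y : R2 → R7} (hA : Differentiable ℝ A)
    (hy : Differentiable ℝ y) : Differentiable ℝ fun p => act (A p) (y p) := by
  rw [differentiable_matrix_iff] at hA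
  rw [differentiable_euclidean] at *
  intro i
  simp only [act_apply]
  exact Differentiable.fun_sum fun l _ => (hA i l).mul (hy l)

/-- The cross product as a continuous bilinear map. -/
def crossL : R7 →L[ℝ] R7 →L[ℝ] R7 := toBilinL crossₗ

theorem contDiff_cross {x y : R2 → R7} {k : WithTop ℕ∞} (hx : ContDiff ℝ k x)
    (hy : ContDiff ℝ k y) : ContDiff ℝ k fun p => cross (x p) (y p) :=
  (crossL.contDiff.comp hx).clm_apply hy

theorem pd_cross {x y : R2 → R7} (hx : Differentiable ℝ x) (hy : Differentiable ℝ y) (i : Fin 2)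
    (m : R2) : pd i (fun p => cross (x p) (y p)) m =
      cross (pd i x m) (y m) + cross (x m) (pd i y m) :=
  pd_bilin crossL hx hy i m

end MatrixCalculus

/-! ### Flat matrix-valued one-forms and their frames -/

section Flatness

open Matrix

variable {E : Type*} [NormedAddCommGroup E] [NormedSpace ℝ E]

/-- The one-form `A₀ du₀ + A₁ du₁`. -/
def formOfPair (A : Fin 2 → R2 → E) (m : R2) : R2 →L[ℝ] E :=
  (EuclideanSpace.proj 0 : R2 →L[ℝ] ℝ).smulRight (A 0 m) +
    (EuclideanSpace.proj 1 : R2 →L[ℝ] ℝ).smulRight (A 1 m)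

theorem formOfPair_apply (A : Fin 2 → R2 → E) (m u : R2) :
    formOfPair A m u = u 0 • A 0 m + u 1 • A 1 m := rfl

theorem contDiff_formOfPair {A : Fin 2 → R2 → E} (hA : ∀ i, ContDiff ℝ ∞ (A i)) :
    ContDiff ℝ ∞ (formOfPair A) :=
  ((ContinuousLinearMap.smulRightL ℝ R2 E (EuclideanSpace.proj 0)).contDiff.comp (hA 0)).add
    ((ContinuousLinearMap.smulRightL ℝ R2 E (EuclideanSpace.proj 1)).contDiff.comp (hA 1))

theorem fderiv_formOfPair {A : Fin 2 → R2 → E} (hA : ∀ i, ContDiff ℝ ∞ (A i)) (m u w : R2) :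
    fderiv ℝ (formOfPair A) m u w =
      w 0 • (u 0 • pd 0 (A 0) m + u 1 • pd 1 (A 0) m) +
      w 1 • (u 0 • pd 0 (A 1) m + u 1 • pd 1 (A 1) m) := by
  have h := fderiv_clm (ContinuousLinearMap.apply ℝ E w)
    (differentiable_infty (contDiff_formOfPair hA)) m u
  have hd (i : Fin 2) : Differentiable ℝ (A i) := differentiable_infty (hA i)
  have h2 : (fun p => ContinuousLinearMap.apply ℝ E w (formOfPair A p)) =
      fun p => w 0 • A 0 p + w 1 • A 1 p := rfl
  rw [h2, fderiv_fun_add ((hd 0 m).fun_const_smul _) ((hd 1 m).fun_const_smul _),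
    fderiv_fun_const_smul (hd 0 m), fderiv_fun_const_smul (hd 1 m)] at h
  refine h.symm.trans ?_
  simp only [_root_.add_apply, _root_.smul_apply, fderiv_eq_pd]

/-- A two-form on the plane has a single component, so integrability is one equation for the two
coefficients. -/
theorem exists_solution_of_pair [CompleteSpace E] {A : Fin 2 → R2 → E →L[ℝ] E}
    (hA : ∀ i, ContDiff ℝ ∞ (A i))
    (hflat : ∀ m, pd 0 (A 1) m - pd 1 (A 0) m = A 0 m ∘L A 1 m - A 1 m ∘L A 0 m) (y₀ : E) :
    ∃ Y : R2 → E, ContDiff ℝ ∞ Y ∧ Y 0 = y₀ ∧ ∀ i m, pd i Y m = A i m (Y m) := by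
  have hint : IsIntegrable (formOfPair A) := by
    intro m u w
    rw [fderiv_formOfPair hA, fderiv_formOfPair hA, formOfPair_apply, formOfPair_apply]
    have : A 0 m ∘L A 1 m = pd 0 (A 1) m - pd 1 (A 0) m + A 1 m ∘L A 0 m := by
      rw [hflat m]; abel
    simp only [ContinuousLinearMap.comp_add, ContinuousLinearMap.add_comp,
      ContinuousLinearMap.comp_smul, ContinuousLinearMap.smul_comp, this]
    module
  obtain ⟨Y, h1, h2, h3⟩ := exists_solution_of_isIntegrable (contDiff_formOfPair hA) hint y₀
  refine ⟨Y, h1, h2, fun i m => ?_⟩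
  rw [pd, h3, formOfPair_apply]
  fin_cases i <;> simp

theorem eq_zero_of_pair {A : Fin 2 → R2 → E →L[ℝ] E} (hA : ∀ i, Continuous (A i)) {f : R2 → E}
    (hf : Differentiable ℝ f) (h0 : f 0 = 0) (h : ∀ i m, pd i f m = A i m (f m)) (m : R2) :
    f m = 0 := by
  have hc : Continuous (formOfPair A) :=
    ((ContinuousLinearMap.smulRightL ℝ R2 (E →L[ℝ] E)
      (EuclideanSpace.proj 0)).continuous.comp (hA 0)).add
    ((ContinuousLinearMap.smulRightL ℝ R2 (E →L[ℝ] E)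
      (EuclideanSpace.proj 1)).continuous.comp (hA 1))
  refine eq_zero_of_linear_fderiv hf hc h0 (fun m u => ?_) m
  rw [fderiv_eq_pd, h, h, formOfPair_apply]
  rfl

variable {n : Type*} [Fintype n] [DecidableEq n]

/-- Right multiplication of matrices, on the normed space of functions `n → n → ℝ`. -/
def rightMul (n : Type*) [Fintype n] [DecidableEq n] :
    (n → n → ℝ) →L[ℝ] (n → n → ℝ) →L[ℝ] (n → n → ℝ) :=
  (toBilinL (LinearMap.mul ℝ (Matrix n n ℝ) : (n → n → ℝ) →ₗ[ℝ] (n → n → ℝ) →ₗ[ℝ] (n → n → ℝ))).flip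

/-- Flatness of the one-form `A₀ du₀ + A₁ du₁`. -/
def IsFlatPair (A : Fin 2 → R2 → Matrix n n ℝ) : Prop :=
  ∀ m, pd 0 (A 1) m - pd 1 (A 0) m + ⁅A 0 m, A 1 m⁆ = 0

/-- Flat matrix-valued one-forms can be integrated. -/
theorem exists_frame_of_isFlatPair {A : Fin 2 → R2 → Matrix n n ℝ} (hA : ∀ i, ContDiff ℝ ∞ (A i))
    (hflat : IsFlatPair A) (g : Matrix n n ℝ) :
    ∃ Φ : R2 → Matrix n n ℝ, ContDiff ℝ ∞ Φ ∧ Φ 0 = g ∧ ∀ i m, pd i Φ m = Φ m * A i m := by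
  have hA' (i : Fin 2) : ContDiff ℝ ∞ (A i : R2 → n → n → ℝ) := hA i
  refine exists_solution_of_pair
    -- Right multiplication reverses products; this produces the sign of the bracket in
    -- `IsFlatPair`.
    (A := fun i m => rightMul n (A i m)) (fun i => (rightMul n).contDiff.comp (hA' i))
    (fun m => ?_) g
  · rw [pd_clm (rightMul n) (differentiable_infty (hA' 1)),
      pd_clm (rightMul n) (differentiable_infty (hA' 0)), ← map_sub]
    have h := eq_neg_of_add_eq_zero_left (hflat m)
    refine (congrArg (rightMul n) h).trans ?_
    refine ContinuousLinearMap.ext fun (X : Matrix n n ℝ) => ?_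
    change X * -⁅A 0 m, A 1 m⁆ = X * A 1 m * A 0 m - X * A 0 m * A 1 m
    rw [Ring.lie_def]
    noncomm_ring

/-- Uniqueness for `dΦ = ΦA`. It is applied to defects of algebraic relations, which satisfy the
same linear equation as the frame. -/
theorem eq_zero_of_frame {A : Fin 2 → R2 → Matrix n n ℝ} (hA : ∀ i, Continuous (A i))
    {Φ : R2 → Matrix n n ℝ} (hΦ : Differentiable ℝ Φ) (h : ∀ i m, pd i Φ m = Φ m * A i m)
    (h0 : Φ 0 = 0) (m : R2) : Φ m = 0 := by
  have hA' (i : Fin 2) : Continuous (A i : R2 → n → n → ℝ) := hA i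
  have hΦ' : Differentiable ℝ (Φ : R2 → n → n → ℝ) := hΦ
  exact eq_zero_of_pair (A := fun i m => rightMul n (A i m))
    (fun i => (rightMul n).continuous.comp (hA' i)) hΦ' h0 h m

/-- Converse to integrability: equality of the mixed second derivatives of `Φ` gives `Φ` times the
curvature, and the left inverse `Ψ` removes `Φ`. -/
theorem isFlatPair_of_frame {A : Fin 2 → R2 → Matrix n n ℝ} (hA : ∀ i, Differentiable ℝ (A i))
    {Φ : R2 → Matrix n n ℝ} (hΦ : ContDiff ℝ ∞ Φ) (h : ∀ i m, pd i Φ m = Φ m * A i m)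
    {Ψ : R2 → Matrix n n ℝ} (hΨ : ∀ m, Ψ m * Φ m = 1) : IsFlatPair A := by
  intro m
  have hd := differentiable_infty hΦ
  have hs := pd_comm hΦ 0 1 m
  have h' (i : Fin 2) : pd i Φ = fun p => Φ p * A i p := funext (h i)
  rw [h' 0, h' 1, pd_mul hd (hA 1), pd_mul hd (hA 0), h, h] at hs
  have h2 : Φ m * (pd 0 (A 1) m - pd 1 (A 0) m + ⁅A 0 m, A 1 m⁆) = 0 := by
    rw [Ring.lie_def, ← sub_eq_zero.2 hs]
    noncomm_ring
  have h3 := congrArg (fun X => Ψ m * X) h2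
  simpa only [← mul_assoc, hΨ, one_mul, mul_zero] using h3

/-- Both defining conditions of `G₂` are conserved quantities: `ΦΦᵀ` and `Φ(Φᵀu × Φᵀv)` have zero
derivative when the coefficients are skew derivations. -/
theorem mem_G2_of_frame {A : Fin 2 → R2 → Mat7} {Φ : R2 → Mat7} (hΦ : Differentiable ℝ Φ)
    (h : ∀ i m, pd i Φ m = Φ m * A i m) (hA : ∀ i m, A i m ∈ g2) (h0 : Φ 0 ∈ G2) (m : R2) :
    Φ m ∈ G2 := by
  have hT : Differentiable ℝ fun p => (Φ p)ᵀ := differentiable_matrix_transpose hΦ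
  have hdT (i : Fin 2) (m : R2) : pd i (fun p => (Φ p)ᵀ) m = -(A i m * (Φ m)ᵀ) := by
    rw [pd_transpose hΦ, h, Matrix.transpose_mul, (hA i m).1, Matrix.neg_mul]
  have horth (m : R2) : Φ m * (Φ m)ᵀ = 1 := by
    rw [eq_of_pd_eq_zero (f := fun p => Φ p * (Φ p)ᵀ)
      (differentiable_matrix_mul hΦ hT) (fun i m => ?_) m, mul_transpose_self_of_mem_G2 h0]
    refine (pd_mul hΦ hT i m).trans ?_
    rw [h, hdT]
    change _ = (0 : Mat7)
    noncomm_ring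
  have horth' (m : R2) : (Φ m)ᵀ * Φ m = 1 := mul_eq_one_comm.1 (horth m)
  rw [← Matrix.transpose_transpose (Φ m)]
  refine transpose_mem_G2 ⟨?_, fun u v => ?_⟩
  · rw [Matrix.mem_orthogonalGroup_iff, Matrix.transpose_transpose]
    exact horth' m
  · have ha (u : R7) : Differentiable ℝ fun p => act (Φ p)ᵀ u :=
      differentiable_act hT (differentiable_const u)
    have hda (u : R7) (i : Fin 2) (m : R2) : pd i (fun p => act (Φ p)ᵀ u) m =
        -act (A i m) (act (Φ m)ᵀ u) := by
      rw [pd_act hT (differentiable_const u), hdT, act_neg, act_mul, pd_const]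
      simp
    have hc : Differentiable ℝ fun p => cross (act (Φ p)ᵀ u) (act (Φ p)ᵀ v) := fun m =>
      (crossL.differentiable.comp (ha u) m).clm_apply (ha v m)
    have key := eq_of_pd_eq_zero
      (f := fun p => act (Φ p) (cross (act (Φ p)ᵀ u) (act (Φ p)ᵀ v)))
      (differentiable_act hΦ hc) (fun i m => ?_) m
    · have h0' := (transpose_mem_G2 h0).2 u v
      rw [← h0', act_act_transpose h0] at key
      rw [← key, ← act_mul, horth' m, act_one]
    · rw [pd_act hΦ hc, pd_cross (ha u) (ha v), hda, hda, h, act_mul,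
        (hA i m).2, ← act_map_add, cross_neg_left, cross_neg_right]
      convert (Matrix.toEuclideanLin (Φ m)).map_zero
      abel

/-- Flat `𝔤₂`-valued one-forms can be integrated to maps into `G₂`. -/
theorem exists_G2_frame_of_isFlatPair {A : Fin 2 → R2 → Mat7} (hA : ∀ i, ContDiff ℝ ∞ (A i))
    (hflat : IsFlatPair A) (hg : ∀ i m, A i m ∈ g2) {g : Mat7} (h0 : g ∈ G2) :
    ∃ Φ : R2 → Mat7, ContDiff ℝ ∞ Φ ∧ Φ 0 = g ∧ (∀ m, Φ m ∈ G2) ∧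
      ∀ i m, pd i Φ m = Φ m * A i m := by
  obtain ⟨Φ, h1, h2, h3⟩ := exists_frame_of_isFlatPair hA hflat g
  exact ⟨Φ, h1, h2, mem_G2_of_frame (differentiable_infty h1) h3 hg (h2 ▸ h0), h3⟩

end Flatness

/-! ### Nondegeneracy and curvature in terms of reflections -/

section Bundles

open Matrix

theorem fderiv_actL {A : R2 → Mat7} (hA : Differentiable ℝ A) (m u : R2) :
    fderiv ℝ (fun p => actL (A p)) m u = actL (fderiv ℝ A m u) := fderiv_clm actL hA m u

theorem lie_smul_smul {n : Type*} [Fintype n] [DecidableEq n] (c d : ℝ) (A B : Matrix n n ℝ) :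
    ⁅c • A, d • B⁆ = (c * d) • ⁅A, B⁆ := by
  simp only [Ring.lie_def, Matrix.smul_mul, Matrix.mul_smul, smul_smul, smul_sub, mul_comm d c]

/-- The curvature of a bundle of subspaces, in terms of the projections onto them. -/
theorem covariant_commutator {Q : R2 → Mat7} (hQ : Differentiable ℝ Q) (hQQ : ∀ m, Q m * Q m = Q m)
    {s : R2 → R7} (hs : ContDiff ℝ ∞ s) (hQs : ∀ m, act (Q m) (s m) = s m) (m : R2) :
    act (Q m) (pd 0 (fun p => act (Q p) (pd 1 s p)) m) -
      act (Q m) (pd 1 (fun p => act (Q p) (pd 0 s p)) m) = act ⁅pd 0 Q m, pd 1 Q m⁆ (s m) := by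
  have hsd := differentiable_infty hs
  have hpd (i : Fin 2) : Differentiable ℝ (pd i s) := differentiable_infty (contDiff_pd hs i)
  have h1 (i : Fin 2) : pd i Q m * Q m + Q m * pd i Q m = pd i Q m := by
    rw [← pd_mul hQ hQ]; simp only [hQQ]
  have h2 (i : Fin 2) : act (pd i Q m) (s m) + act (Q m) (pd i s m) = pd i s m := by
    rw [← pd_act hQ hsd]; simp only [hQs]
  -- From `Q² = Q` one has `Q ∂ᵢQ = ∂ᵢQ (1 - Q)`, and from `Qs = s` one has `(1 - Q) ∂ⱼs = ∂ⱼQ s`.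
  have h3 (i j : Fin 2) : act (Q m) (act (pd i Q m) (pd j s m)) =
      act (pd i Q m) (act (pd j Q m) (s m)) := by
    rw [← act_mul, eq_sub_of_add_eq' (h1 i), act_sub, act_mul, ← act_map_sub,
      ← eq_sub_of_add_eq (h2 j)]
  rw [pd_act hQ (hpd 1), pd_act hQ (hpd 0), act_map_add, act_map_add, h3, h3, pd_comm hs 1 0,
    Ring.lie_def, act_sub, act_mul, act_mul]
  abel

/-- The curvature is `[∂₀Q, ∂₁Q]` restricted to the image of `Q`. The sections `Q c` with constant
`c` fill every fibre and suffice as test sections. -/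
theorem isFlatBundle_iff {W : R2 → Submodule ℝ R7} {Q : R2 → Mat7} (hQ : ContDiff ℝ ∞ Q)
    (hQQ : ∀ m, Q m * Q m = Q m) (hW : ∀ m, (W m).starProjection = actL (Q m)) :
    IsFlatBundle W ↔ ∀ m, ⁅pd 0 Q m, pd 1 Q m⁆ * Q m = 0 := by
  have hQd := differentiable_infty hQ
  have hcov (u : R2) (s : R2 → R7) (m : R2) : covDeriv W u s m =
      u 0 • act (Q m) (pd 0 s m) + u 1 • act (Q m) (pd 1 s m) := by
    rw [covDeriv, hW, actL_apply, fderiv_eq_pd, act_map_add, act_map_smul, act_map_smul]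
  have hmem (m : R2) (y : R7) : y ∈ W m ↔ act (Q m) y = y := by
    rw [← Submodule.starProjection_eq_self_iff, hW, actL_apply]
  constructor
  · intro h m
    refine act_injective fun c => ?_
    have hs : ContDiff ℝ ∞ fun p => act (Q p) c := contDiff_act hQ contDiff_const
    have hsQ (m : R2) : act (Q m) (act (Q m) c) = act (Q m) c := by rw [← act_mul, hQQ]
    have h1 := h _ hs (fun m => (hmem m _).2 (hsQ m)) (E2 0) (E2 1) m
    have hf (i : Fin 2) : covDeriv W (E2 i) (fun p => act (Q p) c) =
        fun p => act (Q p) (pd i (fun p => act (Q p) c) p) := by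
      funext p
      rw [hcov]
      fin_cases i <;> simp
    have hf' (i : Fin 2) (s : R2 → R7) : covDeriv W (E2 i) s m = act (Q m) (pd i s m) := by
      rw [hcov]
      fin_cases i <;> simp
    rw [hf, hf, hf', hf', ← sub_eq_zero, covariant_commutator hQd hQQ hs hsQ, ← act_mul] at h1
    rw [h1]
    simp [act]
  · intro h s hs hsW u w m
    have hsQ (m : R2) : act (Q m) (s m) = s m := (hmem m _).1 (hsW m)
    have hd (i : Fin 2) : Differentiable ℝ fun p => act (Q p) (pd i s p) :=
      differentiable_infty (contDiff_act hQ (contDiff_pd hs i))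
    have hf (u : R2) : covDeriv W u s =
        fun p => u 0 • act (Q p) (pd 0 s p) + u 1 • act (Q p) (pd 1 s p) := funext (hcov u s)
    have hp (w : R2) (i : Fin 2) : pd i (covDeriv W w s) m =
        w 0 • pd i (fun p => act (Q p) (pd 0 s p)) m +
        w 1 • pd i (fun p => act (Q p) (pd 1 s p)) m := by
      rw [hf, pd_add ((hd 0).fun_const_smul _) ((hd 1).fun_const_smul _),
        pd_smul (differentiable_const _) (hd 0), pd_smul (differentiable_const _) (hd 1),
        pd_const, pd_const]
      simp
    have hc := covariant_commutator hQd hQQ hs hsQ m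
    have hz : act ⁅pd 0 Q m, pd 1 Q m⁆ (s m) = 0 := by
      rw [← hsQ m, ← act_mul, h m]; simp [act]
    rw [hz, sub_eq_zero] at hc
    rw [hcov, hcov, hp, hp, hp, hp]
    simp only [act_map_add, act_map_smul, hc]
    module

/-- The projection is an injective affine function of `S`, so the two derivatives have the same
kernel. -/
theorem isNondegenerate_iff {φ : R2 → R7} {S : R2 → Mat7} (hS : ContDiff ℝ ∞ S)
    (hφ : ∀ m, (extGauss φ m).starProjection = actL ((1 / 2 : ℝ) • (1 + S m))) :
    IsNondegenerate φ ↔ ∀ m (u : R2), u 0 • pd 0 S m + u 1 • pd 1 S m = 0 → u = 0 := by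
  have hd := differentiable_infty hS
  have hfd : (fun p => (extGauss φ p).starProjection) =
      fun p => actL ((1 / 2 : ℝ) • (1 + S p)) := funext hφ
  have hd1 : Differentiable ℝ fun p => (1 : Mat7) + S p := (differentiable_const (1 : Mat7)).add hd
  have hd2 : Differentiable ℝ fun p => (1 / 2 : ℝ) • (1 + S p) := hd1.fun_const_smul _
  have key (m u : R2) : fderiv ℝ (fun p => (extGauss φ p).starProjection) m u =
      actL ((1 / 2 : ℝ) • (u 0 • pd 0 S m + u 1 • pd 1 S m)) := by
    have hp (i : Fin 2) : pd i (fun p => (1 / 2 : ℝ) • (1 + S p)) m = (1 / 2 : ℝ) • pd i S m := by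
      rw [pd_matrix_const_smul _ hd1, pd_matrix_add (differentiable_const (1 : Mat7)) hd,
        pd_matrix_const, zero_add]
    rw [hfd]
    rw [fderiv_actL hd2, fderiv_matrix_eq_pd, hp, hp]
    congr 1
    module
  refine forall_congr' fun m => ?_
  rw [injective_iff_map_eq_zero]
  refine forall_congr' fun u => ?_
  rw [key]
  have : actL ((1 / 2 : ℝ) • (u 0 • pd 0 S m + u 1 • pd 1 S m)) = 0 ↔
      u 0 • pd 0 S m + u 1 • pd 1 S m = 0 := by
    constructor
    · intro h
      have := actL_injective (h.trans actL.map_zero.symm)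
      exact (smul_eq_zero.1 this).resolve_left (by norm_num)
    · intro h
      rw [h, smul_zero]
      exact actL.map_zero
  rw [this]

/-- The projection to the coassociative plane is `(1 - S)/2`, and constant factors do not matter for
vanishing. -/
theorem isAbelian_iff {φ : R2 → R7} {S : R2 → Mat7} (hS : ContDiff ℝ ∞ S)
    (hSS : ∀ m, S m * S m = 1)
    (hφ : ∀ m, (extGauss φ m).starProjection = actL ((1 / 2 : ℝ) • (1 + S m))) :
    IsAbelian φ ↔ ∀ m, ⁅pd 0 S m, pd 1 S m⁆ * (1 - S m) = 0 := by
  have hd := differentiable_infty hS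
  have hd1 : Differentiable ℝ fun p => (1 : Mat7) - S p := (differentiable_const (1 : Mat7)).sub hd
  have hQ : ContDiff ℝ ∞ fun p => (1 / 2 : ℝ) • ((1 : Mat7) - S p) :=
    contDiff_matrix_smul contDiff_const (contDiff_matrix_sub contDiff_const hS)
  rw [IsAbelian, isFlatBundle_iff hQ]
  · refine forall_congr' fun m => ?_
    have hp (i : Fin 2) : pd i (fun p => (1 / 2 : ℝ) • (1 - S p)) m = -(1 / 2 : ℝ) • pd i S m := by
      rw [pd_matrix_const_smul _ hd1, pd_matrix_sub (differentiable_const (1 : Mat7)) hd,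
        pd_matrix_const, zero_sub, neg_smul, smul_neg]
    rw [hp, hp, lie_smul_smul, Matrix.smul_mul, Matrix.mul_smul, smul_smul, smul_eq_zero]
    norm_num
  · intro m
    rw [Matrix.smul_mul, Matrix.mul_smul, smul_smul, Matrix.sub_mul, Matrix.mul_sub, Matrix.mul_sub,
      hSS, one_mul, mul_one, one_mul]
    module
  · intro m
    ext1 w
    rw [Submodule.starProjection_orthogonal_val, hφ, actL_apply, actL_apply, act_smul, act_smul,
      act_add, act_sub, act_one]
    module

/-- The even part commutes with `S7` and cancels; the odd part anticommutes and is doubled. So the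
derivative of the Gauss map sees exactly the odd part. -/
theorem pd_reflection {F : R2 → Mat7} (hF : Differentiable ℝ F)
    {A B : Fin 2 → R2 → Mat7} (h : ∀ i m, pd i F m = F m * (A i m + B i m))
    (hA : ∀ i m, S7 * A i m = -(A i m * S7)) (hA' : ∀ i m, A i m ∈ g2)
    (hB : ∀ i m, S7 * B i m = B i m * S7) (hB' : ∀ i m, B i m ∈ g2) (i : Fin 2) (m : R2) :
    pd i (fun p => reflection (F p)) m = (2 : ℝ) • (F m * (A i m * S7) * (F m)ᵀ) := by
  have hT := differentiable_matrix_transpose hF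
  have h1 : Differentiable ℝ fun p => F p * S7 := differentiable_matrix_mul hF (differentiable_const _)
  unfold reflection
  rw [pd_mul h1 hT, pd_mul_const hF, pd_transpose hF, h, Matrix.transpose_mul,
    (add_mem_g2 (hA' i m) (hB' i m)).1]
  have : S7 * (A i m + B i m) = -(A i m * S7) + B i m * S7 := by rw [Matrix.mul_add, hA, hB]
  calc F m * (A i m + B i m) * S7 * (F m)ᵀ + F m * S7 * (-(A i m + B i m) * (F m)ᵀ)
      = F m * ((A i m + B i m) * S7 - S7 * (A i m + B i m)) * (F m)ᵀ := by noncomm_ring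
    _ = _ := by rw [this, two_smul]; noncomm_ring

theorem reflection_mul_self {F : Mat7} (hF : F ∈ G2) : reflection F * reflection F = 1 := by
  have h := transpose_mul_self_of_mem_G2 hF
  calc F * S7 * Fᵀ * (F * S7 * Fᵀ) = F * S7 * (Fᵀ * F) * (S7 * Fᵀ) := by noncomm_ring
    _ = F * (S7 * S7) * Fᵀ := by rw [h]; noncomm_ring
    _ = 1 := by rw [S7_mul_S7, mul_one, mul_transpose_self_of_mem_G2 hF]

theorem contDiff_reflection {F : R2 → Mat7} (hF : ContDiff ℝ ∞ F) :
    ContDiff ℝ ∞ fun p => reflection (F p) :=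
  contDiff_matrix_mul (contDiff_matrix_mul hF contDiff_const) (contDiff_matrix_transpose hF)

/-- A surface with an adapted frame whose `𝔭`-part consists of commuting, linearly independent
matrices is nondegenerate and abelian. -/
theorem isNondegenerate_and_isAbelian_of_frame {φ : R2 → R7} {F : R2 → Mat7} (hF : ContDiff ℝ ∞ F)
    (hG : ∀ m, F m ∈ G2) (hφ : ∀ m, extGauss φ m = framePlane (F m))
    {A B : Fin 2 → R2 → Mat7} (h : ∀ i m, pd i F m = F m * (A i m + B i m))
    (hA : ∀ i m, S7 * A i m = -(A i m * S7)) (hA' : ∀ i m, A i m ∈ g2)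
    (hB : ∀ i m, S7 * B i m = B i m * S7) (hB' : ∀ i m, B i m ∈ g2)
    (hcomm : ∀ m, ⁅A 0 m, A 1 m⁆ = 0)
    (hind : ∀ m (u : R2), u 0 • A 0 m + u 1 • A 1 m = 0 → u = 0) :
    IsNondegenerate φ ∧ IsAbelian φ := by
  have hS := contDiff_reflection hF
  have hpr : ∀ m, (extGauss φ m).starProjection = actL ((1 / 2 : ℝ) • (1 + reflection (F m))) :=
    fun m => by rw [hφ, starProjection_framePlane (hG m)]
  have hpd := pd_reflection (differentiable_infty hF) h hA hA' hB hB'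
  have hFF (m : R2) := transpose_mul_self_of_mem_G2 (hG m)
  constructor
  · rw [isNondegenerate_iff hS hpr]
    intro m u hu
    refine hind m u ?_
    rw [hpd, hpd] at hu
    have h2 : u 0 • A 0 m + u 1 • A 1 m = (1 / 2 : ℝ) • ((F m)ᵀ *
        (u 0 • (2 : ℝ) • (F m * (A 0 m * S7) * (F m)ᵀ) +
          u 1 • (2 : ℝ) • (F m * (A 1 m * S7) * (F m)ᵀ)) * F m * S7) := by
      have hX (X : Mat7) : (F m)ᵀ * (F m * (X * S7) * (F m)ᵀ) * F m * S7 = X := by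
        calc (F m)ᵀ * (F m * (X * S7) * (F m)ᵀ) * F m * S7 =
            (F m)ᵀ * F m * X * S7 * ((F m)ᵀ * F m) * S7 := by noncomm_ring
          _ = X * (S7 * S7) := by rw [hFF]; noncomm_ring
          _ = X := by rw [S7_mul_S7, mul_one]
      simp only [Matrix.mul_add, Matrix.add_mul, Matrix.mul_smul, Matrix.smul_mul, hX]
      module
    rw [h2, hu]
    simp
  · rw [isAbelian_iff hS (fun m => reflection_mul_self (hG m)) hpr]
    intro m
    have : ⁅pd 0 (fun p => reflection (F p)) m, pd 1 (fun p => reflection (F p)) m⁆ = 0 := by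
      rw [hpd, hpd, lie_smul_smul, Ring.lie_def]
      have hX (X Y : Mat7) (hY : S7 * Y = -(Y * S7)) :
          F m * (X * S7) * (F m)ᵀ * (F m * (Y * S7) * (F m)ᵀ) = -(F m * (X * Y) * (F m)ᵀ) := by
        calc F m * (X * S7) * (F m)ᵀ * (F m * (Y * S7) * (F m)ᵀ) =
            F m * (X * S7) * ((F m)ᵀ * F m) * (Y * S7) * (F m)ᵀ := by noncomm_ring
          _ = F m * (X * (S7 * Y) * S7) * (F m)ᵀ := by rw [hFF]; noncomm_ring
          _ = -(F m * (X * Y * (S7 * S7)) * (F m)ᵀ) := by rw [hY]; noncomm_ring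
          _ = _ := by rw [S7_mul_S7, mul_one]
      rw [hX _ _ (hA 1 m), hX _ _ (hA 0 m)]
      have hc := hcomm m
      rw [Ring.lie_def, sub_eq_zero] at hc
      rw [hc]
      simp
    rw [this, Matrix.zero_mul]

end Bundles

/-! ### The affine group and its Lie algebra in block form -/

section Affine

open Matrix

/-- The element of the Lie algebra of the affine group with linear part `A` and translation part
`c`. -/
def affineLie (A : Mat7) (c : R7) : Mat8 ℝ :=
  Matrix.fromBlocks A (Matrix.replicateCol Unit c.ofLp) 0 0

theorem mul_replicateCol (A : Mat7) (c : R7) :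
    A * Matrix.replicateCol Unit c.ofLp = Matrix.replicateCol Unit (act A c).ofLp := by
  ext i j
  simp [Matrix.mul_apply, Matrix.mulVec, dotProduct]

theorem affineLie_mul (A B : Mat7) (c d : R7) :
    affineLie A c * affineLie B d = affineLie (A * B) (act A d) := by
  rw [affineLie, affineLie, Matrix.fromBlocks_multiply, mul_replicateCol]
  simp [affineLie]

theorem affineMatrix_mul_affineLie (A B : Mat7) (c d : R7) :
    affineMatrix A c * affineLie B d = affineLie (A * B) (act A d) := by
  rw [affineMatrix, affineLie, Matrix.fromBlocks_multiply, mul_replicateCol]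
  simp [affineLie]

theorem affineLie_mul_affineMatrix (A B : Mat7) (c d : R7) :
    affineLie A c * affineMatrix B d = affineLie (A * B) (act A d + c) := by
  rw [affineMatrix, affineLie, Matrix.fromBlocks_multiply, mul_replicateCol]
  simp only [Matrix.mul_zero, Matrix.zero_mul, Matrix.mul_one, add_zero]
  rfl

theorem affineMatrix_mul (A B : Mat7) (c d : R7) :
    affineMatrix A c * affineMatrix B d = affineMatrix (A * B) (act A d + c) := by
  rw [affineMatrix, affineMatrix, Matrix.fromBlocks_multiply, mul_replicateCol]
  simp only [Matrix.mul_zero, Matrix.zero_mul, Matrix.mul_one, add_zero, zero_add]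
  rfl

theorem affineMatrix_one : affineMatrix 1 0 = 1 := by
  have : Matrix.replicateCol Unit (0 : R7).ofLp = 0 := by ext i j; simp
  rw [affineMatrix, this, Matrix.fromBlocks_one]

theorem affineLie_inj {A B : Mat7} {c d : R7} : affineLie A c = affineLie B d ↔ A = B ∧ c = d := by
  rw [affineLie, affineLie, Matrix.fromBlocks_inj]
  refine ⟨fun h => ⟨h.1, ?_⟩, fun h => ?_⟩
  · ext i
    exact congrFun (congrFun h.2.1 i) ()
  · simp [h.1, h.2]

theorem affineMatrix_inj {A B : Mat7} {c d : R7} :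
    affineMatrix A c = affineMatrix B d ↔ A = B ∧ c = d := by
  rw [affineMatrix, affineMatrix, Matrix.fromBlocks_inj]
  refine ⟨fun h => ⟨h.1, ?_⟩, fun h => ?_⟩
  · ext i
    exact congrFun (congrFun h.2.1 i) ()
  · simp [h.1, h.2]

theorem affineLie_add (A B : Mat7) (c d : R7) :
    affineLie A c + affineLie B d = affineLie (A + B) (c + d) := by
  ext (i | i) (j | j) <;> simp [affineLie]

theorem affineLie_sub (A B : Mat7) (c d : R7) :
    affineLie A c - affineLie B d = affineLie (A - B) (c - d) := by
  ext (i | i) (j | j) <;> simp [affineLie]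

theorem affineLie_neg (A : Mat7) (c : R7) : -affineLie A c = affineLie (-A) (-c) := by
  ext (i | i) (j | j) <;> simp [affineLie]

theorem affineLie_smul (r : ℝ) (A : Mat7) (c : R7) :
    r • affineLie A c = affineLie (r • A) (r • c) := by
  ext (i | i) (j | j) <;> simp [affineLie]

theorem affineLie_lie (A B : Mat7) (c d : R7) :
    ⁅affineLie A c, affineLie B d⁆ = affineLie ⁅A, B⁆ (act A d - act B c) := by
  rw [Ring.lie_def, affineLie_mul, affineLie_mul, affineLie_sub, Ring.lie_def]

theorem b_eq_affineLie (i : Fin 2) : b i = affineLie (b7 i) 0 := by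
  have : Matrix.replicateCol Unit (0 : R7).ofLp = 0 := by ext i j; simp
  rw [affineLie, this]
  rfl

theorem S8_eq_affineMatrix : S8 = affineMatrix S7 0 := by
  have : Matrix.replicateCol Unit (0 : R7).ofLp = 0 := by ext i j; simp
  rw [affineMatrix, this]
  rfl

theorem act_zero_right (A : Mat7) : act A 0 = 0 := (Matrix.toEuclideanLin A).map_zero

theorem S8_mul_affineLie (A : Mat7) (c : R7) : S8 * affineLie A c = affineLie (S7 * A) (act S7 c) := by
  rw [S8_eq_affineMatrix, affineMatrix_mul_affineLie]

theorem affineLie_mul_S8 (A : Mat7) (c : R7) : affineLie A c * S8 = affineLie (A * S7) c := by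
  rw [S8_eq_affineMatrix, affineLie_mul_affineMatrix, act_zero_right, zero_add]

/-- As `S` has last diagonal entry 1, the translation part transforms by `S7` alone. Hence `p̂` is 𝔭
together with the translations in ℝ⁴. -/
theorem mem_pHat_iff {ξ : Mat8 ℝ} : ξ ∈ pHat ↔
    ∃ A c, A ∈ g2 ∧ S7 * A = -(A * S7) ∧ act S7 c = -c ∧ ξ = affineLie A c := by
  constructor
  · rintro ⟨⟨A, hA, c, rfl⟩, h⟩
    change S8 * affineLie A c * S8 = -affineLie A c at h
    rw [S8_mul_affineLie, affineLie_mul_S8, affineLie_neg, affineLie_inj] at h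
    refine ⟨A, c, hA, ?_, h.2, rfl⟩
    rw [← Matrix.neg_mul, ← h.1, mul_assoc, S7_mul_S7, mul_one]
  · rintro ⟨A, c, hA, h1, h2, rfl⟩
    refine ⟨⟨A, hA, c, rfl⟩, ?_⟩
    rw [S8_mul_affineLie, affineLie_mul_S8, affineLie_neg, affineLie_inj]
    refine ⟨?_, h2⟩
    rw [h1, Matrix.neg_mul, mul_assoc, S7_mul_S7, mul_one]

theorem contDiff_affineLie {A : R2 → Mat7} {c : R2 → R7} (hA : ContDiff ℝ ∞ A)
    (hc : ContDiff ℝ ∞ c) : ContDiff ℝ ∞ fun p => affineLie (A p) (c p) := by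
  rw [contDiff_matrix_iff] at *
  rw [contDiff_euclidean] at hc
  rintro (i | i) (j | j) <;> simp only [affineLie, Matrix.fromBlocks_apply₁₁,
    Matrix.fromBlocks_apply₁₂, Matrix.fromBlocks_apply₂₁, Matrix.fromBlocks_apply₂₂]
  · exact hA i j
  · exact hc i
  · exact contDiff_const
  · exact contDiff_const

theorem affineMatrix_eq (A : Mat7) (c : R7) :
    affineMatrix A c = affineLie A c + Matrix.fromBlocks 0 0 0 1 := by
  ext (i | i) (j | j) <;> simp [affineLie, affineMatrix]

/-- `affineLie` as a linear map. -/
def affineLieₗ : Mat7 × R7 →ₗ[ℝ] Mat8 ℝ where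
  toFun p := affineLie p.1 p.2
  map_add' _ _ := (affineLie_add _ _ _ _).symm
  map_smul' _ _ := (affineLie_smul _ _ _).symm

/-- `affineLie` as a continuous linear map. -/
def affineLieL : Mat7 × R7 →L[ℝ] Mat8 ℝ := LinearMap.toContinuousLinearMap affineLieₗ

theorem pd_prodMk {E F : Type*} [NormedAddCommGroup E] [NormedSpace ℝ E] [NormedAddCommGroup F]
    [NormedSpace ℝ F] {f : R2 → E} {g : R2 → F} (hf : Differentiable ℝ f)
    (hg : Differentiable ℝ g) (i : Fin 2) (m : R2) :
    pd i (fun p => (f p, g p)) m = (pd i f m, pd i g m) := by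
  rw [pd, (hf m).fderiv_prodMk (hg m)]
  rfl

theorem pd_affineLie {A : R2 → Mat7} {c : R2 → R7} (hA : Differentiable ℝ A)
    (hc : Differentiable ℝ c) (i : Fin 2) (m : R2) :
    pd i (fun p => affineLie (A p) (c p)) m = affineLie (pd i A m) (pd i c m) := by
  have h : Differentiable ℝ fun p => (A p, c p) := hA.prodMk hc
  refine (pd_clm affineLieL h i m).trans ?_
  exact congrArg affineLieL (pd_prodMk hA hc i m)

theorem contDiff_affineMatrix {A : R2 → Mat7} {c : R2 → R7} (hA : ContDiff ℝ ∞ A)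
    (hc : ContDiff ℝ ∞ c) : ContDiff ℝ ∞ fun p => affineMatrix (A p) (c p) := by
  simp only [affineMatrix_eq]
  exact contDiff_matrix_add (contDiff_affineLie hA hc) contDiff_const

theorem pd_affineMatrix {A : R2 → Mat7} {c : R2 → R7} (hA : ContDiff ℝ ∞ A)
    (hc : ContDiff ℝ ∞ c) (i : Fin 2) (m : R2) :
    pd i (fun p => affineMatrix (A p) (c p)) m = affineLie (pd i A m) (pd i c m) := by
  simp only [affineMatrix_eq]
  rw [pd_matrix_add (differentiable_infty (contDiff_affineLie hA hc)) (differentiable_const _),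
    pd_affineLie (differentiable_infty hA) (differentiable_infty hc), pd_matrix_const, add_zero]

end Affine

/-! ### The family of connections and its parity splitting -/

section Families

open Matrix

/-- The coefficients of the one-form `∑ⱼ bⱼ dxⱼ`. -/
def pForm (x : R2 → R2) (i : Fin 2) (m : R2) : Mat8 ℝ := ∑ j : Fin 2, pd i x m j • b j

/-- The coefficients of the one-form `∑ⱼ [bⱼ, v] dxⱼ`. -/
def kForm (x : R2 → R2) (v : R2 → Mat8 ℝ) (i : Fin 2) (m : R2) : Mat8 ℝ :=
  ∑ j : Fin 2, pd i x m j • ⁅b j, v m⁆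

/-- The linear map `(X, Y) ↦ lam X + Y`. -/
def complexCombination (lam : ℂ) : Mat8 ℝ × Mat8 ℝ →ₗ[ℝ] Mat8 ℂ where
  toFun p := lam • p.1.map (algebraMap ℝ ℂ) + p.2.map (algebraMap ℝ ℂ)
  map_add' p q := by ext i j; simp; ring
  map_smul' r p := by ext i j; simp; ring

theorem fderiv_apply_eq (x : R2 → R2) (m u : R2) (j : Fin 2) :
    fderiv ℝ x m u j = u 0 * pd 0 x m j + u 1 * pd 1 x m j := by
  rw [fderiv_eq_pd]; simp

theorem theta_complex (x : R2 → R2) (v : R2 → Mat8 ℝ) (lam : ℂ) (m u : R2) :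
    theta x v lam m u = u 0 • complexCombination lam (pForm x 0 m, kForm x v 0 m) +
      u 1 • complexCombination lam (pForm x 1 m, kForm x v 1 m) := by
  ext i j
  simp [theta, fderiv_apply_eq, complexCombination, pForm, kForm]
  ring

theorem theta_one (x : R2 → R2) (v : R2 → Mat8 ℝ) (m u : R2) :
    theta x v (1 : ℝ) m u = u 0 • (pForm x 0 m + kForm x v 0 m) +
      u 1 • (pForm x 1 m + kForm x v 1 m) := by
  ext i j
  simp [theta, fderiv_apply_eq, pForm, kForm]
  ring

theorem pForm_eq (x : R2 → R2) (i : Fin 2) (m : R2) :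
    pForm x i m = affineLie (∑ j, pd i x m j • b7 j) 0 := by
  simp only [pForm, Fin.sum_univ_two, b_eq_affineLie, affineLie_smul, affineLie_add, smul_zero,
    add_zero]

theorem kForm_eq (x : R2 → R2) {v : R2 → Mat8 ℝ} {A : Mat7} {c : R7} (i : Fin 2) {m : R2}
    (h : v m = affineLie A c) : kForm x v i m =
      affineLie (∑ j, pd i x m j • ⁅b7 j, A⁆) (∑ j, pd i x m j • act (b7 j) c) := by
  simp only [kForm, Fin.sum_univ_two, b_eq_affineLie, h, affineLie_lie, affineLie_smul,
    affineLie_add, act_zero_right, sub_zero]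

theorem contDiff_pd_apply {x : R2 → R2} (hx : ContDiff ℝ ∞ x) (i j : Fin 2) :
    ContDiff ℝ ∞ fun p => pd i x p j := contDiff_euclidean.1 (contDiff_pd hx i) j

theorem contDiff_pForm {x : R2 → R2} (hx : ContDiff ℝ ∞ x) (i : Fin 2) :
    ContDiff ℝ ∞ (pForm x i) := by
  unfold pForm
  simp only [Fin.sum_univ_two]
  exact contDiff_matrix_add (contDiff_matrix_smul (contDiff_pd_apply hx i 0) contDiff_const)
    (contDiff_matrix_smul (contDiff_pd_apply hx i 1) contDiff_const)

theorem contDiff_kForm {x : R2 → R2} {v : R2 → Mat8 ℝ} (hx : ContDiff ℝ ∞ x)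
    (hv : ContDiff ℝ ∞ v) (i : Fin 2) : ContDiff ℝ ∞ (kForm x v i) := by
  unfold kForm
  simp only [Fin.sum_univ_two]
  exact contDiff_matrix_add
    (contDiff_matrix_smul (contDiff_pd_apply hx i 0) (contDiff_matrix_lie contDiff_const hv))
    (contDiff_matrix_smul (contDiff_pd_apply hx i 1) (contDiff_matrix_lie contDiff_const hv))

theorem S8_mul_S8 : S8 * S8 = 1 := by
  rw [S8_eq_affineMatrix, affineMatrix_mul, S7_mul_S7, act_zero_right, add_zero, affineMatrix_one]

theorem S8_mul_b (i : Fin 2) : S8 * b i * S8 = -b i := by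
  rw [b_eq_affineLie, S8_mul_affineLie, affineLie_mul_S8, affineLie_neg, S7_mul_b7,
    act_zero_right, neg_zero, Matrix.neg_mul, mul_assoc, S7_mul_S7, mul_one]

theorem S8_mul_pForm (x : R2 → R2) (i : Fin 2) (m : R2) :
    S8 * pForm x i m * S8 = -pForm x i m := by
  simp only [pForm, Fin.sum_univ_two, Matrix.mul_add, Matrix.add_mul, Matrix.mul_smul,
    Matrix.smul_mul, S8_mul_b, smul_neg, neg_add]

theorem S8_conj_lie (X Y : Mat8 ℝ) : S8 * ⁅X, Y⁆ * S8 = ⁅S8 * X * S8, S8 * Y * S8⁆ := by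
  have h (X Y : Mat8 ℝ) : S8 * X * S8 * (S8 * Y * S8) = S8 * (X * Y) * S8 := by
    calc S8 * X * S8 * (S8 * Y * S8) = S8 * X * (S8 * S8) * Y * S8 := by noncomm_ring
      _ = _ := by rw [S8_mul_S8]; noncomm_ring
  rw [Ring.lie_def, Ring.lie_def, h, h]
  noncomm_ring

theorem neg_lie_neg' {n : Type*} [Fintype n] [DecidableEq n] (X Y : Matrix n n ℝ) :
    ⁅-X, -Y⁆ = ⁅X, Y⁆ := by
  simp [Ring.lie_def]

theorem S8_mul_kForm (x : R2 → R2) {v : R2 → Mat8 ℝ} (i : Fin 2) {m : R2} (hv : v m ∈ pHat) :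
    S8 * kForm x v i m * S8 = kForm x v i m := by
  simp only [kForm, Fin.sum_univ_two, Matrix.mul_add, Matrix.add_mul, Matrix.mul_smul,
    Matrix.smul_mul, S8_conj_lie, S8_mul_b, hv.2, neg_lie_neg']

/-- An equation between elements of the Lie algebra splits into its even and its odd part. -/
theorem eq_zero_of_add_eq_zero {X Y : Mat8 ℝ} (hX : S8 * X * S8 = -X) (hY : S8 * Y * S8 = Y)
    (h : X + Y = 0) : X = 0 ∧ Y = 0 := by
  have h1 : S8 * (X + Y) * S8 = -X + Y := by rw [Matrix.mul_add, Matrix.add_mul, hX, hY]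
  rw [h, Matrix.mul_zero, Matrix.zero_mul] at h1
  have h2 : Y = X := by rw [← sub_eq_zero, sub_eq_neg_add, ← h1]
  rw [h2, ← two_smul ℝ, smul_eq_zero] at h
  have h3 := h.resolve_left two_ne_zero
  exact ⟨h3, h2.trans h3⟩

theorem b_lie_b (i j : Fin 2) : ⁅b i, b j⁆ = 0 := by
  rw [b_eq_affineLie, b_eq_affineLie, affineLie_lie, b7_eq_pMat j, lie_b7_pMat, act_zero_right,
    act_zero_right, mul_zero, sub_zero]
  rw [kMat_zero, ← zero_smul ℝ (0 : Mat7), ← zero_smul ℝ (0 : R7), ← affineLie_smul, zero_smul]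

theorem pForm_lie (x : R2 → R2) (m : R2) : ⁅pForm x 0 m, pForm x 1 m⁆ = 0 := by
  have h := b_lie_b 0 1
  rw [Ring.lie_def, sub_eq_zero] at h
  simp only [pForm, Fin.sum_univ_two, Ring.lie_def, Matrix.mul_add, Matrix.add_mul, Matrix.mul_smul,
    Matrix.smul_mul, h]
  module

theorem pd_pForm {x : R2 → R2} (hx : ContDiff ℝ ∞ x) (i j : Fin 2) (m : R2) :
    pd i (pForm x j) m = ∑ k : Fin 2, pd i (pd j x) m k • b k := by
  have hd (k : Fin 2) : Differentiable ℝ fun p => pd j x p k :=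
    differentiable_infty (contDiff_pd_apply hx j k)
  have h1 (k : Fin 2) : Differentiable ℝ fun p => pd j x p k • b k :=
    differentiable_infty (contDiff_matrix_smul (contDiff_pd_apply hx j k) contDiff_const)
  have h2 (k : Fin 2) : pd i (fun p => pd j x p k) m = pd i (pd j x) m k :=
    pd_clm (EuclideanSpace.proj k : R2 →L[ℝ] ℝ) (differentiable_infty (contDiff_pd hx j)) i m
  have : pForm x j = fun p => pd j x p 0 • b 0 + pd j x p 1 • b 1 := by
    funext p; rw [pForm, Fin.sum_univ_two]
  rw [this, pd_matrix_add (h1 0) (h1 1), pd_matrix_smul (hd 0) (differentiable_const _),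
    pd_matrix_smul (hd 1) (differentiable_const _), pd_matrix_const, pd_matrix_const, h2, h2,
    Fin.sum_univ_two]
  simp

/-- The form `∑ bⱼ dxⱼ` is exact. -/
theorem closed_pForm {x : R2 → R2} (hx : ContDiff ℝ ∞ x) (m : R2) :
    pd 0 (pForm x 1) m = pd 1 (pForm x 0) m := by
  rw [pd_pForm hx, pd_pForm hx, pd_comm hx]

theorem map_mul_ofReal (X Y : Mat8 ℝ) : X.map (algebraMap ℝ ℂ) * Y.map (algebraMap ℝ ℂ) =
    (X * Y).map (algebraMap ℝ ℂ) := (Matrix.map_mul (f := algebraMap ℝ ℂ)).symm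

theorem map_injective_ofReal {X Y : Mat8 ℝ} (h : X.map (algebraMap ℝ ℂ) = Y.map (algebraMap ℝ ℂ)) :
    X = Y := Matrix.map_injective (algebraMap ℝ ℂ).injective h

theorem complexCombination_one (X Y : Mat8 ℝ) :
    complexCombination 1 (X, Y) = (X + Y).map (algebraMap ℝ ℂ) := by
  ext i j; simp [complexCombination]

/-- The expansion in powers of the parameter which shows the coefficients that flatness for all
`lam` forces to vanish. -/
theorem complexCombination_lie (lam : ℂ) (X Y Z W : Mat8 ℝ) :
    ⁅complexCombination lam (X, Y), complexCombination lam (Z, W)⁆ =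
      lam ^ 2 • (⁅X, Z⁆).map (algebraMap ℝ ℂ) + lam • (⁅X, W⁆ + ⁅Y, Z⁆).map (algebraMap ℝ ℂ) +
        (⁅Y, W⁆).map (algebraMap ℝ ℂ) := by
  have hs (X Y : Mat8 ℝ) : (X - Y).map (algebraMap ℝ ℂ) =
      X.map (algebraMap ℝ ℂ) - Y.map (algebraMap ℝ ℂ) := by ext i j; simp
  have ha (X Y : Mat8 ℝ) : (X + Y).map (algebraMap ℝ ℂ) =
      X.map (algebraMap ℝ ℂ) + Y.map (algebraMap ℝ ℂ) := by ext i j; simp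
  simp only [complexCombination, LinearMap.coe_mk, AddHom.coe_mk, Ring.lie_def, hs, ha,
    ← map_mul_ofReal, Matrix.mul_add, Matrix.add_mul, Matrix.smul_mul, Matrix.mul_smul]
  module

/-- The coefficients of the connection one-forms, before the parameter is put in. -/
def formPair (x : R2 → R2) (v : R2 → Mat8 ℝ) (i : Fin 2) (m : R2) : Mat8 ℝ × Mat8 ℝ :=
  (pForm x i m, kForm x v i m)

theorem contDiff_formPair {x : R2 → R2} {v : R2 → Mat8 ℝ} (hx : ContDiff ℝ ∞ x)
    (hv : ContDiff ℝ ∞ v) (i : Fin 2) : ContDiff ℝ ∞ (formPair x v i) :=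
  (contDiff_pForm hx i).prodMk (contDiff_kForm hx hv i)

theorem pd_formPair {x : R2 → R2} {v : R2 → Mat8 ℝ} (hx : ContDiff ℝ ∞ x)
    (hv : ContDiff ℝ ∞ v) (i j : Fin 2) (m : R2) :
    pd i (formPair x v j) m = (pd i (pForm x j) m, pd i (kForm x v j) m) :=
  pd_prodMk (differentiable_infty (contDiff_pForm hx j))
    (differentiable_infty (contDiff_kForm hx hv j)) i m

theorem fderiv_theta {x : R2 → R2} {v : R2 → Mat8 ℝ} (hx : ContDiff ℝ ∞ x)
    (hv : ContDiff ℝ ∞ v) (lam : ℂ) (m u w : R2) :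
    fderiv ℝ (fun p => theta x v lam p w) m u = complexCombination lam
      (w 0 • (u 0 • pd 0 (formPair x v 0) m + u 1 • pd 1 (formPair x v 0) m) +
        w 1 • (u 0 • pd 0 (formPair x v 1) m + u 1 • pd 1 (formPair x v 1) m)) := by
  have hd (i : Fin 2) : Differentiable ℝ (formPair x v i) :=
    differentiable_infty (contDiff_formPair hx hv i)
  have h1 : (fun p => theta x v lam p w) = fun p => LinearMap.toContinuousLinearMap
      (complexCombination lam) (w 0 • formPair x v 0 p + w 1 • formPair x v 1 p) := by
    funext p
    rw [theta_complex, ← map_smul, ← map_smul, ← map_add]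
    rfl
  have hs (i : Fin 2) : Differentiable ℝ fun p => w i • formPair x v i p := (hd i).fun_const_smul _
  have hp (i j : Fin 2) : pd i (fun p => w j • formPair x v j p) m = w j • pd i (formPair x v j) m := by
    rw [pd_smul (differentiable_const _) (hd j), pd_const, zero_smul, zero_add]
  rw [h1]
  refine (fderiv_clm _ ((hs 0).add (hs 1)) m u).trans ?_
  refine congrArg (complexCombination lam) ?_
  refine (fderiv_eq_pd (fun p => w 0 • formPair x v 0 p + w 1 • formPair x v 1 p) m u).trans ?_
  rw [pd_add (hs 0) (hs 1), pd_add (hs 0) (hs 1), hp, hp, hp, hp]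
  module

/-- A two-form on the plane is `u₀w₁ - u₁w₀` times its value on the coordinate fields. -/
theorem isFlatConnection_theta {x : R2 → R2} {v : R2 → Mat8 ℝ} (hx : ContDiff ℝ ∞ x)
    (hv : ContDiff ℝ ∞ v) (lam : ℂ) : IsFlatConnection (theta x v lam) ↔
      ∀ m, complexCombination lam (pd 0 (formPair x v 1) m - pd 1 (formPair x v 0) m) +
        ⁅complexCombination lam (formPair x v 0 m), complexCombination lam (formPair x v 1 m)⁆ = 0 := by
  have key (m u w : R2) : fderiv ℝ (fun p => theta x v lam p w) m u -
      fderiv ℝ (fun p => theta x v lam p u) m w + ⁅theta x v lam m u, theta x v lam m w⁆ =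
      (u 0 * w 1 - u 1 * w 0) •
        (complexCombination lam (pd 0 (formPair x v 1) m - pd 1 (formPair x v 0) m) +
        ⁅complexCombination lam (formPair x v 0 m), complexCombination lam (formPair x v 1 m)⁆) := by
    have ht (u : R2) : theta x v lam m u = u 0 • complexCombination lam (formPair x v 0 m) +
        u 1 • complexCombination lam (formPair x v 1 m) := theta_complex x v lam m u
    rw [fderiv_theta hx hv, fderiv_theta hx hv, ht, ht]
    simp only [Ring.lie_def, Matrix.mul_add, Matrix.add_mul, Matrix.smul_mul, Matrix.mul_smul,
      map_sub, map_add, map_smul]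
    module
  constructor
  · intro h m
    have := h m (E2 0) (E2 1)
    rw [key] at this
    simpa using this
  · intro h m u w
    rw [key, h, smul_zero]

/-- The flatness of the family is equivalent to the flatness of its real member `θ₁`. -/
theorem flat_family_iff {x : R2 → R2} {v : R2 → Mat8 ℝ} (hx : ContDiff ℝ ∞ x)
    (hv : ContDiff ℝ ∞ v) (hp : ∀ m, v m ∈ pHat) :
    (∀ lam : ℂ, IsFlatConnection (theta x v lam)) ↔
      IsFlatPair fun i m => pForm x i m + kForm x v i m := by
  have hpd (i : Fin 2) := differentiable_infty (contDiff_pForm hx i)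
  have hkd (i : Fin 2) := differentiable_infty (contDiff_kForm hx hv i)
  constructor
  · intro h m
    have h1 := (isFlatConnection_theta hx hv 1).1 (h 1) m
    rw [pd_formPair hx hv, pd_formPair hx hv, Prod.mk_sub_mk, formPair, formPair,
      complexCombination_one, complexCombination_one, complexCombination_one, Ring.lie_def,
      map_mul_ofReal, map_mul_ofReal] at h1
    rw [pd_matrix_add (hpd 1) (hkd 1), pd_matrix_add (hpd 0) (hkd 0)]
    apply map_injective_ofReal
    rw [Matrix.map_zero _ (map_zero _), ← h1, Ring.lie_def]
    ext i j
    simp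
    ring
  · intro h
    -- The terms `d(∑ bⱼ dxⱼ)` and `[b, b]` vanish identically. In what remains the mixed brackets
    -- are odd under `S8` and the curvature of the even part is even, so both vanish separately.
    have hsplit (m : R2) : ⁅pForm x 0 m, kForm x v 1 m⁆ + ⁅kForm x v 0 m, pForm x 1 m⁆ = 0 ∧
        pd 0 (kForm x v 1) m - pd 1 (kForm x v 0) m + ⁅kForm x v 0 m, kForm x v 1 m⁆ = 0 := by
      have hk (i j : Fin 2) : S8 * pd i (kForm x v j) m * S8 = pd i (kForm x v j) m := by
        rw [← pd_const_mul _ (hkd j), ← pd_mul_const (differentiable_matrix_mul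
          (differentiable_const _) (hkd j))]
        congr 1
        funext p
        exact S8_mul_kForm x j (hp p)
      refine eq_zero_of_add_eq_zero ?_ ?_ ?_
      · rw [Matrix.mul_add, Matrix.add_mul, S8_conj_lie, S8_conj_lie, S8_mul_pForm, S8_mul_pForm,
          S8_mul_kForm x _ (hp m), S8_mul_kForm x _ (hp m)]
        simp only [Ring.lie_def]
        noncomm_ring
      · rw [Matrix.mul_add, Matrix.add_mul, Matrix.mul_sub, Matrix.sub_mul, S8_conj_lie, hk, hk,
          S8_mul_kForm x _ (hp m), S8_mul_kForm x _ (hp m)]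
      · have h1 := h m
        rw [pd_matrix_add (hpd 1) (hkd 1), pd_matrix_add (hpd 0) (hkd 0), closed_pForm hx] at h1
        have h2 := pForm_lie x m
        rw [Ring.lie_def] at h2
        refine Eq.trans ?_ h1
        rw [← sub_eq_zero, ← neg_eq_zero.2 h2]
        simp only [Ring.lie_def]
        noncomm_ring
    intro lam
    rw [isFlatConnection_theta hx hv]
    intro m
    obtain ⟨h1, h2⟩ := hsplit m
    -- The coefficients of `lam²`, `lam` and `1` are now each zero.
    rw [pd_formPair hx hv, pd_formPair hx hv, Prod.mk_sub_mk, formPair, formPair,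
      complexCombination_lie, pForm_lie, h1, closed_pForm hx, sub_self]
    have h3 : ⁅kForm x v 0 m, kForm x v 1 m⁆ =
      -(pd 0 (kForm x v 1) m - pd 1 (kForm x v 0) m) := eq_neg_of_add_eq_zero_right h2
    rw [h3]
    ext i j
    simp [complexCombination]

theorem S8_conj_mul_left {k : Mat7} (hk : S7 * k = k * S7) (X : Mat8 ℝ) :
    S8 * (affineMatrix k 0 * X) * S8 = affineMatrix k 0 * (S8 * X * S8) := by
  have h : S8 * affineMatrix k 0 = affineMatrix k 0 * S8 := by
    rw [S8_eq_affineMatrix, affineMatrix_mul, affineMatrix_mul, hk, act_zero_right, act_zero_right]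
  calc S8 * (affineMatrix k 0 * X) * S8 = S8 * affineMatrix k 0 * X * S8 := by noncomm_ring
    _ = _ := by rw [h]; noncomm_ring

theorem S8_conj_mul_right {k : Mat7} (hk : S7 * k = k * S7) (X : Mat8 ℝ) :
    S8 * (X * affineMatrix k 0) * S8 = S8 * X * S8 * affineMatrix k 0 := by
  have h : S8 * affineMatrix k 0 = affineMatrix k 0 * S8 := by
    rw [S8_eq_affineMatrix, affineMatrix_mul, affineMatrix_mul, hk, act_zero_right, act_zero_right]
  calc S8 * (X * affineMatrix k 0) * S8 = S8 * X * (affineMatrix k 0 * S8) := by noncomm_ring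
    _ = _ := by rw [← h]; noncomm_ring

/-- Conjugation by `k ∈ K` preserves parity, so the identity at `lam = 1` splits into its odd and
even parts and holds for every `lam`. -/
theorem conjugateFamilies_iff {x x' : R2 → R2} {v v' : R2 → Mat8 ℝ} (hv : ∀ m, v m ∈ pHat)
    (hv' : ∀ m, v' m ∈ pHat) : ConjugateFamilies x v x' v' ↔ ∃ k ∈ K, ∀ i m,
      affineMatrix k 0 * (pForm x' i m + kForm x' v' i m) =
        (pForm x i m + kForm x v i m) * affineMatrix k 0 := by
  refine exists_congr fun k => and_congr_right fun hk => ?_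
  constructor
  · intro h i m
    have h1 := h 1 m (E2 i)
    have ht (x : R2 → R2) (v : R2 → Mat8 ℝ) : theta x v (1 : ℂ) m (E2 i) =
        (pForm x i m + kForm x v i m).map (algebraMap ℝ ℂ) := by
      rw [theta_complex, complexCombination_one, complexCombination_one]
      fin_cases i <;> simp
    rw [ht, ht, map_mul_ofReal, map_mul_ofReal] at h1
    exact map_injective_ofReal h1
  · intro h lam m u
    have hsplit (i : Fin 2) : affineMatrix k 0 * pForm x' i m = pForm x i m * affineMatrix k 0 ∧
        affineMatrix k 0 * kForm x' v' i m = kForm x v i m * affineMatrix k 0 := by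
      rw [← sub_eq_zero, ← sub_eq_zero (b := kForm x v i m * _)]
      refine eq_zero_of_add_eq_zero ?_ ?_ ?_
      · rw [Matrix.mul_sub, Matrix.sub_mul, S8_conj_mul_left hk.2, S8_conj_mul_right hk.2,
          S8_mul_pForm, S8_mul_pForm]
        noncomm_ring
      · rw [Matrix.mul_sub, Matrix.sub_mul, S8_conj_mul_left hk.2, S8_conj_mul_right hk.2,
          S8_mul_kForm _ _ (hv m), S8_mul_kForm _ _ (hv' m)]
      · rw [← sub_eq_zero.2 (h i m)]
        noncomm_ring
    have hc (i : Fin 2) : (affineMatrix k 0).map (algebraMap ℝ ℂ) *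
        complexCombination lam (pForm x' i m, kForm x' v' i m) =
        complexCombination lam (pForm x i m, kForm x v i m) *
          (affineMatrix k 0).map (algebraMap ℝ ℂ) := by
      simp only [complexCombination, LinearMap.coe_mk, AddHom.coe_mk, Matrix.mul_add,
        Matrix.add_mul, Matrix.smul_mul, Matrix.mul_smul, map_mul_ofReal, (hsplit i).1,
        (hsplit i).2]
    rw [theta_complex, theta_complex, Matrix.mul_add, Matrix.add_mul, Matrix.mul_smul,
      Matrix.mul_smul, Matrix.smul_mul, Matrix.smul_mul, hc, hc]

end Families

/-! ### From solutions of the system to surfaces -/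

section Integration

open Matrix

/-- The `𝔭`-part of the linear part of `θ₁`. -/
def oddPart (x : R2 → R2) (i : Fin 2) (m : R2) : Mat7 := ∑ j, pd i x m j • b7 j

/-- The `𝔰𝔬(4)`-part of the linear part of `θ₁`, where `A` is the linear part of `v`. -/
def evenPart (x : R2 → R2) (A : R2 → Mat7) (i : Fin 2) (m : R2) : Mat7 :=
  ∑ j, pd i x m j • ⁅b7 j, A m⁆

/-- The translation part of `θ₁`, where `c` is the translation part of `v`. -/
def translationPart (x : R2 → R2) (c : R2 → R7) (i : Fin 2) (m : R2) : R7 :=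
  ∑ j, pd i x m j • act (b7 j) (c m)

theorem form_eq_affineLie (x : R2 → R2) {v : R2 → Mat8 ℝ} {A : R2 → Mat7} {c : R2 → R7}
    (i : Fin 2) {m : R2} (h : v m = affineLie (A m) (c m)) :
    pForm x i m + kForm x v i m =
      affineLie (oddPart x i m + evenPart x A i m) (translationPart x c i m) := by
  rw [pForm_eq, kForm_eq x i h, affineLie_add, zero_add]
  rfl

theorem oddPart_mem_g2 (x : R2 → R2) (i : Fin 2) (m : R2) : oddPart x i m ∈ g2 := by
  rw [oddPart, Fin.sum_univ_two]
  exact add_mem_g2 (smul_mem_g2 _ (b7_mem_g2 _)) (smul_mem_g2 _ (b7_mem_g2 _))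

theorem S7_mul_oddPart (x : R2 → R2) (i : Fin 2) (m : R2) :
    S7 * oddPart x i m = -(oddPart x i m * S7) := by
  simp only [oddPart, Fin.sum_univ_two, Matrix.mul_add, Matrix.add_mul, Matrix.mul_smul,
    Matrix.smul_mul, S7_mul_b7, smul_neg, neg_add]

theorem evenPart_mem_g2 (x : R2 → R2) {A : R2 → Mat7} (i : Fin 2) {m : R2} (hA : A m ∈ g2) :
    evenPart x A i m ∈ g2 := by
  rw [evenPart, Fin.sum_univ_two]
  exact add_mem_g2 (smul_mem_g2 _ (lie_mem_g2 (b7_mem_g2 _) hA))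
    (smul_mem_g2 _ (lie_mem_g2 (b7_mem_g2 _) hA))

theorem S7_mul_evenPart (x : R2 → R2) {A : R2 → Mat7} (i : Fin 2) {m : R2}
    (hA : S7 * A m = -(A m * S7)) : S7 * evenPart x A i m = evenPart x A i m * S7 := by
  simp only [evenPart, Fin.sum_univ_two, Matrix.mul_add, Matrix.add_mul, Matrix.mul_smul,
    Matrix.smul_mul, S7_mul_lie_of_odd (S7_mul_b7 _) hA]

theorem act_S7_translationPart (x : R2 → R2) {c : R2 → R7} (i : Fin 2) {m : R2}
    (hc : act S7 (c m) = -c m) : act S7 (translationPart x c i m) = translationPart x c i m := by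
  have h (j : Fin 2) : act S7 (act (b7 j) (c m)) = act (b7 j) (c m) := by
    rw [← act_mul, S7_mul_b7, act_neg, act_mul, hc, act_map_neg, neg_neg]
  simp only [translationPart, Fin.sum_univ_two, act_map_add, act_map_smul, h]

theorem b7_lie_b7 (i j : Fin 2) : ⁅b7 i, b7 j⁆ = 0 := by
  rw [b7_eq_pMat j, lie_b7_pMat, mul_zero, kMat_zero]

theorem lie_oddPart (x : R2 → R2) (m : R2) : ⁅oddPart x 0 m, oddPart x 1 m⁆ = 0 := by
  have h := b7_lie_b7 0 1
  rw [Ring.lie_def, sub_eq_zero] at h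
  simp only [oddPart, Fin.sum_univ_two, Ring.lie_def, Matrix.mul_add, Matrix.add_mul,
    Matrix.mul_smul, Matrix.smul_mul, h]
  module

theorem eq_zero_of_sum_b7 {r s : ℝ} (h : r • b7 0 + s • b7 1 = 0) : r = 0 ∧ s = 0 := by
  have h1 := congrFun (congrFun h 4) 0
  have h2 := congrFun (congrFun h 5) 3
  simp [b7_eq_pMat, pMat] at h1 h2
  exact ⟨h1, h2⟩

theorem oddPart_independent {x : R2 → R2} {m : R2} (hx : Function.Bijective (fderiv ℝ x m))
    (u : R2) (hu : u 0 • oddPart x 0 m + u 1 • oddPart x 1 m = 0) : u = 0 := by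
  have h : fderiv ℝ x m u 0 • b7 0 + fderiv ℝ x m u 1 • b7 1 = 0 := by
    rw [← hu, fderiv_apply_eq, fderiv_apply_eq, oddPart, oddPart, Fin.sum_univ_two,
      Fin.sum_univ_two]
    module
  obtain ⟨h0, h1⟩ := eq_zero_of_sum_b7 h
  refine hx.1 ?_
  rw [map_zero]
  ext i
  fin_cases i
  · exact h0
  · exact h1

theorem exists_affineLie {v : R2 → Mat8 ℝ} (hv : ∀ m, v m ∈ pHat) :
    ∃ (A : R2 → Mat7) (c : R2 → R7), (∀ m, A m ∈ g2) ∧ (∀ m, S7 * A m = -(A m * S7)) ∧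
      (∀ m, act S7 (c m) = -c m) ∧ ∀ m, v m = affineLie (A m) (c m) := by
  choose A c h1 h2 h3 h4 using fun m => mem_pHat_iff.1 (hv m)
  exact ⟨A, c, h1, h2, h3, h4⟩

theorem theta_one_eq (x : R2 → R2) {v : R2 → Mat8 ℝ} {A : R2 → Mat7} {c : R2 → R7} {m : R2}
    (h : v m = affineLie (A m) (c m)) (u : R2) : theta x v (1 : ℝ) m u =
      u 0 • affineLie (oddPart x 0 m + evenPart x A 0 m) (translationPart x c 0 m) +
      u 1 • affineLie (oddPart x 1 m + evenPart x A 1 m) (translationPart x c 1 m) := by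
  rw [theta_one, form_eq_affineLie x 0 h, form_eq_affineLie x 1 h]

/-- The frame equations, written out in partial derivatives. -/
theorem integrates_iff {F : R2 → Mat7} {φ : R2 → R7} {x : R2 → R2} {v : R2 → Mat8 ℝ}
    {A : R2 → Mat7} {c : R2 → R7} (hv : ∀ m, v m = affineLie (A m) (c m)) :
    Integrates F φ x v ↔ ContDiff ℝ ∞ F ∧ ContDiff ℝ ∞ φ ∧ (∀ m, F m ∈ G2) ∧
      (∀ i m, pd i F m = F m * (oddPart x i m + evenPart x A i m)) ∧
      ∀ i m, pd i φ m = act (F m) (translationPart x c i m) := by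
  constructor
  · intro h
    have key (i : Fin 2) (m : R2) : affineLie (pd i F m) (pd i φ m) = affineLie
        (F m * (oddPart x i m + evenPart x A i m)) (act (F m) (translationPart x c i m)) := by
      rw [← pd_affineMatrix h.smooth_F h.smooth_φ, ← affineMatrix_mul_affineLie _ _ (φ m)]
      refine (h.eqn m (E2 i)).trans ?_
      rw [theta_one_eq x (hv m)]
      fin_cases i <;> simp
    exact ⟨h.smooth_F, h.smooth_φ, h.mem_G2, fun i m => (affineLie_inj.1 (key i m)).1,
      fun i m => (affineLie_inj.1 (key i m)).2⟩
  · rintro ⟨h1, h2, h3, h4, h5⟩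
    refine ⟨h1, h2, h3, fun m u => ?_⟩
    rw [fderiv_matrix_eq_pd, pd_affineMatrix h1 h2, pd_affineMatrix h1 h2, h4, h4, h5, h5,
      theta_one_eq x (hv m), Matrix.mul_add (affineMatrix _ _), Matrix.mul_smul, Matrix.mul_smul,
      affineMatrix_mul_affineLie, affineMatrix_mul_affineLie]

/-- Frobenius gives only a matrix solution; that it is an affine matrix with linear part in `G₂` is
preserved from the value at the origin. -/
theorem IsAffineSystem.exists_integrates {x : R2 → R2} {v : R2 → Mat8 ℝ}
    (h : IsAffineSystem x v) : ∃ (F : R2 → Mat7) (φ : R2 → R7), Integrates F φ x v := by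
  obtain ⟨A, c, hA, hA', -, hv⟩ := exists_affineLie h.mem_pHat
  have hθ (i : Fin 2) : ContDiff ℝ ∞ fun m => pForm x i m + kForm x v i m :=
    contDiff_matrix_add (contDiff_pForm h.smooth_x i) (contDiff_kForm h.smooth_x h.smooth_v i)
  obtain ⟨Φ, hΦ, hΦ0, hΦ'⟩ := exists_frame_of_isFlatPair (A := fun i m => pForm x i m + kForm x v i m)
    hθ ((flat_family_iff h.smooth_x h.smooth_v h.mem_pHat).1 h.flat) 1
  have hΦd := differentiable_infty hΦ
  have hΦ'' (i : Fin 2) (m : R2) : pd i Φ m = Φ m *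
      affineLie (oddPart x i m + evenPart x A i m) (translationPart x c i m) := by
    rw [hΦ', form_eq_affineLie x i (hv m)]
  -- Multiplication by `R` extracts the last row. The coefficients of `θ₁` have zero last row, so
  -- `RΦ - R` solves the frame equation with initial value zero.
  let R : Mat8 ℝ := Matrix.fromBlocks 0 0 0 1
  have hR (B : Mat7) (d : R7) : R * affineLie B d = 0 := by
    simp [R, affineLie, Matrix.fromBlocks_multiply]
  have hRd : Differentiable ℝ fun p => R * Φ p :=
    differentiable_matrix_mul (differentiable_const R) hΦd
  have hrow (m : R2) : R * Φ m = R := by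
    rw [← sub_eq_zero]
    refine eq_zero_of_frame (Φ := fun p => R * Φ p - R) (fun i => (hθ i).continuous)
      (hRd.sub (differentiable_const R)) (fun i m => ?_) ?_ m
    · rw [pd_matrix_sub hRd (differentiable_const R), pd_matrix_const, pd_const_mul R hΦd, hΦ'',
        form_eq_affineLie x i (hv m), Matrix.sub_mul, hR, mul_assoc]
    · simp only [hΦ0, mul_one, sub_self]
  let F : R2 → Mat7 := fun m => (Φ m).toBlocks₁₁
  let φ : R2 → R7 := fun m => WithLp.toLp 2 fun j => Φ m (Sum.inl j) (Sum.inr ())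
  have hΦe : Φ = fun m => affineMatrix (F m) (φ m) := by
    funext m
    have hr (j : Fin 7 ⊕ Unit) := congrFun (congrFun (hrow m) (Sum.inr ())) j
    simp only [R, Matrix.mul_apply, Fintype.sum_sum_type] at hr
    ext (i | i) (j | j)
    · rfl
    · rfl
    · simpa [affineMatrix] using hr (Sum.inl j)
    · simpa [affineMatrix] using hr (Sum.inr j)
  have hΦs := contDiff_matrix_iff.1 hΦ
  have hF : ContDiff ℝ ∞ F := contDiff_matrix_iff.2 fun i j => hΦs _ _
  have hφ : ContDiff ℝ ∞ φ := contDiff_euclidean.2 fun i => hΦs _ _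
  have key (i : Fin 2) (m : R2) : affineLie (pd i F m) (pd i φ m) = affineLie
      (F m * (oddPart x i m + evenPart x A i m)) (act (F m) (translationPart x c i m)) := by
    rw [← pd_affineMatrix hF hφ, ← affineMatrix_mul_affineLie _ _ (φ m), ← hΦe, hΦ'']
    rw [hΦe]
  have hF' (i : Fin 2) (m : R2) := (affineLie_inj.1 (key i m)).1
  refine ⟨F, φ, (integrates_iff hv).2 ⟨hF, hφ, ?_, hF', fun i m => (affineLie_inj.1 (key i m)).2⟩⟩
  refine mem_G2_of_frame (differentiable_infty hF) hF'
    (fun i m => add_mem_g2 (oddPart_mem_g2 x i m) (evenPart_mem_g2 x i (hA m))) ?_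
  have : F 0 = 1 := by
    simp only [F, hΦ0, ← Matrix.fromBlocks_one, Matrix.toBlocks_fromBlocks₁₁]
  rw [this]
  exact one_mem_G2

theorem Integrates.isImmersedSurface_iff {F : R2 → Mat7} {φ : R2 → R7} {x : R2 → R2}
    {v : R2 → Mat8 ℝ} (hv : ∀ m, v m ∈ pHat) (h : Integrates F φ x v) :
    IsImmersedSurface φ ↔ HasInjectiveTranslationPart x v := by
  obtain ⟨A, c, -, -, -, hv⟩ := exists_affineLie hv
  obtain ⟨-, hφ, hG, -, hφ'⟩ := (integrates_iff hv).1 h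
  rw [IsImmersedSurface, and_iff_right hφ]
  refine forall_congr' fun m => ?_
  rw [injective_iff_map_eq_zero]
  refine forall_congr' fun u => imp_congr_left ?_
  have h1 : fderiv ℝ φ m u = act (F m) (u 0 • translationPart x c 0 m +
      u 1 • translationPart x c 1 m) := by
    rw [fderiv_eq_pd, hφ', hφ', act_map_add, act_map_smul, act_map_smul]
  have h2 : fderiv ℝ φ m u = 0 ↔ u 0 • translationPart x c 0 m + u 1 • translationPart x c 1 m = 0 := by
    rw [h1]
    constructor
    · intro h
      rw [← act_transpose_act (hG m) (_ + _), h, act_zero_right]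
    · intro h
      rw [h, act_zero_right]
  rw [h2, theta_one_eq x (hv m)]
  constructor
  · intro h j
    have := congrArg (fun w : R7 => w j) h
    simpa [affineLie] using this
  · intro h
    ext j
    simpa [affineLie] using h j

theorem finrank_gaussMap {φ : R2 → R7} (h : IsImmersedSurface φ) (m : R2) :
    Module.finrank ℝ (gaussMap φ m) = 2 := by
  rw [gaussMap, LinearMap.finrank_range_of_inj (h.2 m)]
  simp

theorem gaussMap_le_iff {φ : R2 → R7} {m : R2} {V : Submodule ℝ R7} :
    gaussMap φ m ≤ V ↔ ∀ i, pd i φ m ∈ V := by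
  rw [gaussMap, LinearMap.range_le_iff_comap, Submodule.eq_top_iff']
  refine ⟨fun h i => h (E2 i), fun h u => ?_⟩
  rw [Submodule.mem_comap]
  change fderiv ℝ φ m u ∈ V
  rw [fderiv_eq_pd]
  exact V.add_mem (V.smul_mem _ (h 0)) (V.smul_mem _ (h 1))

theorem extGauss_eq_framePlane {φ : R2 → R7} (h : IsImmersedSurface φ) {F : Mat7} (hF : F ∈ G2)
    {m : R2} (hm : ∀ i, pd i φ m ∈ framePlane F) : extGauss φ m = framePlane F :=
  assocExtension_eq (isAssociative_framePlane hF) (gaussMap_le_iff.2 hm) (finrank_gaussMap h m)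

/-- The translation part of `v` lies in ℝ⁴ and `bᵢ` maps ℝ⁴ to ℝ³, so the tangent planes lie in the
span of `e₅, e₆, e₇`. -/
theorem Integrates.isAdaptedFrame {F : R2 → Mat7} {φ : R2 → R7} {x : R2 → R2}
    {v : R2 → Mat8 ℝ} (hv : ∀ m, v m ∈ pHat) (h : Integrates F φ x v) (hi : IsImmersedSurface φ) :
    IsAdaptedFrame F φ := by
  obtain ⟨A, c, -, -, hc, hv⟩ := exists_affineLie hv
  obtain ⟨hF, hφ, hG, -, hφ'⟩ := (integrates_iff hv).1 h
  refine ⟨hF, hG, fun m => (extGauss_eq_framePlane hi (hG m) fun i => ?_).symm⟩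
  rw [mem_framePlane_iff (hG m), hφ', act_transpose_act (hG m), act_S7_translationPart x i (hc m)]

theorem Integrates.isNondegenerate_and_isAbelian {F : R2 → Mat7} {φ : R2 → R7} {x : R2 → R2}
    {v : R2 → Mat8 ℝ} (hs : IsAffineSystem x v) (h : Integrates F φ x v)
    (hF : IsAdaptedFrame F φ) : IsNondegenerate φ ∧ IsAbelian φ := by
  obtain ⟨A, c, hA, hA', -, hv⟩ := exists_affineLie hs.mem_pHat
  obtain ⟨-, -, hG, hF', -⟩ := (integrates_iff hv).1 h
  exact isNondegenerate_and_isAbelian_of_frame hF.smooth hG (fun m => (hF.span_eq m).symm) hF'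
    (S7_mul_oddPart x) (oddPart_mem_g2 x) (fun i m => S7_mul_evenPart x i (hA' m))
    (fun i m => evenPart_mem_g2 x i (hA m)) (lie_oddPart x)
    (fun m => oddPart_independent (hs.coordinates m))

end Integration

/-! ### Congruent surfaces and conjugate families -/

section Congruence

open Matrix

theorem K_transpose_mul {k : Mat7} (hk : k ∈ K) : kᵀ * k = 1 := transpose_mul_self_of_mem_G2 hk.1

theorem Integrates.pd_affineMatrix {F : R2 → Mat7} {φ : R2 → R7} {x : R2 → R2}
    {v : R2 → Mat8 ℝ} (h : Integrates F φ x v) (i : Fin 2) (m : R2) :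
    pd i (fun p => affineMatrix (F p) (φ p)) m =
      affineMatrix (F m) (φ m) * (pForm x i m + kForm x v i m) := by
  refine (h.eqn m (E2 i)).trans ?_
  rw [theta_one]
  fin_cases i <;> simp

/-- Both `Φ'` and `(g, c)Φk` solve the frame equation of `θ'₁`, and they agree at the origin. -/
theorem areCongruent_of_conjugateFamilies {x x' : R2 → R2} {v v' : R2 → Mat8 ℝ}
    {F F' : R2 → Mat7} {φ φ' : R2 → R7} (hs : IsAffineSystem x v) (hs' : IsAffineSystem x' v')
    (h : Integrates F φ x v) (h' : Integrates F' φ' x' v') (hc : ConjugateFamilies x v x' v') :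
    AreCongruent φ φ' := by
  obtain ⟨k, hk, hc⟩ := (conjugateFamilies_iff hs.mem_pHat hs'.mem_pHat).1 hc
  -- The rigid motion `(g, c)` is forced by the condition `Φ' = (g, c)Φk` at the origin.
  let g : Mat7 := F' 0 * kᵀ * (F 0)ᵀ
  have hg : g ∈ G2 :=
    mul_mem_G2 (mul_mem_G2 (h'.mem_G2 0) (transpose_mem_G2 hk.1)) (transpose_mem_G2 (h.mem_G2 0))
  let c : R7 := φ' 0 - act g (φ 0)
  have hΦ := differentiable_infty (contDiff_affineMatrix h.smooth_F h.smooth_φ)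
  have hΦ' := differentiable_infty (contDiff_affineMatrix h'.smooth_F h'.smooth_φ)
  have hG : Differentiable ℝ fun p => affineMatrix g c * affineMatrix (F p) (φ p) :=
    differentiable_matrix_mul (differentiable_const _) hΦ
  have hGk : Differentiable ℝ fun p =>
      affineMatrix g c * affineMatrix (F p) (φ p) * affineMatrix k 0 :=
    differentiable_matrix_mul hG (differentiable_const _)
  have key (m : R2) : affineMatrix (F' m) (φ' m) -
      affineMatrix g c * affineMatrix (F m) (φ m) * affineMatrix k 0 = 0 := by
    refine eq_zero_of_frame (A := fun i m => pForm x' i m + kForm x' v' i m)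
      (Φ := fun p => affineMatrix (F' p) (φ' p) -
        affineMatrix g c * affineMatrix (F p) (φ p) * affineMatrix k 0)
      (fun i => (contDiff_matrix_add (contDiff_pForm hs'.smooth_x i)
        (contDiff_kForm hs'.smooth_x hs'.smooth_v i)).continuous) (hΦ'.sub hGk) (fun i m => ?_) ?_ m
    · rw [pd_matrix_sub hΦ' hGk, pd_mul_const hG, pd_const_mul _ hΦ, h.pd_affineMatrix,
        h'.pd_affineMatrix, Matrix.sub_mul, mul_assoc _ (affineMatrix k 0), hc]
      simp only [mul_assoc]
    · simp only [affineMatrix_mul, sub_eq_zero]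
      rw [affineMatrix_inj]
      constructor
      · calc F' 0 = F' 0 * (kᵀ * ((F 0)ᵀ * F 0) * k) := by
              rw [transpose_mul_self_of_mem_G2 (h.mem_G2 0), mul_one, K_transpose_mul hk, mul_one]
          _ = _ := by simp only [g]; noncomm_ring
      · rw [act_zero_right, zero_add]
        simp [c]
  refine ⟨g, hg, c, fun m => ?_⟩
  have h1 := sub_eq_zero.1 (key m)
  rw [affineMatrix_mul, affineMatrix_mul, affineMatrix_inj, act_zero_right, zero_add] at h1
  exact h1.2

theorem reflection_eq_of_framePlane_eq {F F' : Mat7} (hF : F ∈ G2) (hF' : F' ∈ G2)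
    (h : framePlane F = framePlane F') : reflection F = reflection F' := by
  have h1 := starProjection_framePlane hF
  rw [h, starProjection_framePlane hF'] at h1
  have h2 := smul_right_injective _ (by norm_num : (1 / 2 : ℝ) ≠ 0) (actL_injective h1)
  exact (add_left_cancel h2).symm

theorem eq_zero_of_add_eq_zero7 {X Y : Mat7} (hX : S7 * X = -(X * S7)) (hY : S7 * Y = Y * S7)
    (h : X + Y = 0) : X = 0 ∧ Y = 0 := by
  have h1 : S7 * (X + Y) * S7 = -X + Y := by
    rw [Matrix.mul_add, Matrix.add_mul, hX, hY, Matrix.neg_mul, mul_assoc, mul_assoc, S7_mul_S7,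
      mul_one, mul_one]
  rw [h, Matrix.mul_zero, Matrix.zero_mul] at h1
  have h2 : Y = X := by rw [← sub_eq_zero, sub_eq_neg_add, ← h1]
  rw [h2, ← two_smul ℝ, smul_eq_zero] at h
  have h3 := h.resolve_left two_ne_zero
  exact ⟨h3, h2.trans h3⟩

theorem exists_eq_oddPart {x : R2 → R2} {m : R2} (hx : Function.Bijective (fderiv ℝ x m))
    (j : Fin 2) : ∃ u : R2, b7 j = u 0 • oddPart x 0 m + u 1 • oddPart x 1 m := by
  obtain ⟨u, hu⟩ := hx.2 (E2 j)
  refine ⟨u, ?_⟩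
  have h : u 0 • oddPart x 0 m + u 1 • oddPart x 1 m =
      fderiv ℝ x m u 0 • b7 0 + fderiv ℝ x m u 1 • b7 1 := by
    rw [fderiv_apply_eq, fderiv_apply_eq, oddPart, oddPart, Fin.sum_univ_two, Fin.sum_univ_two]
    module
  rw [h, hu]
  fin_cases j <;> simp

theorem tCoord_b7 (j : Fin 2) : tCoord (b7 j) = 0 := by rw [b7_eq_pMat, tCoord_pMat]

theorem tCoord_oddPart (x : R2 → R2) (i : Fin 2) (m : R2) : tCoord (oddPart x i m) = 0 := by
  rw [oddPart, map_sum]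
  exact Finset.sum_eq_zero fun j _ => by rw [map_smul, tCoord_b7, smul_zero]

/-- The normalizer of the span of `b₁, b₂` in `𝔰𝔬(4)` is trivial. -/
theorem eq_zero_of_tCoord_lie {N : Mat7} (hN : N ∈ g2) (hN' : S7 * N = N * S7)
    (h : ∀ j, tCoord ⁅b7 j, N⁆ = 0) : N = 0 := by
  rw [eq_kMat hN hN'] at h ⊢
  have h0 (j : Fin 2) (r : Fin 6) : root j r * kCoord N r = 0 := by
    have := h j
    rw [lie_b7_kMat, tCoord_pMat] at this
    simpa using congrFun this r
  have : kCoord N = 0 := by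
    funext r
    have h1 := h0 0 r
    have h2 := h0 1 r
    fin_cases r <;> simp [root] at h1 h2 ⊢ <;> assumption
  rw [this, kMat_zero]

/-- `tCoord` as a continuous linear map. -/
def tCoordL : Mat7 →L[ℝ] (Fin 6 → ℝ) := LinearMap.toContinuousLinearMap tCoord

theorem pd_tCoord {A : R2 → Mat7} (hA : Differentiable ℝ A) (i : Fin 2) (m : R2) :
    pd i (fun p => tCoord (A p)) m = tCoord (pd i A m) := pd_clm tCoordL hA i m

/-- The frames `gF` and `F'` are adapted to the same surface, so `F' = gFk` with `k` in `K`. The odd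
parts force `k` to normalize the span of `b₁, b₂`; as no nonzero element of `𝔰𝔬(4)` normalizes it,
`k` is constant. -/
theorem conjugateFamilies_of_areCongruent {x x' : R2 → R2} {v v' : R2 → Mat8 ℝ}
    {F F' : R2 → Mat7} {φ φ' : R2 → R7} (hs : IsAffineSystem x v) (hs' : IsAffineSystem x' v')
    (h : Integrates F φ x v) (h' : Integrates F' φ' x' v') (hi : IsImmersedSurface φ)
    (hc : AreCongruent φ φ') : ConjugateFamilies x v x' v' := by
  obtain ⟨g, hg, c, hc⟩ := hc
  have hφ' : φ' = fun m => act g (φ m) + c := funext hc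
  have hφd := differentiable_infty h.smooth_φ
  have hgφ : Differentiable ℝ fun p => act g (φ p) := differentiable_act (differentiable_const g) hφd
  have hpd (i : Fin 2) (m : R2) : pd i φ' m = act g (pd i φ m) := by
    rw [hφ', pd_add hgφ (differentiable_const c), pd_act (differentiable_const g) hφd, pd_matrix_const,
      pd_const]
    simp [act]
  have hi' : IsImmersedSurface φ' := by
    refine ⟨h'.smooth_φ, fun m => ?_⟩
    rw [injective_iff_map_eq_zero]
    intro u hu
    refine (injective_iff_map_eq_zero _).1 (hi.2 m) u ?_
    rw [fderiv_eq_pd, hpd, hpd, ← act_map_smul, ← act_map_smul, ← act_map_add, ← fderiv_eq_pd] at hu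
    rw [← act_transpose_act hg (fderiv ℝ φ m u), hu, act_zero_right]
  have hF := h.isAdaptedFrame hs.mem_pHat hi
  have hF' := h'.isAdaptedFrame hs'.mem_pHat hi'
  have hG := h.mem_G2
  have hG' := h'.mem_G2
  have hgF (m : R2) : g * F m ∈ G2 := mul_mem_G2 hg (hG m)
  have hpl (m : R2) : framePlane (g * F m) = framePlane (F' m) := by
    rw [← extGauss_eq_framePlane hi' (hgF m), ← hF'.span_eq]
    · rfl
    intro i
    have h1 : pd i φ m ∈ framePlane (F m) := by
      have : gaussMap φ m ≤ framePlane (F m) := by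
        have h2 : extGauss φ m = framePlane (F m) := (hF.span_eq m).symm
        rw [← h2]
        exact le_sInf fun V hV => hV.2
      exact gaussMap_le_iff.1 this i
    rw [mem_framePlane_iff (hG m)] at h1
    rw [mem_framePlane_iff (hgF m), hpd, Matrix.transpose_mul, act_mul, act_transpose_act hg, h1]
  let k : R2 → Mat7 := fun m => (g * F m)ᵀ * F' m
  have hkG (m : R2) : k m ∈ G2 := mul_mem_G2 (transpose_mem_G2 (hgF m)) (hG' m)
  have hkF (m : R2) : F' m = g * F m * k m := by
    rw [← mul_assoc, mul_transpose_self_of_mem_G2 (hgF m), one_mul]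
  have hkK (m : R2) : S7 * k m = k m * S7 := by
    have h1 := reflection_eq_of_framePlane_eq (hgF m) (hG' m) (hpl m)
    unfold reflection at h1
    calc S7 * ((g * F m)ᵀ * F' m)
        = ((g * F m)ᵀ * (g * F m)) * S7 * ((g * F m)ᵀ * F' m) := by
          rw [transpose_mul_self_of_mem_G2 (hgF m), one_mul]
      _ = (g * F m)ᵀ * (g * F m * S7 * (g * F m)ᵀ) * F' m := by simp only [mul_assoc]
      _ = (g * F m)ᵀ * F' m * S7 * ((F' m)ᵀ * F' m) := by rw [h1]; simp only [mul_assoc]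
      _ = (g * F m)ᵀ * F' m * S7 := by rw [transpose_mul_self_of_mem_G2 (hG' m), mul_one]
  have hgFs : ContDiff ℝ ∞ fun m => g * F m := contDiff_matrix_mul contDiff_const h.smooth_F
  have hks : ContDiff ℝ ∞ k := contDiff_matrix_mul (contDiff_matrix_transpose hgFs) h'.smooth_F
  have hkd := differentiable_infty hks
  clear_value k
  obtain ⟨A, d, hA, hA', hd, hv⟩ := exists_affineLie hs.mem_pHat
  obtain ⟨A', d', hAA, hAA', hd', hv'⟩ := exists_affineLie hs'.mem_pHat
  obtain ⟨-, -, -, hFe, hφe⟩ := (integrates_iff hv).1 h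
  obtain ⟨-, -, -, hFe', hφe'⟩ := (integrates_iff hv').1 h'
  have hkpd (i : Fin 2) (m : R2) : k m * (oddPart x' i m + evenPart x' A' i m) =
      (oddPart x i m + evenPart x A i m) * k m + pd i k m := by
    have h1 : pd i F' m = g * F m * (oddPart x i m + evenPart x A i m) * k m + g * F m * pd i k m := by
      have : F' = fun m => g * F m * k m := funext hkF
      conv_lhs => rw [this]
      rw [pd_mul (differentiable_infty hgFs) hkd, pd_const_mul _ (differentiable_infty h.smooth_F),
        hFe, ← mul_assoc]
    rw [hFe', hkF, mul_assoc] at h1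
    have h2 := congrArg (fun X => (g * F m)ᵀ * X) h1
    simp only [Matrix.mul_add, ← mul_assoc, transpose_mul_self_of_mem_G2 (hgF m), one_mul,
      Matrix.add_mul] at h2 ⊢
    exact h2
  have hpdk (i : Fin 2) (m : R2) : S7 * pd i k m = pd i k m * S7 := by
    rw [← pd_const_mul _ hkd, ← pd_mul_const hkd]
    simp only [hkK]
  -- The odd part of the gauge relation is purely algebraic in `k`; the derivative of `k` occurs
  -- only in the even part.
  have hsplit (i : Fin 2) (m : R2) : k m * oddPart x' i m = oddPart x i m * k m ∧
      pd i k m = k m * evenPart x' A' i m - evenPart x A i m * k m := by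
    have := eq_zero_of_add_eq_zero7
      (X := k m * oddPart x' i m - oddPart x i m * k m)
      (Y := k m * evenPart x' A' i m - evenPart x A i m * k m - pd i k m) ?_ ?_ ?_
    · exact ⟨sub_eq_zero.1 this.1, (sub_eq_zero.1 this.2).symm⟩
    · rw [Matrix.mul_sub, Matrix.sub_mul,
        S7_mul_mul_of_even_odd (hkK m) (S7_mul_oddPart x' i m),
        S7_mul_mul_of_odd_even (S7_mul_oddPart x i m) (hkK m)]
      abel
    · rw [Matrix.mul_sub, Matrix.mul_sub, Matrix.sub_mul, Matrix.sub_mul, hpdk,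
        S7_mul_mul_of_even (hkK m) (S7_mul_evenPart x' i (hAA' m)),
        S7_mul_mul_of_even (S7_mul_evenPart x i (hA' m)) (hkK m)]
    · rw [← sub_eq_zero.2 (hkpd i m)]
      noncomm_ring
  have hkk (m : R2) : k m * (k m)ᵀ = 1 := mul_transpose_self_of_mem_G2 (hkG m)
  have hkk' (m : R2) : (k m)ᵀ * k m = 1 := transpose_mul_self_of_mem_G2 (hkG m)
  have hconj (i : Fin 2) (m : R2) : k m * oddPart x' i m * (k m)ᵀ = oddPart x i m := by
    rw [(hsplit i m).1, mul_assoc, hkk, mul_one]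
  -- As `x'` is a local diffeomorphism, `bⱼ` is a combination of the odd parts of `θ'₁`, which `k`
  -- conjugates to those of `θ₁`. So `k` normalizes the span of `b₁, b₂`.
  have ht (j : Fin 2) (m : R2) : tCoord (k m * b7 j * (k m)ᵀ) = 0 := by
    obtain ⟨u, hu⟩ := exists_eq_oddPart (hs'.coordinates m) j
    rw [hu, Matrix.mul_add, Matrix.add_mul, Matrix.mul_smul, Matrix.mul_smul, Matrix.smul_mul,
      Matrix.smul_mul, hconj, hconj, map_add, map_smul, map_smul, tCoord_oddPart, tCoord_oddPart]
    simp
  have hkT := differentiable_matrix_transpose hkd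
  have hkb (j : Fin 2) : Differentiable ℝ fun p => k p * b7 j :=
    differentiable_matrix_mul hkd (differentiable_const _)
  have hpdk0 (i : Fin 2) (m : R2) : pd i k m = 0 := by
    let N : Mat7 := pd i k m * (k m)ᵀ
    have hNk : pd i k m = N * k m := by rw [mul_assoc, hkk', mul_one]
    have hNeq : N = k m * evenPart x' A' i m * (k m)ᵀ - evenPart x A i m := by
      simp only [N, (hsplit i m).2, Matrix.sub_mul]
      rw [mul_assoc (evenPart x A i m), hkk, mul_one]
    have hN : N ∈ g2 := by
      rw [hNeq]
      exact sub_mem_g2 (conj_mem_g2' (hkG m) (evenPart_mem_g2 x' i (hAA m)))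
        (evenPart_mem_g2 x i (hA m))
    have hkTS : S7 * (k m)ᵀ = (k m)ᵀ * S7 := by
      have := congrArg Matrix.transpose (hkK m)
      rw [Matrix.transpose_mul, Matrix.transpose_mul, transpose_S7] at this
      exact this.symm
    have hNS : S7 * N = N * S7 := S7_mul_mul_of_even (hpdk i m) hkTS
    -- Differentiation of the normalizing condition: `N = dk k⁻¹` normalizes the span
    -- infinitesimally.
    have hQ (j : Fin 2) : tCoord ⁅N, k m * b7 j * (k m)ᵀ⁆ = 0 := by
      have h1 : pd i (fun p => tCoord (k p * b7 j * (k p)ᵀ)) m = 0 := by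
        simp only [ht]
        exact pd_const _ _ _
      rw [pd_tCoord (differentiable_matrix_mul (hkb j) hkT), pd_mul (hkb j) hkT, pd_mul_const hkd,
        pd_transpose hkd, hNk, Matrix.transpose_mul, hN.1] at h1
      rw [← h1, Ring.lie_def]
      congr 1
      noncomm_ring
    have hα (l : Fin 2) : tCoord ⁅oddPart x l m, N⁆ = 0 := by
      rw [← hconj, oddPart, Fin.sum_univ_two]
      have : ⁅k m * (pd l x' m 0 • b7 0 + pd l x' m 1 • b7 1) * (k m)ᵀ, N⁆ =
          -(pd l x' m 0 • ⁅N, k m * b7 0 * (k m)ᵀ⁆ + pd l x' m 1 • ⁅N, k m * b7 1 * (k m)ᵀ⁆) := by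
        simp only [Ring.lie_def, Matrix.mul_add, Matrix.add_mul, Matrix.mul_smul, Matrix.smul_mul]
        module
      rw [this, map_neg, map_add, map_smul, map_smul, hQ, hQ]
      simp
    have hN0 : N = 0 := by
      refine eq_zero_of_tCoord_lie hN hNS fun j => ?_
      obtain ⟨u, hu⟩ := exists_eq_oddPart (hs.coordinates m) j
      have : ⁅b7 j, N⁆ = u 0 • ⁅oddPart x 0 m, N⁆ + u 1 • ⁅oddPart x 1 m, N⁆ := by
        rw [hu]
        simp only [Ring.lie_def, Matrix.mul_add, Matrix.add_mul, Matrix.mul_smul, Matrix.smul_mul]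
        module
      rw [this, map_add, map_smul, map_smul, hα, hα]
      simp
    rw [hNk, hN0, Matrix.zero_mul]
  have hkc (m : R2) : k m = k 0 := eq_of_pd_eq_zero hkd hpdk0 m
  rw [conjugateFamilies_iff hs.mem_pHat hs'.mem_pHat]
  refine ⟨k 0, ⟨hkG 0, hkK 0⟩, fun i m => ?_⟩
  rw [form_eq_affineLie x i (hv m), form_eq_affineLie x' i (hv' m), affineMatrix_mul_affineLie,
    affineLie_mul_affineMatrix, affineLie_inj, ← hkc m]
  refine ⟨?_, ?_⟩
  · rw [hkpd, hpdk0, add_zero]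
  · rw [act_zero_right, zero_add]
    have h1 := hφe' i m
    rw [hpd, hφe, hkF, act_mul, act_mul] at h1
    have h2 := congrArg (fun w => act (F m)ᵀ (act gᵀ w)) h1
    simp only [act_transpose_act hg, act_transpose_act (hG m)] at h2
    exact h2.symm

end Congruence

/-! ### Conjugacy of maximal abelian subspaces of 𝔭 -/

section MaximalTorus

open Matrix

theorem isClosed_K : IsClosed K := by
  have h1 : IsClosed {k : Mat7 | kᵀ * k = 1} :=
    isClosed_eq (by fun_prop) continuous_const
  have h2 : IsClosed {k : Mat7 | S7 * k = k * S7} :=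
    isClosed_eq (by fun_prop) (by fun_prop)
  have hact (u : R7) : Continuous fun k : Mat7 => act k u :=
    (ContinuousLinearMap.apply ℝ R7 u).continuous.comp actL.continuous
  have h3 : IsClosed {k : Mat7 | ∀ u v : R7, act k (cross u v) = cross (act k u) (act k v)} := by
    simp only [Set.ofPred_forall]
    refine isClosed_iInter fun u => isClosed_iInter fun v => isClosed_eq (hact _) ?_
    exact (crossL.continuous.comp (hact u)).clm_apply (hact v)
  have : K = {k : Mat7 | kᵀ * k = 1} ∩
      {k : Mat7 | ∀ u v : R7, act k (cross u v) = cross (act k u) (act k v)} ∩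
      {k : Mat7 | S7 * k = k * S7} := by
    ext k
    simp only [K, G2, Set.mem_ofPred_eq, Set.mem_inter_iff]
    rw [Matrix.mem_orthogonalGroup_iff']
  rw [this]
  exact (h1.inter h3).inter h2

theorem isCompact_K : IsCompact K := by
  have : ProperSpace Mat7 := FiniteDimensional.proper ℝ Mat7
  refine Metric.isCompact_of_isClosed_isBounded isClosed_K ?_
  refine (Metric.isBounded_closedBall (x := (0 : Mat7)) (r := 1)).subset fun k hk => ?_
  rw [mem_closedBall_zero_iff]
  exact entrywise_sup_norm_bound_of_unitary hk.1.1

theorem one_mem_K : (1 : Mat7) ∈ K := ⟨one_mem_G2, by simp⟩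

theorem mul_mem_K {k l : Mat7} (hk : k ∈ K) (hl : l ∈ K) : k * l ∈ K :=
  ⟨mul_mem_G2 hk.1 hl.1, S7_mul_mul_of_even hk.2 hl.2⟩

theorem transpose_mem_K {k : Mat7} (hk : k ∈ K) : kᵀ ∈ K := by
  refine ⟨transpose_mem_G2 hk.1, ?_⟩
  have := congrArg Matrix.transpose hk.2
  rw [Matrix.transpose_mul, Matrix.transpose_mul, transpose_S7] at this
  exact this.symm

/-- On skew matrices `-tr N²` is the squared Frobenius norm. This definiteness replaces that of the
Killing form. -/
theorem eq_zero_of_trace_mul_self {N : Mat7} (hN : Nᵀ = -N) (h : (N * N).trace = 0) : N = 0 := by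
  have : (Nᵀ * N).trace = 0 := by rw [hN, Matrix.neg_mul, Matrix.trace_neg, h, neg_zero]
  have h2 := Matrix.trace_conjTranspose_mul_self_eq_zero_iff (A := N)
  rw [Matrix.conjTranspose_eq_transpose_of_trivial] at h2
  exact h2.1 this

/-- The trace as a continuous linear map. -/
def traceL : Mat7 →L[ℝ] ℝ := LinearMap.toContinuousLinearMap (Matrix.traceLinearMap (Fin 7) ℝ ℝ)

theorem pd_trace {A : R2 → Mat7} (hA : Differentiable ℝ A) (i : Fin 2) (m : R2) :
    pd i (fun p => (A p).trace) m = (pd i A m).trace := pd_clm traceL hA i m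

/-- One-parameter subgroups, as maps on the parameter domain. -/
theorem exists_oneParameter {N : Mat7} (hN : N ∈ g2) :
    ∃ Φ : R2 → Mat7, ContDiff ℝ ∞ Φ ∧ Φ 0 = 1 ∧ (∀ m, Φ m ∈ G2) ∧ (∀ m, pd 0 Φ m = Φ m * N) ∧
      ∀ Z, Z * N = N * Z → ∀ m, Z * Φ m = Φ m * Z := by
  -- The one-form `N du₀` with constant coefficient is flat; its frame is the one-parameter group of
  -- `N` in the first variable.
  let A : Fin 2 → R2 → Mat7 := fun i _ => if i = 0 then N else 0
  have hA (i : Fin 2) : ContDiff ℝ ∞ (A i) := contDiff_const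
  have hflat : IsFlatPair A := by
    intro m
    have (i j : Fin 2) : pd i (A j) m = 0 := pd_matrix_const _ i m
    rw [this, this]
    simp [A, Ring.lie_def]
  obtain ⟨Φ, h1, h2, h3, h4⟩ := exists_G2_frame_of_isFlatPair hA hflat (fun i m => by
    fin_cases i
    · exact hN
    · exact zero_mem_g2) one_mem_G2
  refine ⟨Φ, h1, h2, h3, fun m => h4 0 m, fun Z hZ m => ?_⟩
  have hd := differentiable_infty h1
  have hz1 : Differentiable ℝ fun p => Z * Φ p := differentiable_matrix_mul (differentiable_const _) hd
  have hz2 : Differentiable ℝ fun p => Φ p * Z := differentiable_matrix_mul hd (differentiable_const _)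
  rw [← sub_eq_zero]
  refine eq_zero_of_frame (A := A) (Φ := fun p => Z * Φ p - Φ p * Z)
    (fun i => (hA i).continuous) (hz1.sub hz2) (fun i m => ?_) ?_ m
  · rw [pd_matrix_sub hz1 hz2, pd_const_mul _ hd, pd_mul_const hd, h4]
    fin_cases i
    · simp only [A, Fin.zero_eta, if_true]
      rw [mul_assoc (Φ m), ← hZ]
      noncomm_ring
    · simp [A]
  · simp only [h2, mul_one, one_mul, sub_self]

/-- An odd matrix can be conjugated so that it commutes with `B`, by an element of `SO(4)` that
commutes with `Z`. -/
theorem exists_conj_commute {X B Z : Mat7} (hX : X ∈ g2) (hX' : S7 * X = -(X * S7)) (hB : B ∈ g2)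
    (hB' : S7 * B = -(B * S7)) (hXZ : Z * X = X * Z) (hBZ : Z * B = B * Z) :
    ∃ k ∈ K, Z * k = k * Z ∧ ⁅B, kᵀ * X * k⁆ = 0 := by
  have hZc : IsClosed {k : Mat7 | Z * k = k * Z} := isClosed_eq (by fun_prop) (by fun_prop)
  -- The trace pairing of the conjugates of `X` with `B` attains a maximum on the compact
  -- centralizer of `Z` in `K`. The direction `N = [B, X']` is tangent to this centralizer, because
  -- `N` is even and commutes with `Z`.
  obtain ⟨k, ⟨hk, hkZ⟩, hmax⟩ := (isCompact_K.inter_right hZc).exists_isMaxOn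
    ⟨1, one_mem_K, by simp⟩ (f := fun k : Mat7 => (kᵀ * X * k * B).trace)
    (Continuous.continuousOn (by fun_prop))
  refine ⟨k, hk, hkZ, ?_⟩
  have hkk : k * kᵀ = 1 := mul_transpose_self_of_mem_G2 hk.1
  have hkk' : kᵀ * k = 1 := transpose_mul_self_of_mem_G2 hk.1
  have hkZ' : Z * kᵀ = kᵀ * Z := by
    calc Z * kᵀ = kᵀ * k * Z * kᵀ := by rw [hkk', one_mul]
      _ = kᵀ * (k * Z) * kᵀ := by noncomm_ring
      _ = kᵀ * Z * (k * kᵀ) := by rw [← hkZ]; noncomm_ring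
      _ = kᵀ * Z := by rw [hkk, mul_one]
  set X' := kᵀ * X * k with hX'def
  have hXg : X' ∈ g2 := conj_mem_g2 hk.1 hX
  have hXo : S7 * X' = -(X' * S7) :=
    S7_mul_mul_of_odd_even (S7_mul_mul_of_even_odd (transpose_mem_K hk).2 hX') hk.2
  have hXZ' : Z * X' = X' * Z := by
    calc Z * (kᵀ * X * k) = (Z * kᵀ) * X * k := by noncomm_ring
      _ = kᵀ * (Z * X) * k := by rw [hkZ']; noncomm_ring
      _ = kᵀ * X * (Z * k) := by rw [hXZ]; noncomm_ring
      _ = kᵀ * X * k * Z := by rw [hkZ]; noncomm_ring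
  set N := ⁅B, X'⁆ with hNdef
  have hN : N ∈ g2 := lie_mem_g2 hB hXg
  have hNS : S7 * N = N * S7 := S7_mul_lie_of_odd hB' hXo
  have hNZ : Z * N = N * Z := by
    have e1 : Z * (B * X') = B * X' * Z := by
      rw [← mul_assoc, hBZ, mul_assoc B Z, hXZ', ← mul_assoc]
    have e2 : Z * (X' * B) = X' * B * Z := by
      rw [← mul_assoc, hXZ', mul_assoc X' Z, hBZ, ← mul_assoc]
    rw [hNdef, Ring.lie_def, Matrix.mul_sub, Matrix.sub_mul, e1, e2]
  obtain ⟨Φ, h1, h2, h3, h4, h5⟩ := exists_oneParameter hN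
  have hd := differentiable_infty h1
  have hT := differentiable_matrix_transpose hd
  have hTX : Differentiable ℝ fun p => (Φ p)ᵀ * X' :=
    differentiable_matrix_mul hT (differentiable_const _)
  have hTXd : Differentiable ℝ fun p => (Φ p)ᵀ * X' * Φ p := differentiable_matrix_mul hTX hd
  have hTXB : Differentiable ℝ fun p => (Φ p)ᵀ * X' * Φ p * B :=
    differentiable_matrix_mul hTXd (differentiable_const _)
  have hloc : IsLocalMax (fun p => ((Φ p)ᵀ * X' * Φ p * B).trace) 0 := by
    refine Filter.Eventually.of_forall fun p => ?_
    have hmem : k * Φ p ∈ K ∩ {k : Mat7 | Z * k = k * Z} := by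
      refine ⟨mul_mem_K hk ⟨h3 p, h5 S7 hNS p⟩, ?_⟩
      change Z * (k * Φ p) = k * Φ p * Z
      rw [← mul_assoc, hkZ, mul_assoc, h5 Z hNZ, mul_assoc]
    have := hmax hmem
    simp only [Set.mem_ofPred_eq, h2, Matrix.transpose_mul] at this ⊢
    simp only [Matrix.transpose_one, one_mul, mul_one]
    refine Eq.trans_le ?_ this
    congr 1
    simp only [hX'def]
    noncomm_ring
  have hz : pd 0 (fun p => ((Φ p)ᵀ * X' * Φ p * B).trace) 0 = 0 := by
    rw [pd, hloc.fderiv_eq_zero]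
    rfl
  rw [pd_trace hTXB, pd_mul_const hTXd, pd_mul hTX hd, pd_mul_const hT, pd_transpose hd, h4, h2,
    one_mul, hN.1, Matrix.transpose_one, one_mul, mul_one] at hz
  refine eq_zero_of_trace_mul_self hN.1 ?_
  -- The derivative at the maximum in the direction `N` is `tr N²`.
  have e1 : N * N = N * (B * X') - N * X' * B := by
    rw [mul_assoc, ← Matrix.mul_sub, ← Ring.lie_def]
  have e2 : (-N * X' + X' * N) * B = X' * (N * B) - N * X' * B := by noncomm_ring
  rw [e2, Matrix.trace_sub, Matrix.trace_mul_comm X'] at hz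
  rw [e1, Matrix.trace_sub, ← mul_assoc, hz]

/-- Commuting elements of `𝔭` are simultaneously conjugate to elements of the span of `b₁, b₂`. -/
theorem exists_conj_tCoord_eq_zero {X : Fin 2 → Mat7} (hX : ∀ i, X i ∈ g2)
    (hX' : ∀ i, S7 * X i = -(X i * S7)) (hc : ⁅X 0, X 1⁆ = 0) :
    ∃ k ∈ K, ∀ i, tCoord (kᵀ * X i * k) = 0 := by
  -- A regular element: the six roots take the values 2, 1, 3, 1, 5, 4 on it, so an odd element
  -- commuting with `B` lies in the span of `b₁, b₂`.
  let B : Mat7 := (2 : ℝ) • b7 0 + b7 1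
  have hB : B ∈ g2 := add_mem_g2 (smul_mem_g2 _ (b7_mem_g2 0)) (b7_mem_g2 1)
  have hB' : S7 * B = -(B * S7) := by
    simp only [B, Matrix.mul_add, Matrix.add_mul, Matrix.mul_smul, Matrix.smul_mul, S7_mul_b7,
      smul_neg, neg_add]
  have hBp (h : Fin 2 → ℝ) (t : Fin 6 → ℝ) :
      ⁅B, pMat h t⁆ = kMat ((2 : ℝ) • (root 0 * t) + root 1 * t) := by
    rw [kMat_add, kMat_smul, ← lie_b7_pMat 0 h, ← lie_b7_pMat 1 h]
    simp only [B, Ring.lie_def, Matrix.mul_add, Matrix.add_mul, Matrix.mul_smul, Matrix.smul_mul]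
    module
  have hBz {Y : Mat7} (hY : Y ∈ g2) (hY' : S7 * Y = -(Y * S7)) (h : ⁅B, Y⁆ = 0) :
      tCoord Y = 0 := by
    rw [eq_pMat hY hY', hBp] at h
    have h1 := congrArg kCoord h
    rw [kCoord_kMat, map_zero] at h1
    funext r
    have h2 := congrFun h1 r
    fin_cases r <;> simp [root] at h2 ⊢ <;> linarith
  have hBt {Y : Mat7} (hY : Y ∈ g2) (hY' : S7 * Y = -(Y * S7)) (h : tCoord Y = 0) :
      Y * B = B * Y := by
    have : ⁅B, Y⁆ = 0 := by
      rw [eq_pMat hY hY', hBp, h, mul_zero, mul_zero, smul_zero, add_zero, kMat_zero]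
    rw [Ring.lie_def, sub_eq_zero] at this
    exact this.symm
  have hodd {k Y : Mat7} (hk : k ∈ K) (hY : S7 * Y = -(Y * S7)) :
      S7 * (kᵀ * Y * k) = -(kᵀ * Y * k * S7) :=
    S7_mul_mul_of_odd_even (S7_mul_mul_of_even_odd (transpose_mem_K hk).2 hY) hk.2
  obtain ⟨k, hk, -, h0⟩ := exists_conj_commute (Z := 0) (hX 0) (hX' 0) hB hB' (by simp) (by simp)
  have hkk : k * kᵀ = 1 := mul_transpose_self_of_mem_G2 hk.1
  have ht0 := hBz (conj_mem_g2 hk.1 (hX 0)) (hodd hk (hX' 0)) h0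
  have hcomm : kᵀ * X 0 * k * (kᵀ * X 1 * k) = kᵀ * X 1 * k * (kᵀ * X 0 * k) := by
    have e (Y Y' : Mat7) : kᵀ * Y * k * (kᵀ * Y' * k) = kᵀ * (Y * Y') * k := by
      calc kᵀ * Y * k * (kᵀ * Y' * k) = kᵀ * Y * (k * kᵀ) * Y' * k := by noncomm_ring
        _ = _ := by rw [hkk]; noncomm_ring
    rw [Ring.lie_def, sub_eq_zero] at hc
    rw [e, e, hc]
  -- The second conjugation is chosen in the centralizer of the first conjugated element, which
  -- therefore stays in place.
  obtain ⟨l, hl, hlZ, h1⟩ := exists_conj_commute (Z := kᵀ * X 0 * k) (conj_mem_g2 hk.1 (hX 1))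
    (hodd hk (hX' 1)) hB hB' hcomm (hBt (conj_mem_g2 hk.1 (hX 0)) (hodd hk (hX' 0)) ht0)
  have ht1 := hBz (conj_mem_g2 hl.1 (conj_mem_g2 hk.1 (hX 1))) (hodd hl (hodd hk (hX' 1))) h1
  have hll : lᵀ * l = 1 := transpose_mul_self_of_mem_G2 hl.1
  refine ⟨k * l, mul_mem_K hk hl, fun i => ?_⟩
  have e (Y : Mat7) : (k * l)ᵀ * Y * (k * l) = lᵀ * (kᵀ * Y * k) * l := by
    rw [Matrix.transpose_mul]; noncomm_ring
  rw [e]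
  fin_cases i
  · change tCoord (lᵀ * (kᵀ * X 0 * k) * l) = 0
    rw [mul_assoc, hlZ, ← mul_assoc, hll, one_mul, ht0]
  · exact ht1

end MaximalTorus

/-! ### Frames with purely odd Maurer–Cartan form -/

section ParallelFrame

open Matrix

theorem transpose_mul_pd_mem_g2 {F : R2 → Mat7} (hF : Differentiable ℝ F) (hG : ∀ m, F m ∈ G2)
    (i : Fin 2) (m : R2) : (F m)ᵀ * pd i F m ∈ g2 := by
  have hT := differentiable_matrix_transpose hF
  refine ⟨?_, fun u v => ?_⟩
  · have h : pd i (fun p => (F p)ᵀ * F p) m = 0 := by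
      simp only [fun p => transpose_mul_self_of_mem_G2 (hG p)]
      exact pd_matrix_const _ _ _
    rw [pd_mul hT hF, pd_transpose hF] at h
    rw [Matrix.transpose_mul, Matrix.transpose_transpose]
    exact eq_neg_of_add_eq_zero_left h
  · have ha (u : R7) : Differentiable ℝ fun p => act (F p) u :=
      differentiable_act hF (differentiable_const u)
    have hda (u : R7) : pd i (fun p => act (F p) u) m = act (pd i F m) u := by
      rw [pd_act hF (differentiable_const u), pd_const, act_zero_right, add_zero]
    have h : pd i (fun p => act (F p) (cross u v)) m =
        pd i (fun p => cross (act (F p) u) (act (F p) v)) m := by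
      simp only [fun p => (hG p).2 u v]
    rw [pd_cross (ha u) (ha v), hda, hda, hda] at h
    rw [act_mul, h, act_map_add, (transpose_mem_G2 (hG m)).2, (transpose_mem_G2 (hG m)).2,
      act_transpose_act (hG m), act_transpose_act (hG m), act_mul, act_mul]

/-- Only the last three columns of `g` enter. The reflection is therefore smooth as soon as these
columns are, even if the rest of the frame is chosen pointwise. -/
theorem reflection_apply {g : Mat7} (hg : g ∈ G2) (i j : Fin 7) :
    reflection g i j = 2 * (g i 4 * g j 4 + g i 5 * g j 5 + g i 6 * g j 6) -
      (1 : Mat7) i j := by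
  rw [← mul_transpose_self_of_mem_G2 hg, reflection]
  simp only [Matrix.mul_apply, Matrix.transpose_apply, Fin.sum_univ_seven]
  simp [S7]
  ring

/-- The reflections in the planes of the extended Gauss map depend smoothly on the point. -/
theorem exists_smooth_reflection {φ : R2 → R7} (h : IsImmersedSurface φ) :
    ∃ (S : R2 → Mat7) (g : R2 → Mat7), ContDiff ℝ ∞ S ∧ (∀ m, g m ∈ G2) ∧
      (∀ m, S m = reflection (g m)) ∧ ∀ m, extGauss φ m = framePlane (g m) := by
  have hinj (m u : R2) (hu : u 0 • pd 0 φ m + u 1 • pd 1 φ m = 0) : u = 0 := by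
    rw [← fderiv_eq_pd] at hu
    exact (injective_iff_map_eq_zero _).1 (h.2 m) u hu
  have hs (i : Fin 2) := contDiff_pd h.1 i
  have h0 (m : R2) : pd 0 φ m ≠ 0 := by
    intro h0
    have := hinj m (E2 0) (by simp [h0])
    simpa using congrArg (fun w : R2 => w 0) this
  -- Gram–Schmidt applied to the coordinate tangent vectors; the third vector is the cross product.
  let f5 : R2 → R7 := fun m => ‖pd 0 φ m‖⁻¹ • pd 0 φ m
  have hf5s : ContDiff ℝ ∞ f5 := (((hs 0).norm ℝ h0).inv fun m => norm_ne_zero_iff.2 (h0 m)).smul (hs 0)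
  have hf5 (m : R2) : inner ℝ (f5 m) (f5 m) = 1 := by
    rw [real_inner_self_eq_norm_sq, norm_smul, norm_inv, norm_norm,
      inv_mul_cancel₀ (norm_ne_zero_iff.2 (h0 m)), one_pow]
  have hpd0 (m : R2) : pd 0 φ m = ‖pd 0 φ m‖ • f5 m := by
    rw [smul_smul, mul_inv_cancel₀ (norm_ne_zero_iff.2 (h0 m)), one_smul]
  let q : R2 → R7 := fun m => pd 1 φ m - inner ℝ (f5 m) (pd 1 φ m) • f5 m
  have hqs : ContDiff ℝ ∞ q := (hs 1).sub ((hf5s.inner ℝ (hs 1)).smul hf5s)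
  have hq0 (m : R2) : q m ≠ 0 := by
    intro hq
    -- The differential of `φ` maps this vector to `q m`.
    have := hinj m (!₂[-(inner ℝ (f5 m) (pd 1 φ m) * ‖pd 0 φ m‖⁻¹), 1]) (by
      simp only [q, f5] at hq
      simp only [f5]
      simp
      rw [← hq]
      module)
    simpa using congrArg (fun w : R2 => w 1) this
  have hq5 (m : R2) : inner ℝ (f5 m) (q m) = 0 := by
    simp only [q]
    rw [inner_sub_right, inner_smul_right, hf5, mul_one, sub_self]
  let f6 : R2 → R7 := fun m => ‖q m‖⁻¹ • q m
  have hf6s : ContDiff ℝ ∞ f6 := ((hqs.norm ℝ hq0).inv fun m => norm_ne_zero_iff.2 (hq0 m)).smul hqs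
  have hf6 (m : R2) : inner ℝ (f6 m) (f6 m) = 1 := by
    rw [real_inner_self_eq_norm_sq, norm_smul, norm_inv, norm_norm,
      inv_mul_cancel₀ (norm_ne_zero_iff.2 (hq0 m)), one_pow]
  have hf56 (m : R2) : inner ℝ (f5 m) (f6 m) = 0 := by
    simp only [f6]
    rw [inner_smul_right, hq5, mul_zero]
  have hpd1 (m : R2) : pd 1 φ m = ‖q m‖ • f6 m + inner ℝ (f5 m) (pd 1 φ m) • f5 m := by
    rw [smul_smul, mul_inv_cancel₀ (norm_ne_zero_iff.2 (hq0 m)), one_smul]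
    simp only [q]
    abel
  have hf7s : ContDiff ℝ ∞ fun m => cross (f5 m) (f6 m) := contDiff_cross hf5s hf6s
  choose g hg hg5 hg6 hg7 using fun m => exists_G2_frame_of_orthonormal (hf5 m) (hf6 m) (hf56 m)
  have hc (m : R2) (j : Fin 7) (w : R7) (hw : act (g m) (e j) = w) (i : Fin 7) : g m i j = w i := by
    rw [← hw, ← column_eq_act]
  refine ⟨fun m => reflection (g m), g, ?_, hg, fun m => rfl, fun m => ?_⟩
  · rw [contDiff_matrix_iff]
    intro i j
    simp only [fun m => reflection_apply (hg m), fun m => hc m 4 _ (hg5 m), fun m => hc m 5 _ (hg6 m),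
      fun m => hc m 6 _ (hg7 m)]
    rw [contDiff_euclidean] at hf5s hf6s hf7s
    exact (contDiff_const.mul ((((hf5s i).mul (hf5s j)).add ((hf6s i).mul (hf6s j))).add
      ((hf7s i).mul (hf7s j)))).sub contDiff_const
  · have h5 : f5 m ∈ framePlane (g m) := hg5 m ▸ act_e_mem_framePlane 0
    have h6 : f6 m ∈ framePlane (g m) := hg6 m ▸ act_e_mem_framePlane 1
    refine extGauss_eq_framePlane h (hg m) fun i => ?_
    fin_cases i
    · change pd 0 φ m ∈ _
      rw [hpd0]
      exact Submodule.smul_mem _ _ h5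
    · change pd 1 φ m ∈ _
      rw [hpd1]
      exact Submodule.add_mem _ (Submodule.smul_mem _ _ h6) (Submodule.smul_mem _ _ h5)

/-- The isotropy representation of `SO(4)` on the coassociative plane is faithful. -/
theorem eq_zero_of_mul_one_sub_S7 {D : Mat7} (hD : D ∈ g2) (hD' : S7 * D = D * S7)
    (h : D * (1 - S7) = 0) : D = 0 := by
  have hz (i j : Fin 7) : (D * (1 - S7)) i j = 0 := by rw [h]; rfl
  simp only [Matrix.mul_sub, mul_one, Matrix.sub_apply, mul_S7_apply] at hz
  rw [eq_kMat hD hD'] at hz ⊢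
  have h1 := hz 0 1
  have h2 := hz 1 3
  have h3 := hz 1 2
  have h4 := hz 0 2
  have h5 := hz 0 3
  have h6 := hz 2 3
  have : kCoord D = 0 := by
    generalize kCoord D = s at *
    simp [kMat] at h1 h2 h3 h4 h5 h6
    ext r; fin_cases r <;> simp <;> linarith
  rw [this, kMat_zero]

theorem framePlane_eq_of_reflection_eq {F F' : Mat7} (hF : F ∈ G2) (hF' : F' ∈ G2)
    (h : reflection F = reflection F') : framePlane F = framePlane F' := by
  have h1 := starProjection_framePlane hF
  rw [h, ← starProjection_framePlane hF'] at h1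
  ext w
  rw [← Submodule.starProjection_eq_self_iff, h1, Submodule.starProjection_eq_self_iff]

theorem reflection_mem_G2 {g : Mat7} (hg : g ∈ G2) : reflection g ∈ G2 :=
  mul_mem_G2 (mul_mem_G2 hg S7_mem_G2) (transpose_mem_G2 hg)

theorem transpose_reflection (g : Mat7) : (reflection g)ᵀ = reflection g := by
  rw [reflection, Matrix.transpose_mul, Matrix.transpose_mul, Matrix.transpose_transpose,
    transpose_S7, mul_assoc]

/-- A nondegenerate abelian surface has an adapted frame without `𝔰𝔬(4)`-part. -/
theorem exists_parallel_frame {φ : R2 → R7} (h : IsImmersedSurface φ) (hn : IsNondegenerate φ)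
    (ha : IsAbelian φ) : ∃ (F : R2 → Mat7) (β : Fin 2 → R2 → Mat7), ContDiff ℝ ∞ F ∧
      (∀ m, F m ∈ G2) ∧ (∀ m, extGauss φ m = framePlane (F m)) ∧ (∀ i, ContDiff ℝ ∞ (β i)) ∧
      (∀ i m, pd i F m = F m * β i m) ∧ (∀ i m, β i m ∈ g2) ∧
      (∀ i m, S7 * β i m = -(β i m * S7)) ∧ (∀ m, ⁅β 0 m, β 1 m⁆ = 0) ∧
      ∀ m (u : R2), u 0 • β 0 m + u 1 • β 1 m = 0 → u = 0 := by
  obtain ⟨S, g, hS, hg, hSg, hφ⟩ := exists_smooth_reflection h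
  have hSd := differentiable_infty hS
  have hSG (m : R2) : S m ∈ G2 := hSg m ▸ reflection_mem_G2 (hg m)
  have hST (m : R2) : (S m)ᵀ = S m := by rw [hSg, transpose_reflection]
  have hSS (m : R2) : S m * S m = 1 := by rw [hSg, reflection_mul_self (hg m)]
  have hpr (m : R2) : (extGauss φ m).starProjection = actL ((1 / 2 : ℝ) • (1 + S m)) := by
    rw [hφ, starProjection_framePlane (hg m), hSg]
  have hn' := (isNondegenerate_iff hS hpr).1 hn
  have ha' := (isAbelian_iff hS hSS hpr).1 ha
  have hanti (i : Fin 2) (m : R2) : pd i S m * S m = -(S m * pd i S m) := by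
    have h1 : pd i (fun p => S p * S p) m = 0 := by
      simp only [hSS]
      exact pd_matrix_const _ _ _
    rw [pd_mul hSd hSd] at h1
    exact eq_neg_of_add_eq_zero_left h1
  have hg2 (i : Fin 2) (m : R2) : S m * pd i S m ∈ g2 := by
    have := transpose_mul_pd_mem_g2 hSd hSG i m
    rwa [hST] at this
  -- Since `S` is a map into `G₂` with `S⁻¹ = S`, the products `S ∂ᵢS` lie in `𝔤₂`. Rewriting the
  -- bracket through them shows that it lies in `𝔤₂` as well.
  have hD (m : R2) : ⁅pd 0 S m, pd 1 S m⁆ = -⁅S m * pd 0 S m, S m * pd 1 S m⁆ := by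
    have e (X Y : Mat7) (hX : X * S m = -(S m * X)) : S m * X * (S m * Y) = -(X * Y) := by
      calc S m * X * (S m * Y) = S m * (X * S m) * Y := by noncomm_ring
        _ = -(S m * S m * X * Y) := by rw [hX]; noncomm_ring
        _ = _ := by rw [hSS, one_mul]
    rw [Ring.lie_def, Ring.lie_def, e _ _ (hanti 0 m), e _ _ (hanti 1 m)]
    abel
  -- The abelian condition makes the bracket vanish on the coassociative plane only; faithfulness of
  -- the isotropy action makes it vanish altogether.
  have hD0 (m : R2) : ⁅pd 0 S m, pd 1 S m⁆ = 0 := by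
    have hgg := mul_transpose_self_of_mem_G2 (hg m)
    have hgg' := transpose_mul_self_of_mem_G2 (hg m)
    set D := ⁅pd 0 S m, pd 1 S m⁆ with hDdef
    have hDg : D ∈ g2 := by
      rw [hDdef, hD]
      exact neg_mem_g2 (lie_mem_g2 (hg2 0 m) (hg2 1 m))
    have hDS : S m * D = D * S m := by
      have e (X Y : Mat7) (hX : X * S m = -(S m * X)) (hY : Y * S m = -(S m * Y)) :
          S m * (X * Y) = X * Y * S m := by
        calc S m * (X * Y) = (S m * X) * Y := by noncomm_ring
          _ = -(X * (S m * Y)) := by rw [← neg_eq_iff_eq_neg.2 hX]; noncomm_ring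
          _ = _ := by rw [← neg_eq_iff_eq_neg.2 hY]; noncomm_ring
      rw [hDdef, Ring.lie_def, Matrix.mul_sub, Matrix.sub_mul, e _ _ (hanti 0 m) (hanti 1 m),
        e _ _ (hanti 1 m) (hanti 0 m)]
    have hgS : (g m)ᵀ * S m = S7 * (g m)ᵀ := by
      rw [hSg, reflection]
      calc (g m)ᵀ * (g m * S7 * (g m)ᵀ) = (g m)ᵀ * g m * S7 * (g m)ᵀ := by noncomm_ring
        _ = _ := by rw [hgg', one_mul]
    have hSg' : S m * g m = g m * S7 := by
      rw [hSg, reflection]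
      calc g m * S7 * (g m)ᵀ * g m = g m * S7 * ((g m)ᵀ * g m) := by noncomm_ring
        _ = _ := by rw [hgg', mul_one]
    have hz : (g m)ᵀ * D * g m = 0 := by
      refine eq_zero_of_mul_one_sub_S7 (conj_mem_g2 (hg m) hDg) ?_ ?_
      · calc S7 * ((g m)ᵀ * D * g m) = S7 * (g m)ᵀ * D * g m := by noncomm_ring
          _ = (g m)ᵀ * (S m * D) * g m := by rw [← hgS]; noncomm_ring
          _ = (g m)ᵀ * D * (S m * g m) := by rw [hDS]; noncomm_ring
          _ = _ := by rw [hSg']; noncomm_ring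
      · calc (g m)ᵀ * D * g m * (1 - S7) = (g m)ᵀ * D * (g m - g m * S7) := by noncomm_ring
          _ = (g m)ᵀ * (D * (1 - S m)) * g m := by rw [← hSg']; noncomm_ring
          _ = 0 := by rw [ha']; simp
    calc D = (g m * (g m)ᵀ) * D * (g m * (g m)ᵀ) := by rw [hgg, one_mul, mul_one]
      _ = g m * ((g m)ᵀ * D * g m) * (g m)ᵀ := by noncomm_ring
      _ = 0 := by rw [hz]; simp
  -- The form `½ S dS` satisfies `dS + [θ, S] = 0`, so that `S` is parallel for it. Its curvature is
  -- a multiple of `[∂₀S, ∂₁S] = 0`.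
  let θ : Fin 2 → R2 → Mat7 := fun i m => (1 / 2 : ℝ) • (S m * pd i S m)
  have hSpd (i : Fin 2) : ContDiff ℝ ∞ fun m => S m * pd i S m :=
    contDiff_matrix_mul hS (contDiff_pd hS i)
  have hθs (i : Fin 2) : ContDiff ℝ ∞ (θ i) := contDiff_matrix_smul contDiff_const (hSpd i)
  have hθg (i : Fin 2) (m : R2) : θ i m ∈ g2 := smul_mem_g2 _ (hg2 i m)
  have hθc (m : R2) : ⁅θ 0 m, θ 1 m⁆ = 0 := by
    simp only [θ]
    rw [lie_smul_smul, ← neg_eq_iff_eq_neg.2 (hD m), hD0, neg_zero, smul_zero]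
  have hpdθ (i j : Fin 2) (m : R2) : pd i (θ j) m =
      (1 / 2 : ℝ) • (pd i S m * pd j S m + S m * pd i (pd j S) m) := by
    have : pd i (θ j) m = (1 / 2 : ℝ) • pd i (fun m => S m * pd j S m) m :=
      pd_matrix_const_smul _ (differentiable_infty (hSpd j)) i m
    rw [this, pd_mul hSd (differentiable_infty (contDiff_pd hS j))]
  have hflat : IsFlatPair θ := by
    intro m
    have hD0' := hD0 m
    rw [Ring.lie_def, sub_eq_zero] at hD0'
    rw [hθc, add_zero, hpdθ, hpdθ, pd_comm hS 0 1, hD0', sub_self]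
  obtain ⟨Φ, hΦ, hΦ0, hΦG, hΦ'⟩ :=
    exists_G2_frame_of_isFlatPair hθs hflat hθg (transpose_mem_G2 (hg 0))
  have hΦd := differentiable_infty hΦ
  have hΦT := differentiable_matrix_transpose hΦd
  have hΦΦ (m : R2) := mul_transpose_self_of_mem_G2 (hΦG m)
  have hΦΦ' (m : R2) := transpose_mul_self_of_mem_G2 (hΦG m)
  have hθS (i : Fin 2) (m : R2) : θ i m * S m = -(1 / 2 : ℝ) • pd i S m := by
    simp only [θ, Matrix.smul_mul]
    rw [mul_assoc, hanti, Matrix.mul_neg, ← mul_assoc, hSS, one_mul, smul_neg, neg_smul]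
  have hSθ (i : Fin 2) (m : R2) : S m * θ i m = (1 / 2 : ℝ) • pd i S m := by
    simp only [θ, Matrix.mul_smul]
    rw [← mul_assoc, hSS, one_mul]
  -- Parallel transport makes `ΦSΦᵀ` constant, and the initial value `g(0)ᵀ` makes the constant
  -- `S7`. Thus `Φᵀ` is adapted, and `θ` becomes odd in this frame.
  have hΦS (m : R2) : Φ m * S m * (Φ m)ᵀ = S7 := by
    have hΦSd : Differentiable ℝ fun p => Φ p * S p := differentiable_matrix_mul hΦd hSd
    have h1 := eq_of_pd_eq_zero (f := fun p => Φ p * S p * (Φ p)ᵀ)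
      (differentiable_matrix_mul hΦSd hΦT) (fun i m => ?_) m
    · rw [h1, hΦ0, hSg, reflection, Matrix.transpose_transpose]
      have hgg' := transpose_mul_self_of_mem_G2 (hg 0)
      calc (g 0)ᵀ * (g 0 * S7 * (g 0)ᵀ) * g 0 = ((g 0)ᵀ * g 0) * S7 * ((g 0)ᵀ * g 0) := by
            noncomm_ring
        _ = S7 := by rw [hgg', one_mul, mul_one]
    · refine (pd_mul hΦSd hΦT i m).trans ?_
      rw [pd_mul hΦd hSd, pd_transpose hΦd, hΦ', Matrix.transpose_mul, (hθg i m).1]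
      calc (Φ m * θ i m * S m + Φ m * pd i S m) * (Φ m)ᵀ + Φ m * S m * (-θ i m * (Φ m)ᵀ)
          = Φ m * (θ i m * S m + pd i S m - S m * θ i m) * (Φ m)ᵀ := by noncomm_ring
        _ = Φ m * 0 * (Φ m)ᵀ := by
          rw [hθS, hSθ]
          congr 2
          module
        _ = 0 := by simp
  have hΦS' (m : R2) : S7 * Φ m = Φ m * S m := by
    rw [← hΦS m, mul_assoc _ _ (Φ m), hΦΦ', mul_one]
  have hSΦ (m : R2) : (Φ m)ᵀ * S7 = S m * (Φ m)ᵀ := by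
    rw [← hΦS m, ← mul_assoc, ← mul_assoc, hΦΦ', one_mul]
  refine ⟨fun m => (Φ m)ᵀ, fun i m => -(Φ m * θ i m * (Φ m)ᵀ), contDiff_matrix_transpose hΦ,
    fun m => transpose_mem_G2 (hΦG m), fun m => ?_, fun i => ?_, fun i m => ?_, fun i m => ?_,
    fun i m => ?_, fun m => ?_, fun m u hu => ?_⟩
  · rw [hφ]
    refine framePlane_eq_of_reflection_eq (hg m) (transpose_mem_G2 (hΦG m)) ?_
    rw [← hSg, reflection, Matrix.transpose_transpose, hSΦ, mul_assoc, hΦΦ', mul_one]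
  · exact contDiff_matrix_neg (contDiff_matrix_mul (contDiff_matrix_mul hΦ (hθs i))
      (contDiff_matrix_transpose hΦ))
  · rw [pd_transpose hΦd, hΦ', Matrix.transpose_mul, (hθg i m).1]
    calc -θ i m * (Φ m)ᵀ = -(((Φ m)ᵀ * Φ m) * θ i m * (Φ m)ᵀ) := by
          rw [hΦΦ', one_mul, Matrix.neg_mul]
      _ = _ := by noncomm_ring
  · exact neg_mem_g2 (conj_mem_g2' (hΦG m) (hθg i m))
  · calc S7 * -(Φ m * θ i m * (Φ m)ᵀ) = -(S7 * Φ m * θ i m * (Φ m)ᵀ) := by noncomm_ring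
      _ = -(Φ m * (S m * θ i m) * (Φ m)ᵀ) := by rw [hΦS']; noncomm_ring
      _ = Φ m * (θ i m * S m) * (Φ m)ᵀ := by
        rw [hθS, hSθ, neg_smul, Matrix.mul_neg, Matrix.neg_mul]
      _ = Φ m * θ i m * ((Φ m)ᵀ * S7) := by rw [hSΦ]; noncomm_ring
      _ = _ := by noncomm_ring
  · have e (X Y : Mat7) : -(Φ m * X * (Φ m)ᵀ) * -(Φ m * Y * (Φ m)ᵀ) = Φ m * (X * Y) * (Φ m)ᵀ := by
      calc -(Φ m * X * (Φ m)ᵀ) * -(Φ m * Y * (Φ m)ᵀ) =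
          Φ m * X * ((Φ m)ᵀ * Φ m) * Y * (Φ m)ᵀ := by noncomm_ring
        _ = _ := by rw [hΦΦ']; noncomm_ring
    have hc := hθc m
    rw [Ring.lie_def, sub_eq_zero] at hc
    rw [Ring.lie_def, e, e, hc, sub_self]
  · refine hn' m u ?_
    have e (X : Mat7) : S m * ((Φ m)ᵀ * -(Φ m * ((1 / 2 : ℝ) • (S m * X)) * (Φ m)ᵀ) * Φ m) =
        -(1 / 2 : ℝ) • X := by
      calc S m * ((Φ m)ᵀ * -(Φ m * ((1 / 2 : ℝ) • (S m * X)) * (Φ m)ᵀ) * Φ m) =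
          -(S m * (((Φ m)ᵀ * Φ m) * ((1 / 2 : ℝ) • (S m * X)) * ((Φ m)ᵀ * Φ m))) := by noncomm_ring
        _ = -((1 / 2 : ℝ) • (S m * S m * X)) := by
          rw [hΦΦ', one_mul, mul_one, Matrix.mul_smul, mul_assoc]
        _ = _ := by rw [hSS, one_mul, neg_smul]
    have h1 := congrArg (fun X => S m * ((Φ m)ᵀ * X * Φ m)) hu
    simp only [Matrix.mul_add, Matrix.add_mul, Matrix.mul_smul, Matrix.smul_mul, Matrix.mul_zero,
      Matrix.zero_mul] at h1
    have h2 (i : Fin 2) := e (pd i S m)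
    simp only [Matrix.mul_smul, Matrix.smul_mul] at h2
    simp only [θ, Matrix.mul_smul, Matrix.smul_mul, h2] at h1
    have h3 : u 0 • pd 0 S m + u 1 • pd 1 S m = (-2 : ℝ) • (u 0 • -(1 / 2 : ℝ) • pd 0 S m +
        u 1 • -(1 / 2 : ℝ) • pd 1 S m) := by module
    rw [h3, h1, smul_zero]

end ParallelFrame

/-! ### Algebra of commuting independent pairs in 𝔭 -/

section TorusPairs

open Matrix

theorem pMat_zero_right (h : Fin 2 → ℝ) : pMat h 0 = h 0 • b7 0 + h 1 • b7 1 := by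
  rw [b7_eq_pMat, b7_eq_pMat, ← pMat_smul, ← pMat_smul, ← pMat_add]
  congr 1
  · ext i; fin_cases i <;> simp
  · simp

/-- The values of the roots on the projection of a matrix to the span of `b₁, b₂`. -/
def rootOf : Mat7 →ₗ[ℝ] (Fin 6 → ℝ) where
  toFun X := hCoord X 0 • root 0 + hCoord X 1 • root 1
  map_add' X Y := by simp only [map_add, Pi.add_apply]; module
  map_smul' c X := by simp only [map_smul, Pi.smul_apply, smul_eq_mul, RingHom.id_apply]; module

theorem rootOf_b7 (j : Fin 2) : rootOf (b7 j) = root j := by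
  change hCoord (b7 j) 0 • root 0 + hCoord (b7 j) 1 • root 1 = _
  rw [b7_eq_pMat, hCoord_pMat]
  fin_cases j <;> simp

theorem eq_of_tCoord_eq_zero {X : Mat7} (hX : X ∈ g2) (hX' : S7 * X = -(X * S7))
    (ht : tCoord X = 0) : X = hCoord X 0 • b7 0 + hCoord X 1 • b7 1 := by
  conv_lhs => rw [eq_pMat hX hX', ht, pMat_zero_right]

theorem lie_pMat_of_tCoord {X : Mat7} (hX : X ∈ g2) (hX' : S7 * X = -(X * S7))
    (ht : tCoord X = 0) (h : Fin 2 → ℝ) (t : Fin 6 → ℝ) :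
    ⁅X, pMat h t⁆ = kMat (rootOf X * t) := by
  have : rootOf X * t = hCoord X 0 • (root 0 * t) + hCoord X 1 • (root 1 * t) := by
    change (hCoord X 0 • root 0 + hCoord X 1 • root 1) * t = _
    rw [add_mul, smul_mul_assoc, smul_mul_assoc]
  rw [this, kMat_add, kMat_smul, kMat_smul, ← lie_b7_pMat 0 h, ← lie_b7_pMat 1 h]
  conv_lhs => rw [eq_of_tCoord_eq_zero hX hX' ht]
  simp only [Ring.lie_def, Matrix.mul_add, Matrix.add_mul, Matrix.mul_smul, Matrix.smul_mul]
  module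

theorem lie_kMat_of_tCoord {X : Mat7} (hX : X ∈ g2) (hX' : S7 * X = -(X * S7))
    (ht : tCoord X = 0) (s : Fin 6 → ℝ) :
    ⁅X, kMat s⁆ = pMat 0 (-(rootOf X * s)) := by
  have : pMat 0 (-(rootOf X * s)) = pMat (hCoord X 0 • (0 : Fin 2 → ℝ) + hCoord X 1 • (0 : Fin 2 → ℝ))
      (hCoord X 0 • (-(root 0 * s)) + hCoord X 1 • (-(root 1 * s))) := by
    congr 1
    · simp
    · change -((hCoord X 0 • root 0 + hCoord X 1 • root 1) * s) = _
      rw [add_mul, smul_mul_assoc, smul_mul_assoc]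
      module
  rw [this, pMat_add, pMat_smul, pMat_smul, ← lie_b7_kMat, ← lie_b7_kMat]
  conv_lhs => rw [eq_of_tCoord_eq_zero hX hX' ht]
  simp only [Ring.lie_def, Matrix.mul_add, Matrix.add_mul, Matrix.mul_smul, Matrix.smul_mul]
  module

theorem lie_conj {k : Mat7} (hk : k ∈ K) (X Y : Mat7) :
    ⁅kᵀ * X * k, kᵀ * Y * k⁆ = kᵀ * ⁅X, Y⁆ * k := by
  have hkk : k * kᵀ = 1 := mul_transpose_self_of_mem_G2 hk.1
  have e (Y Y' : Mat7) : kᵀ * Y * k * (kᵀ * Y' * k) = kᵀ * (Y * Y') * k := by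
    calc kᵀ * Y * k * (kᵀ * Y' * k) = kᵀ * Y * (k * kᵀ) * Y' * k := by noncomm_ring
      _ = _ := by rw [hkk]; noncomm_ring
  rw [Ring.lie_def, Ring.lie_def, e, e]
  noncomm_ring

theorem conj_conj {k : Mat7} (hk : k ∈ K) (X : Mat7) : k * (kᵀ * X * k) * kᵀ = X := by
  have hkk : k * kᵀ = 1 := mul_transpose_self_of_mem_G2 hk.1
  calc k * (kᵀ * X * k) * kᵀ = k * kᵀ * X * (k * kᵀ) := by noncomm_ring
    _ = X := by rw [hkk, one_mul, mul_one]

theorem conj_conj' {k : Mat7} (hk : k ∈ K) (X : Mat7) : kᵀ * (k * X * kᵀ) * k = X := by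
  simpa using conj_conj (transpose_mem_K hk) X

theorem S7_mul_conj_odd {k X : Mat7} (hk : k ∈ K) (hX : S7 * X = -(X * S7)) :
    S7 * (kᵀ * X * k) = -(kᵀ * X * k * S7) :=
  S7_mul_mul_of_odd_even (S7_mul_mul_of_even_odd (transpose_mem_K hk).2 hX) hk.2

theorem S7_mul_conj_even {k X : Mat7} (hk : k ∈ K) (hX : S7 * X = X * S7) :
    S7 * (kᵀ * X * k) = kᵀ * X * k * S7 :=
  S7_mul_mul_of_even (S7_mul_mul_of_even (transpose_mem_K hk).2 hX) hk.2

/-- Commuting, linearly independent elements of `𝔭`. -/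
structure IsTorusPair (X : Fin 2 → Mat7) : Prop where
  mem_g2 : ∀ i, X i ∈ g2
  odd : ∀ i, S7 * X i = -(X i * S7)
  comm : ⁅X 0, X 1⁆ = 0
  independent : ∀ u : R2, u 0 • X 0 + u 1 • X 1 = 0 → u = 0

namespace IsTorusPair

variable {X : Fin 2 → Mat7}

theorem conj (h : IsTorusPair X) {k : Mat7} (hk : k ∈ K) :
    IsTorusPair fun i => kᵀ * X i * k where
  mem_g2 i := conj_mem_g2 hk.1 (h.mem_g2 i)
  odd i := S7_mul_conj_odd hk (h.odd i)
  comm := by rw [lie_conj hk, h.comm]; simp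
  independent u hu := by
    refine h.independent u ?_
    rw [← conj_conj hk (u 0 • X 0 + u 1 • X 1)]
    rw [Matrix.mul_add, Matrix.add_mul, Matrix.mul_smul, Matrix.mul_smul, Matrix.smul_mul,
      Matrix.smul_mul, hu]
    simp

/-- An independent pair in the two-dimensional span of `b₁, b₂` is a basis of it. -/
theorem exists_eq_of_tCoord (h : IsTorusPair X) (ht : ∀ i, tCoord (X i) = 0) (y : Fin 2 → ℝ) :
    ∃ u : R2, pMat y 0 = u 0 • X 0 + u 1 • X 1 := by
  let L : R2 →ₗ[ℝ] (Fin 2 → ℝ) :=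
    { toFun := fun u => hCoord (u 0 • X 0 + u 1 • X 1)
      map_add' := fun u w => by
        rw [← map_add]
        congr 1
        simp only [PiLp.add_apply]
        module
      map_smul' := fun c u => by
        rw [← map_smul]
        congr 1
        simp only [PiLp.smul_apply, smul_eq_mul, RingHom.id_apply]
        module }
  have hp (u : R2) : u 0 • X 0 + u 1 • X 1 = pMat (L u) 0 := by
    have h1 : tCoord (u 0 • X 0 + u 1 • X 1) = 0 := by
      rw [map_add, map_smul, map_smul, ht, ht]; simp
    conv_lhs => rw [eq_pMat (add_mem_g2 (smul_mem_g2 _ (h.mem_g2 0)) (smul_mem_g2 _ (h.mem_g2 1)))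
      (by simp only [Matrix.mul_add, Matrix.add_mul, Matrix.mul_smul, Matrix.smul_mul, h.odd,
            smul_neg, neg_add]), h1]
    rfl
  have hinj : Function.Injective L := by
    rw [injective_iff_map_eq_zero]
    intro u hu
    refine h.independent u ?_
    rw [hp, hu, pMat_zero_right]
    simp
  obtain ⟨u, hu⟩ := (LinearMap.injective_iff_surjective_of_finrank_eq_finrank (by simp)).1 hinj y
  exact ⟨u, by rw [hp, hu]⟩

theorem exists_b7_eq (h : IsTorusPair X) (ht : ∀ i, tCoord (X i) = 0) (j : Fin 2) :
    ∃ u : R2, b7 j = u 0 • X 0 + u 1 • X 1 := by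
  rw [b7_eq_pMat]
  exact h.exists_eq_of_tCoord ht _

theorem exists_normal_form (h : IsTorusPair X) :
    ∃ k ∈ K, IsTorusPair (fun i => kᵀ * X i * k) ∧ ∀ i, tCoord (kᵀ * X i * k) = 0 := by
  obtain ⟨k, hk, ht⟩ := exists_conj_tCoord_eq_zero h.mem_g2 h.odd h.comm
  exact ⟨k, hk, h.conj hk, ht⟩

theorem lie_b7_eq_zero (h : IsTorusPair X) (ht : ∀ i, tCoord (X i) = 0) {Y : Mat7}
    (hY : ∀ i, ⁅X i, Y⁆ = 0) (j : Fin 2) : ⁅b7 j, Y⁆ = 0 := by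
  obtain ⟨u, hu⟩ := h.exists_b7_eq ht j
  have : ⁅b7 j, Y⁆ = u 0 • ⁅X 0, Y⁆ + u 1 • ⁅X 1, Y⁆ := by
    rw [hu]
    simp only [Ring.lie_def, Matrix.mul_add, Matrix.add_mul, Matrix.mul_smul, Matrix.smul_mul]
    module
  rw [this, hY, hY]
  simp

/-- After conjugation to normal form the element commutes with `b₁, b₂`, and no root vanishes on
both of them. -/
theorem eq_zero_of_even (h : IsTorusPair X) {N : Mat7} (hN : N ∈ g2) (hN' : S7 * N = N * S7)
    (hc : ∀ i, ⁅X i, N⁆ = 0) : N = 0 := by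
  obtain ⟨k, hk, h', ht⟩ := h.exists_normal_form
  have h0 : kᵀ * N * k = 0 := by
    refine eq_zero_of_tCoord_lie (conj_mem_g2 hk.1 hN) (S7_mul_conj_even hk hN') fun j => ?_
    rw [h'.lie_b7_eq_zero ht (fun i => ?_) j, map_zero]
    rw [lie_conj hk, hc]
    simp
  rw [← conj_conj hk N, h0]
  simp

/-- Maximality of the abelian subspace: in normal form all root components of a commuting odd
element vanish. -/
theorem exists_eq_of_odd (h : IsTorusPair X) {Y : Mat7} (hY : Y ∈ g2) (hY' : S7 * Y = -(Y * S7))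
    (hc : ∀ i, ⁅X i, Y⁆ = 0) : ∃ u : R2, Y = u 0 • X 0 + u 1 • X 1 := by
  obtain ⟨k, hk, h', ht⟩ := h.exists_normal_form
  have hp := eq_pMat (conj_mem_g2 hk.1 hY) (S7_mul_conj_odd hk hY')
  have h0 : tCoord (kᵀ * Y * k) = 0 := by
    have hb (j : Fin 2) : root j * tCoord (kᵀ * Y * k) = 0 := by
      rw [← kCoord_kMat (root j * _), ← lie_b7_pMat j (hCoord (kᵀ * Y * k)), ← hp,
        h'.lie_b7_eq_zero ht (fun i => ?_) j, map_zero]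
      rw [lie_conj hk, hc]
      simp
    funext r
    have h1 := congrFun (hb 0) r
    have h2 := congrFun (hb 1) r
    fin_cases r <;> simp [root] at h1 h2 ⊢ <;> assumption
  obtain ⟨u, hu⟩ := h'.exists_eq_of_tCoord ht (hCoord (kᵀ * Y * k))
  refine ⟨u, ?_⟩
  rw [h0, hu] at hp
  rw [← conj_conj hk Y, hp, Matrix.mul_add, Matrix.add_mul, Matrix.mul_smul, Matrix.mul_smul,
    Matrix.smul_mul, Matrix.smul_mul, conj_conj hk, conj_conj hk]

theorem rootOf_ne_zero (h : IsTorusPair X) (ht : ∀ i, tCoord (X i) = 0) (r : Fin 6) :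
    rootOf (X 0) r ^ 2 + rootOf (X 1) r ^ 2 ≠ 0 := by
  intro hr
  have h0 : rootOf (X 0) r = 0 := by nlinarith [sq_nonneg (rootOf (X 0) r), sq_nonneg (rootOf (X 1) r)]
  have h1 : rootOf (X 1) r = 0 := by nlinarith [sq_nonneg (rootOf (X 0) r), sq_nonneg (rootOf (X 1) r)]
  have hb (j : Fin 2) : root j r = 0 := by
    obtain ⟨u, hu⟩ := h.exists_b7_eq ht j
    rw [← rootOf_b7, hu, map_add, map_smul, map_smul]
    simp [h0, h1]
  have h2 := hb 0
  have h3 := hb 1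
  fin_cases r <;> simp [root] at h2 h3

end IsTorusPair

/-- Under the symmetry condition `(s, t)` is a multiple of `(p, q)`. The factor is given by
orthogonal projection, hence depends smoothly on the data without division by `p` or `q` alone. -/
theorem eq_mul_div_of_symm {p q s t : ℝ} (h : p ^ 2 + q ^ 2 ≠ 0) (hs : p * t = q * s) :
    s = p * ((p * s + q * t) / (p ^ 2 + q ^ 2)) ∧ t = q * ((p * s + q * t) / (p ^ 2 + q ^ 2)) := by
  constructor
  · field_simp
    linear_combination (-q) * hs
  · field_simp
    linear_combination p * hs

/-- A variation of a torus pair through torus pairs is, up to the torus, a variation by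
conjugation. -/
theorem IsTorusPair.exists_infinitesimal_conj {X : Fin 2 → Mat7} (h : IsTorusPair X)
    {P : Fin 2 → Mat7} (hP : ∀ i, P i ∈ g2) (hP' : ∀ i, S7 * P i = -(P i * S7))
    (hs : ⁅X 0, P 1⁆ = ⁅X 1, P 0⁆) :
    ∃ N ∈ g2, S7 * N = N * S7 ∧ ∀ v w, ⁅X v, P w + ⁅X w, N⁆⁆ = 0 := by
  obtain ⟨k, hk, h', ht⟩ := h.exists_normal_form
  set X' : Fin 2 → Mat7 := fun i => kᵀ * X i * k with hX'
  let P' : Fin 2 → Mat7 := fun i => kᵀ * P i * k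
  have hPp (w : Fin 2) : P' w = pMat (hCoord (P' w)) (tCoord (P' w)) :=
    eq_pMat (conj_mem_g2 hk.1 (hP w)) (S7_mul_conj_odd hk (hP' w))
  have hXP (v w : Fin 2) : ⁅X' v, P' w⁆ = kMat (rootOf (X' v) * tCoord (P' w)) := by
    conv_lhs => rw [hPp w, lie_pMat_of_tCoord (h'.mem_g2 v) (h'.odd v) (ht v)]
  -- In root coordinates the linearized commutation relation is the symmetry condition of
  -- `eq_mul_div_of_symm`, one equation for each root.
  have hsym : rootOf (X' 0) * tCoord (P' 1) = rootOf (X' 1) * tCoord (P' 0) := by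
    rw [← kCoord_kMat (rootOf (X' 0) * _), ← kCoord_kMat (rootOf (X' 1) * _), ← hXP, ← hXP]
    simp only [hX', P']
    rw [lie_conj hk, lie_conj hk, hs]
  let s : Fin 6 → ℝ := fun r => (rootOf (X' 0) r * tCoord (P' 0) r + rootOf (X' 1) r * tCoord (P' 1) r) /
    (rootOf (X' 0) r ^ 2 + rootOf (X' 1) r ^ 2)
  have hsw (w : Fin 2) : rootOf (X' w) * s = tCoord (P' w) := by
    funext r
    have := eq_mul_div_of_symm (h'.rootOf_ne_zero ht r) (congrFun hsym r)
    fin_cases w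
    · exact this.1.symm
    · exact this.2.symm
  refine ⟨k * kMat s * kᵀ, conj_mem_g2' hk.1 (kMat_mem_g2 s), ?_, fun v w => ?_⟩
  · exact S7_mul_mul_of_even (S7_mul_mul_of_even hk.2 (S7_mul_kMat s)) (transpose_mem_K hk).2
  · rw [← conj_conj hk ⁅X v, P w + ⁅X w, k * kMat s * kᵀ⁆⁆, ← lie_conj hk, Matrix.mul_add,
      Matrix.add_mul, ← lie_conj hk, conj_conj' hk]
    change k * ⁅X' v, P' w + ⁅X' w, kMat s⁆⁆ * kᵀ = 0
    rw [lie_kMat_of_tCoord (h'.mem_g2 w) (h'.odd w) (ht w), hsw, hPp w, ← pMat_add, tCoord_pMat,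
      add_neg_cancel, lie_pMat_of_tCoord (h'.mem_g2 v) (h'.odd v) (ht v), mul_zero, kMat_zero]
    simp

end TorusPairs

/-! ### A connection preserving a moving torus -/

section Gauge

open Matrix

theorem pd_mem_g2 {A : R2 → Mat7} (hA : Differentiable ℝ A) (hg : ∀ m, A m ∈ g2) (i : Fin 2)
    (m : R2) : pd i A m ∈ g2 := by
  refine ⟨?_, fun u v => ?_⟩
  · rw [← pd_transpose hA]
    simp only [fun p => (hg p).1]
    have : pd i (fun p => (-1 : ℝ) • A p) m = (-1 : ℝ) • pd i A m := pd_matrix_const_smul _ hA i m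
    simpa using this
  · have ha (u : R7) : Differentiable ℝ fun p => act (A p) u :=
      differentiable_act hA (differentiable_const u)
    have hda (u : R7) : pd i (fun p => act (A p) u) m = act (pd i A m) u := by
      rw [pd_act hA (differentiable_const u), pd_const, act_zero_right, add_zero]
    have h : pd i (fun p => act (A p) (cross u v)) m =
        pd i (fun p => crossL (act (A p) u) v + crossL u (act (A p) v)) m := by
      congr 1
      funext p
      exact (hg p).2 u v
    have h1 : Differentiable ℝ fun p => crossL (act (A p) u) v := fun p =>
      (crossL.differentiable.comp (ha u) p).clm_apply (differentiableAt_const v)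
    have h2 : Differentiable ℝ fun p => crossL u (act (A p) v) :=
      (crossL u).differentiable.comp (ha v)
    rw [hda, pd_add h1 h2, pd_clm (crossL u) (ha v),
      pd_bilin crossL (ha u) (differentiable_const v), pd_const, hda, hda, map_zero, add_zero] at h
    exact h

theorem S7_mul_pd_odd {A : R2 → Mat7} (hA : Differentiable ℝ A)
    (h : ∀ m, S7 * A m = -(A m * S7)) (i : Fin 2) (m : R2) :
    S7 * pd i A m = -(pd i A m * S7) := by
  have hS := differentiable_matrix_mul hA (differentiable_const S7)
  have h1 : pd i (fun p => S7 * A p) m = pd i (fun p => (-1 : ℝ) • (A p * S7)) m := by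
    congr 1
    funext p
    rw [h, neg_one_smul]
  rwa [pd_const_mul _ hA, pd_matrix_const_smul _ hS, pd_mul_const hA, neg_one_smul] at h1

theorem trace_mul_self_nonpos {M : Mat7} (hM : Mᵀ = -M) : (M * M).trace ≤ 0 := by
  have h := (Matrix.posSemidef_conjTranspose_mul_self M).trace_nonneg
  rw [Matrix.conjTranspose_eq_transpose_of_trivial, hM, Matrix.neg_mul, Matrix.trace_neg] at h
  linarith

/-- Invariance of the trace form: `ad X` is skew for it. -/
theorem trace_mul_lie_lie (X N : Mat7) : (N * ⁅X, ⁅X, N⁆⁆).trace = -(⁅X, N⁆ * ⁅X, N⁆).trace := by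
  set M := ⁅X, N⁆ with hM
  rw [Ring.lie_def, Matrix.mul_sub, Matrix.trace_sub, ← mul_assoc, ← mul_assoc,
    Matrix.trace_mul_comm (N * M), ← mul_assoc, ← Matrix.trace_sub, ← Matrix.sub_mul,
    ← Matrix.trace_neg, ← Matrix.neg_mul]
  congr 2
  rw [hM, Ring.lie_def]
  abel

/-- Paired with `N`, the equation says that two nonpositive numbers `tr [Xᵢ, N]²` have sum zero.
Both vanish, so `N` centralizes the torus. -/
theorem IsTorusPair.eq_zero_of_lie_lie {X : Fin 2 → Mat7} (h : IsTorusPair X) {N : Mat7}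
    (hN : N ∈ g2) (hN' : S7 * N = N * S7) (hc : ⁅X 0, ⁅X 0, N⁆⁆ + ⁅X 1, ⁅X 1, N⁆⁆ = 0) : N = 0 := by
  have hg (i : Fin 2) : ⁅X i, N⁆ ∈ g2 := lie_mem_g2 (h.mem_g2 i) hN
  have h1 := congrArg (fun Z => (N * Z).trace) hc
  simp only [Matrix.mul_add, Matrix.trace_add, trace_mul_lie_lie, Matrix.mul_zero,
    Matrix.trace_zero] at h1
  have h2 := trace_mul_self_nonpos (hg 0).1
  have h3 := trace_mul_self_nonpos (hg 1).1
  refine h.eq_zero_of_even hN hN' fun i => eq_zero_of_trace_mul_self (hg i).1 ?_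
  fin_cases i
  · change (⁅X 0, N⁆ * ⁅X 0, N⁆).trace = 0
    linarith
  · change (⁅X 1, N⁆ * ⁅X 1, N⁆).trace = 0
    linarith

/-- `kMat` as a linear map. -/
def kMatₗ : (Fin 6 → ℝ) →ₗ[ℝ] Mat7 where
  toFun := kMat
  map_add' := kMat_add
  map_smul' := kMat_smul

/-- The operator `∑ᵢ ad(Xᵢ)²` on the isotropy algebra. -/
def adSq (X : Fin 2 → Mat7) : (Fin 6 → ℝ) →ₗ[ℝ] (Fin 6 → ℝ) where
  toFun s := kCoord (⁅X 0, ⁅X 0, kMat s⁆⁆ + ⁅X 1, ⁅X 1, kMat s⁆⁆)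
  map_add' s s' := by
    rw [← map_add, kMat_add]
    congr 1
    simp only [Ring.lie_def]
    noncomm_ring
  map_smul' c s := by
    rw [← map_smul, kMat_smul]
    congr 1
    simp only [Ring.lie_def, Matrix.mul_smul, Matrix.smul_mul, Matrix.mul_sub, Matrix.sub_mul,
      RingHom.id_apply]
    module

theorem IsTorusPair.injective_adSq {X : Fin 2 → Mat7} (h : IsTorusPair X) :
    Function.Injective (adSq X) := by
  rw [injective_iff_map_eq_zero]
  intro s hs
  have hg (i : Fin 2) : ⁅X i, ⁅X i, kMat s⁆⁆ ∈ g2 :=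
    lie_mem_g2 (h.mem_g2 i) (lie_mem_g2 (h.mem_g2 i) (kMat_mem_g2 s))
  have he (i : Fin 2) : S7 * ⁅X i, ⁅X i, kMat s⁆⁆ = ⁅X i, ⁅X i, kMat s⁆⁆ * S7 :=
    S7_mul_lie_of_odd (h.odd i) (S7_mul_lie_of_odd_even (h.odd i) (S7_mul_kMat s))
  rw [← kCoord_kMat s, h.eq_zero_of_lie_lie (kMat_mem_g2 s) (S7_mul_kMat s), map_zero]
  rw [eq_kMat (add_mem_g2 (hg 0) (hg 1)) (by rw [Matrix.mul_add, Matrix.add_mul, he, he])]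
  change kMat (adSq X s) = 0
  rw [hs, kMat_zero]

theorem contDiff_kMat {s : R2 → Fin 6 → ℝ} (hs : ContDiff ℝ ∞ s) :
    ContDiff ℝ ∞ fun p => kMat (s p) :=
  (LinearMap.toContinuousLinearMap kMatₗ).contDiff.comp hs

theorem contDiff_kCoord {A : R2 → Mat7} (hA : ContDiff ℝ ∞ A) :
    ContDiff ℝ ∞ fun p => kCoord (A p) :=
  (LinearMap.toContinuousLinearMap kCoord).contDiff.comp hA

/-- A smooth family of torus pairs has a connection that preserves the tori. -/
theorem exists_torus_connection {β : Fin 2 → R2 → Mat7} (hβ : ∀ i, ContDiff ℝ ∞ (β i))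
    (h : ∀ m, IsTorusPair fun i => β i m) :
    ∃ η : Fin 2 → R2 → Mat7, (∀ i, ContDiff ℝ ∞ (η i)) ∧ (∀ i m, η i m ∈ g2) ∧
      (∀ i m, S7 * η i m = η i m * S7) ∧
      ∀ i v w m, ⁅β v m, pd i (β w) m + ⁅β w m, η i m⁆⁆ = 0 := by
  have hd (i : Fin 2) := differentiable_infty (hβ i)
  -- The pointwise solution `N` below is found through a normal form that need not depend smoothly
  -- on the point. It is also the unique solution of `T N = -q`, and the inverse of the smooth
  -- invertible family `T` is smooth.
  let T : R2 → (Fin 6 → ℝ) →L[ℝ] (Fin 6 → ℝ) := fun m =>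
    LinearMap.toContinuousLinearMap (adSq fun i => β i m)
  have hT : ContDiff ℝ ∞ T := by
    rw [contDiff_clm_apply_iff]
    intro s
    have hl (i : Fin 2) : ContDiff ℝ ∞ fun m => ⁅β i m, ⁅β i m, kMat s⁆⁆ :=
      contDiff_matrix_lie (hβ i) (contDiff_matrix_lie (hβ i) contDiff_const)
    exact contDiff_kCoord (contDiff_matrix_add (hl 0) (hl 1))
  have hTe (m : R2) : ∃ e : (Fin 6 → ℝ) ≃L[ℝ] (Fin 6 → ℝ), T m = e := by
    refine ⟨(LinearEquiv.ofInjectiveEndo _ (h m).injective_adSq).toContinuousLinearEquiv, ?_⟩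
    ext s
    rfl
  have hTi : ContDiff ℝ ∞ fun m => ContinuousLinearMap.inverse (T m) := by
    rw [contDiff_iff_contDiffAt]
    intro m
    obtain ⟨e, he⟩ := hTe m
    have := contDiffAt_map_inverse (𝕜 := ℝ) (n := ∞) e
    rw [← he] at this
    exact this.comp m hT.contDiffAt
  let q : Fin 2 → R2 → Mat7 := fun i m => ⁅β 0 m, pd i (β 0) m⁆ + ⁅β 1 m, pd i (β 1) m⁆
  have hq (i : Fin 2) : ContDiff ℝ ∞ (q i) :=
    contDiff_matrix_add (contDiff_matrix_lie (hβ 0) (contDiff_pd (hβ 0) i))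
      (contDiff_matrix_lie (hβ 1) (contDiff_pd (hβ 1) i))
  let s : Fin 2 → R2 → Fin 6 → ℝ := fun i m => ContinuousLinearMap.inverse (T m) (-kCoord (q i m))
  have hs (i : Fin 2) : ContDiff ℝ ∞ (s i) := hTi.clm_apply (contDiff_kCoord (hq i)).neg
  refine ⟨fun i m => kMat (s i m), fun i => contDiff_kMat (hs i), fun i m => kMat_mem_g2 _,
    fun i m => S7_mul_kMat _, fun i v w m => ?_⟩
  have hsym : ⁅β 0 m, pd i (β 1) m⁆ = ⁅β 1 m, pd i (β 0) m⁆ := by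
    have h1 : pd i (fun p => ⁅β 0 p, β 1 p⁆) m = 0 := by
      have : (fun p => ⁅β 0 p, β 1 p⁆) = fun _ => 0 := funext fun p => (h p).comm
      rw [this]
      exact pd_matrix_const _ _ _
    rw [pd_lie (hd 0) (hd 1)] at h1
    rw [eq_neg_of_add_eq_zero_right h1]
    simp only [Ring.lie_def]
    abel
  obtain ⟨N, hN, hN', hc⟩ := (h m).exists_infinitesimal_conj (P := fun w => pd i (β w) m)
    (fun w => pd_mem_g2 (hd w) (fun m => (h m).mem_g2 w) i m)
    (fun w => S7_mul_pd_odd (hd w) (fun m => (h m).odd w) i m) hsym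
  have hNs : kMat (s i m) = N := by
    rw [eq_kMat hN hN']
    congr 1
    obtain ⟨e, he⟩ := hTe m
    -- Sum of the defining relations of `N` for `v = w = 0` and `v = w = 1`.
    have h1 : T m (kCoord N) = -kCoord (q i m) := by
      change kCoord (⁅β 0 m, ⁅β 0 m, kMat (kCoord N)⁆⁆ + ⁅β 1 m, ⁅β 1 m, kMat (kCoord N)⁆⁆) = _
      rw [← eq_kMat hN hN', ← map_neg]
      congr 1
      rw [eq_neg_iff_add_eq_zero, ← add_zero (0 : Mat7)]
      nth_rewrite 1 [← hc 0 0]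
      rw [← hc 1 1]
      simp only [q, Ring.lie_def]
      noncomm_ring
    simp only [s]
    rw [← h1, he, ContinuousLinearMap.inverse_equiv]
    simp
  change ⁅β v m, pd i (β w) m + ⁅β w m, kMat (s i m)⁆⁆ = 0
  rw [hNs]
  exact hc v w

end Gauge

/-! ### Flatness of the torus connection and the smooth gauge -/

section TorusGauge

open Matrix

variable {β η : Fin 2 → R2 → Mat7}

/-- The covariant derivatives of a family of torus pairs. -/
def torusDeriv (β η : Fin 2 → R2 → Mat7) (i w : Fin 2) (m : R2) : Mat7 :=
  pd i (β w) m + ⁅β w m, η i m⁆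

theorem contDiff_torusDeriv (hβ : ∀ i, ContDiff ℝ ∞ (β i)) (hη : ∀ i, ContDiff ℝ ∞ (η i))
    (i w : Fin 2) : ContDiff ℝ ∞ (torusDeriv β η i w) :=
  contDiff_matrix_add (contDiff_pd (hβ w) i) (contDiff_matrix_lie (hβ w) (hη i))

/-- The covariant derivative is odd and commutes with the torus, so it lies in the torus by
maximality. -/
theorem exists_torusDeriv_eq (hβ : ∀ i, ContDiff ℝ ∞ (β i)) (h : ∀ m, IsTorusPair fun i => β i m)
    (hg : ∀ i m, η i m ∈ g2) (he : ∀ i m, S7 * η i m = η i m * S7)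
    (hc : ∀ i v w m, ⁅β v m, torusDeriv β η i w m⁆ = 0) (i w : Fin 2) (m : R2) :
    ∃ u : R2, torusDeriv β η i w m = u 0 • β 0 m + u 1 • β 1 m := by
  have hd (i : Fin 2) := differentiable_infty (hβ i)
  refine (h m).exists_eq_of_odd ?_ ?_ fun v => hc i v w m
  · exact add_mem_g2 (pd_mem_g2 (hd w) (fun m => (h m).mem_g2 w) i m)
      (lie_mem_g2 ((h m).mem_g2 w) (hg i m))
  · rw [torusDeriv, Matrix.mul_add, Matrix.add_mul, S7_mul_pd_odd (hd w) (fun m => (h m).odd w),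
      S7_mul_lie_of_odd_even ((h m).odd w) (he i m)]
    abel

/-- The connection that preserves the tori is flat. -/
theorem isFlatPair_torus_connection (hβ : ∀ i, ContDiff ℝ ∞ (β i))
    (h : ∀ m, IsTorusPair fun i => β i m) (hη : ∀ i, ContDiff ℝ ∞ (η i))
    (hg : ∀ i m, η i m ∈ g2) (he : ∀ i m, S7 * η i m = η i m * S7)
    (hc : ∀ i v w m, ⁅β v m, torusDeriv β η i w m⁆ = 0) : IsFlatPair fun i m => -η i m := by
  intro m
  have hd (i : Fin 2) := differentiable_infty (hβ i)
  have hηd (i : Fin 2) := differentiable_infty (hη i)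
  have hDd (i w : Fin 2) := differentiable_infty (contDiff_torusDeriv hβ hη i w)
  have hDD (i v j w : Fin 2) : ⁅torusDeriv β η i v m, torusDeriv β η j w m⁆ = 0 := by
    obtain ⟨u, hu⟩ := exists_torusDeriv_eq hβ h hg he hc i v m
    have : ⁅torusDeriv β η i v m, torusDeriv β η j w m⁆ =
        u 0 • ⁅β 0 m, torusDeriv β η j w m⁆ + u 1 • ⁅β 1 m, torusDeriv β η j w m⁆ := by
      rw [hu]
      simp only [Ring.lie_def, Matrix.mul_add, Matrix.add_mul, Matrix.mul_smul, Matrix.smul_mul]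
      module
    rw [this, hc, hc]
    simp
  -- Covariant differentiation of the relation `[β v, D i w] = 0`: the term with the derivative of
  -- `β v` drops out because all covariant derivatives lie in the abelian torus.
  have hY (j i v w : Fin 2) : ⁅β v m, pd j (torusDeriv β η i w) m -
      ⁅η j m, torusDeriv β η i w m⁆⁆ = 0 := by
    have h1 : pd j (fun p => ⁅β v p, torusDeriv β η i w p⁆) m = 0 := by
      simp only [hc]
      exact pd_matrix_const _ _ _
    rw [pd_lie (hd v) (hDd i w)] at h1
    have h2 : pd j (β v) m = torusDeriv β η j v m - ⁅β v m, η j m⁆ := by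
      rw [torusDeriv]; abel
    rw [h2] at h1
    have h3 := hDD j v i w
    have h4 := hc i v w m
    have e : ⁅β v m, pd j (torusDeriv β η i w) m - ⁅η j m, torusDeriv β η i w m⁆⁆ =
        (⁅torusDeriv β η j v m - ⁅β v m, η j m⁆, torusDeriv β η i w m⁆ +
          ⁅β v m, pd j (torusDeriv β η i w) m⁆) - ⁅torusDeriv β η j v m, torusDeriv β η i w m⁆ -
        ⁅η j m, ⁅β v m, torusDeriv β η i w m⁆⁆ := by
      simp only [Ring.lie_def]
      noncomm_ring
    rw [e, h1, h3, h4]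
    simp [Ring.lie_def]
  set C := pd 0 (η 1) m - pd 1 (η 0) m - ⁅η 0 m, η 1 m⁆ with hC
  have hpD (j i w : Fin 2) : pd j (torusDeriv β η i w) m = pd j (pd i (β w)) m +
      (⁅pd j (β w) m, η i m⁆ + ⁅β w m, pd j (η i) m⁆) := by
    have : torusDeriv β η i w = fun p => pd i (β w) p + ⁅β w p, η i p⁆ := rfl
    rw [this, pd_matrix_add (differentiable_infty (contDiff_pd (hβ w) i))
      (differentiable_infty (contDiff_matrix_lie (hβ w) (hη i))), pd_lie (hd w) (hηd i)]
  -- By the Ricci identity `[β w, C]` is the commutator of two second covariant derivatives, each of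
  -- which commutes with the torus.
  have hCC (v w : Fin 2) : ⁅β v m, ⁅β w m, C⁆⁆ = 0 := by
    have e : ⁅β w m, C⁆ =
        (pd 0 (torusDeriv β η 1 w) m - ⁅η 0 m, torusDeriv β η 1 w m⁆) -
        (pd 1 (torusDeriv β η 0 w) m - ⁅η 1 m, torusDeriv β η 0 w m⁆) := by
      rw [hpD, hpD, pd_comm (hβ w) 0 1, torusDeriv, torusDeriv, hC]
      simp only [Ring.lie_def]
      noncomm_ring
    have e2 (A B : Mat7) : ⁅β v m, A - B⁆ = ⁅β v m, A⁆ - ⁅β v m, B⁆ := by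
      simp only [Ring.lie_def]
      noncomm_ring
    rw [e, e2, hY, hY, sub_zero]
  have hηe (i j : Fin 2) : S7 * pd i (η j) m = pd i (η j) m * S7 := by
    rw [← pd_const_mul _ (hηd j), ← pd_mul_const (hηd j)]
    simp only [he]
  have hC0 : C = 0 := by
    refine (h m).eq_zero_of_lie_lie ?_ ?_ ?_
    · exact sub_mem_g2 (sub_mem_g2 (pd_mem_g2 (hηd 1) (hg 1) 0 m) (pd_mem_g2 (hηd 0) (hg 0) 1 m))
        (lie_mem_g2 (hg 0 m) (hg 1 m))
    · rw [hC, Matrix.mul_sub, Matrix.mul_sub, Matrix.sub_mul, Matrix.sub_mul, hηe, hηe,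
        S7_mul_lie_of_even (he 0 m) (he 1 m)]
    · rw [hCC, hCC, add_zero]
  have hneg (i j : Fin 2) : pd i (fun p => -η j p) m = -pd i (η j) m := by
    have : pd i (fun p => (-1 : ℝ) • η j p) m = (-1 : ℝ) • pd i (η j) m :=
      pd_matrix_const_smul _ (hηd j) i m
    simpa using this
  rw [hneg, hneg, neg_lie_neg', ← neg_eq_zero, ← hC0, hC]
  abel

/-- The Gram determinant of a torus pair. -/
def gram (X : Fin 2 → Mat7) : ℝ :=
  (X 0 * X 0).trace * (X 1 * X 1).trace - (X 0 * X 1).trace * (X 0 * X 1).trace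

/-- The equality case of Cauchy–Schwarz: if the Gram determinant vanishes, so does the norm of
`⟨X₁,X₁⟩X₀ - ⟨X₀,X₁⟩X₁`, which contradicts independence. -/
theorem IsTorusPair.gram_ne_zero {X : Fin 2 → Mat7} (h : IsTorusPair X) : gram X ≠ 0 := by
  intro hz
  have hz' : (X 0 * X 0).trace * (X 1 * X 1).trace - (X 0 * X 1).trace * (X 0 * X 1).trace = 0 := hz
  have hc : (X 1 * X 0).trace = (X 0 * X 1).trace := Matrix.trace_mul_comm _ _
  have h1 : (X 1 * X 1).trace • X 0 + (-(X 0 * X 1).trace) • X 1 = 0 := by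
    refine eq_zero_of_trace_mul_self
      (add_mem_g2 (smul_mem_g2 _ (h.mem_g2 0)) (smul_mem_g2 _ (h.mem_g2 1))).1 ?_
    simp only [Matrix.mul_add, Matrix.add_mul, Matrix.mul_smul, Matrix.smul_mul, Matrix.trace_add,
      Matrix.trace_smul, smul_eq_mul, hc]
    linear_combination (X 1 * X 1).trace * hz'
  have h2 := h.independent !₂[(X 1 * X 1).trace, -(X 0 * X 1).trace] (by simpa using h1)
  have h3 : (X 1 * X 1).trace = 0 := by simpa using congrArg (fun w : R2 => w 0) h2
  have h4 := eq_zero_of_trace_mul_self (h.mem_g2 1).1 h3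
  have h5 := h.independent !₂[0, 1] (by simpa using h4)
  simpa using congrArg (fun w : R2 => w 1) h5

/-- The coefficients of a linear combination of a torus pair. -/
def torusCoeff (X : Fin 2 → Mat7) (Y : Mat7) (v : Fin 2) : ℝ :=
  (![(X 1 * X 1).trace * (X 0 * Y).trace - (X 0 * X 1).trace * (X 1 * Y).trace,
    (X 0 * X 0).trace * (X 1 * Y).trace - (X 0 * X 1).trace * (X 0 * Y).trace] v) / gram X

/-- Cramer's rule for the Gram matrix. Explicit coefficients are needed so that they depend
continuously on the point. -/
theorem IsTorusPair.eq_torusCoeff {X : Fin 2 → Mat7} (h : IsTorusPair X) {Y : Mat7}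
    (hY : ∃ u : R2, Y = u 0 • X 0 + u 1 • X 1) :
    Y = torusCoeff X Y 0 • X 0 + torusCoeff X Y 1 • X 1 := by
  obtain ⟨u, hu⟩ := hY
  have hg := h.gram_ne_zero
  have hc : (X 1 * X 0).trace = (X 0 * X 1).trace := Matrix.trace_mul_comm _ _
  have h0 (i : Fin 2) : (X i * Y).trace = u 0 * (X i * X 0).trace + u 1 * (X i * X 1).trace := by
    simp only [hu, Matrix.mul_add, Matrix.mul_smul, Matrix.trace_add, Matrix.trace_smul, smul_eq_mul]
  have e0 : torusCoeff X Y 0 = u 0 := by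
    rw [torusCoeff, div_eq_iff hg, gram]
    simp only [Matrix.cons_val_zero, h0, hc]
    ring
  have e1 : torusCoeff X Y 1 = u 1 := by
    rw [torusCoeff, div_eq_iff hg, gram]
    simp only [Matrix.cons_val_one, Matrix.cons_val_fin_one, h0, hc]
    ring
  rw [e0, e1, hu]

theorem contDiff_trace_mul {A B : R2 → Mat7} (hA : ContDiff ℝ ∞ A) (hB : ContDiff ℝ ∞ B) :
    ContDiff ℝ ∞ fun p => (A p * B p).trace :=
  traceL.contDiff.comp (contDiff_matrix_mul hA hB)

theorem contDiff_torusCoeff (hβ : ∀ i, ContDiff ℝ ∞ (β i)) (h : ∀ m, IsTorusPair fun i => β i m)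
    {Y : R2 → Mat7} (hY : ContDiff ℝ ∞ Y) (v : Fin 2) :
    ContDiff ℝ ∞ fun m => torusCoeff (fun i => β i m) (Y m) v := by
  have hb (i j : Fin 2) := contDiff_trace_mul (hβ i) (hβ j)
  have hy (i : Fin 2) := contDiff_trace_mul (hβ i) hY
  have hgr : ContDiff ℝ ∞ fun m => gram fun i => β i m :=
    ((hb 0 0).mul (hb 1 1)).sub ((hb 0 1).mul (hb 0 1))
  refine ContDiff.div ?_ hgr fun m => (h m).gram_ne_zero
  fin_cases v
  · exact ((hb 1 1).mul (hy 0)).sub ((hb 0 1).mul (hy 1))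
  · exact ((hb 0 0).mul (hy 1)).sub ((hb 0 1).mul (hy 0))

/-- A smooth family of torus pairs can be conjugated smoothly into the span of `b₁, b₂`. -/
theorem exists_torus_gauge (hβ : ∀ i, ContDiff ℝ ∞ (β i)) (h : ∀ m, IsTorusPair fun i => β i m) :
    ∃ (Ψ : R2 → Mat7) (η : Fin 2 → R2 → Mat7), ContDiff ℝ ∞ Ψ ∧ (∀ m, Ψ m ∈ K) ∧
      (∀ i, ContDiff ℝ ∞ (η i)) ∧ (∀ i m, η i m ∈ g2) ∧ (∀ i m, S7 * η i m = η i m * S7) ∧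
      (∀ i m, pd i Ψ m = -(Ψ m * η i m)) ∧ ∀ w m, tCoord (Ψ m * β w m * (Ψ m)ᵀ) = 0 := by
  obtain ⟨η, hη, hg, he, hc⟩ := exists_torus_connection hβ h
  have hflat := isFlatPair_torus_connection hβ h hη hg he hc
  obtain ⟨k, hk, -, ht0⟩ := (h 0).exists_normal_form
  obtain ⟨Ψ, hΨ, hΨ0, hΨG, hΨ'⟩ := exists_G2_frame_of_isFlatPair (A := fun i m => -η i m)
    (fun i => contDiff_matrix_neg (hη i)) hflat (fun i m => neg_mem_g2 (hg i m))
    (transpose_mem_G2 hk.1)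
  have hd (i : Fin 2) := differentiable_infty (hβ i)
  have hΨd := differentiable_infty hΨ
  have hΨT := differentiable_matrix_transpose hΨd
  have hpd (i : Fin 2) (m : R2) : pd i Ψ m = -(Ψ m * η i m) := by rw [hΨ', Matrix.mul_neg]
  -- The commutator of `Ψ` with `S7` solves the frame equation of `-η`, since `η` is even, and it
  -- vanishes at the origin.
  have hΨK (m : R2) : S7 * Ψ m = Ψ m * S7 := by
    have h1 : Differentiable ℝ fun p => S7 * Ψ p := differentiable_matrix_mul (differentiable_const _) hΨd
    have h2 : Differentiable ℝ fun p => Ψ p * S7 := differentiable_matrix_mul hΨd (differentiable_const _)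
    rw [← sub_eq_zero]
    refine eq_zero_of_frame (A := fun i m => -η i m) (Φ := fun p => S7 * Ψ p - Ψ p * S7)
      (fun i => (hη i).continuous.neg) (h1.sub h2) (fun i m => ?_) ?_ m
    · rw [pd_matrix_sub h1 h2, pd_const_mul _ hΨd, pd_mul_const hΨd, hpd]
      have := he i m
      calc S7 * -(Ψ m * η i m) - -(Ψ m * η i m) * S7
          = -(S7 * Ψ m * η i m) + Ψ m * (η i m * S7) := by noncomm_ring
        _ = (S7 * Ψ m - Ψ m * S7) * -η i m := by rw [← this]; noncomm_ring
    · simp only [hΨ0, sub_eq_zero]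
      exact (transpose_mem_K hk).2
  refine ⟨Ψ, η, hΨ, fun m => ⟨hΨG m, hΨK m⟩, hη, hg, he, hpd, fun w m => ?_⟩
  let γ : Fin 2 → R2 → Mat7 := fun w m => Ψ m * β w m * (Ψ m)ᵀ
  have hΨβ (w : Fin 2) : Differentiable ℝ fun p => Ψ p * β w p := differentiable_matrix_mul hΨd (hd w)
  have hγd (w : Fin 2) : Differentiable ℝ (γ w) := differentiable_matrix_mul (hΨβ w) hΨT
  have hγ (i w : Fin 2) (m : R2) : pd i (γ w) m = Ψ m * torusDeriv β η i w m * (Ψ m)ᵀ := by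
    refine (pd_mul (hΨβ w) hΨT i m).trans ?_
    rw [pd_mul hΨd (hd w), pd_transpose hΨd, hpd, Matrix.transpose_neg, Matrix.transpose_mul,
      (hg i m).1, torusDeriv, Ring.lie_def]
    noncomm_ring
  let c : Fin 2 → Fin 2 → Fin 2 → R2 → ℝ := fun i w v m =>
    torusCoeff (fun i => β i m) (torusDeriv β η i w m) v
  have hγc (i w : Fin 2) (m : R2) : pd i (γ w) m = c i w 0 m • γ 0 m + c i w 1 m • γ 1 m := by
    rw [hγ, (h m).eq_torusCoeff (exists_torusDeriv_eq hβ h hg he hc i w m)]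
    simp only [Matrix.mul_add, Matrix.add_mul, Matrix.mul_smul, Matrix.smul_mul]
    rfl
  have hcc (i w v : Fin 2) : Continuous (c i w v) :=
    (contDiff_torusCoeff hβ h (contDiff_torusDeriv hβ hη i w) v).continuous
  have hpt (i w : Fin 2) (m : R2) (r : Fin 6) : pd i (fun p => tCoord (γ w p) r) m =
      c i w 0 m * tCoord (γ 0 m) r + c i w 1 m * tCoord (γ 1 m) r := by
    have h1 : Differentiable ℝ fun p => tCoord (γ w p) := tCoordL.differentiable.comp (hγd w)
    have h2 := pd_clm (ContinuousLinearMap.proj r : (Fin 6 → ℝ) →L[ℝ] ℝ) h1 i m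
    rw [pd_tCoord (hγd w), hγc, map_add, map_smul, map_smul] at h2
    exact h2
  have htd (w : Fin 2) (r : Fin 6) : Differentiable ℝ fun p => tCoord (γ w p) r :=
    differentiable_pi.1 (tCoordL.differentiable.comp (hγd w)) r
  funext r
  -- For a fixed root the two components of `γ` satisfy a homogeneous linear system with zero
  -- initial value. They are placed in the first row of a matrix so that uniqueness for frames
  -- applies.
  let f : R2 → Matrix (Fin 2) (Fin 2) ℝ := fun p => Matrix.of fun l w =>
    if l = 0 then tCoord (γ w p) r else 0
  have hfd : Differentiable ℝ f := by
    rw [differentiable_matrix_iff]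
    intro l w
    fin_cases l
    · exact htd w r
    · exact differentiable_const 0
  have hf0 := eq_zero_of_frame (A := fun i m => Matrix.of fun v w => c i w v m) (Φ := f)
    (fun i => continuous_pi fun v => continuous_pi fun w => hcc i w v) hfd (fun i m => ?_) ?_ m
  · exact congrFun (congrFun hf0 0) w
  · ext l w
    rw [pd_matrix_apply hfd, Matrix.mul_apply, Fin.sum_univ_two]
    fin_cases l
    · refine (hpt i w m r).trans ?_
      simp only [f, Matrix.of_apply]
      simp
      ring
    · refine (pd_const (0 : ℝ) i m).trans ?_
      simp [f]
  · have e (w : Fin 2) : tCoord (γ w 0) = 0 := by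
      simp only [γ, hΨ0, Matrix.transpose_transpose]
      exact ht0 w
    ext l w
    simp [f, e]

end TorusGauge

/-! ### Normal frames and the construction of `(x, v)` -/

section NormalFrame

open Matrix

/-- Closed one-forms on the plane are exact. -/
theorem exists_primitive {E : Type*} [NormedAddCommGroup E] [NormedSpace ℝ E] [CompleteSpace E]
    {y : Fin 2 → R2 → E} (hy : ∀ i, ContDiff ℝ ∞ (y i)) (hc : ∀ m, pd 0 (y 1) m = pd 1 (y 0) m) :
    ∃ x : R2 → E, ContDiff ℝ ∞ x ∧ ∀ i m, pd i x m = y i m := by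
  -- The equation `dx = y` becomes linear after adding a coordinate constantly equal to 1. Products
  -- of the coefficients `(e, r) ↦ (r • w, 0)` vanish, so integrability is closedness.
  let L : E →L[ℝ] (E × ℝ →L[ℝ] E × ℝ) :=
    ((ContinuousLinearMap.compL ℝ (E × ℝ) E (E × ℝ)) (ContinuousLinearMap.inl ℝ E ℝ)).comp
      (ContinuousLinearMap.smulRightL ℝ (E × ℝ) E (ContinuousLinearMap.snd ℝ E ℝ))
  have hL (w : E) (z : E × ℝ) : L w z = (z.2 • w, 0) := by
    simp [L]
  have hcomp (w w' : E) : L w ∘L L w' = 0 := by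
    refine ContinuousLinearMap.ext fun z => ?_
    rw [ContinuousLinearMap.comp_apply, hL, hL]
    simp
  obtain ⟨Y, hY, hY0, hY'⟩ := exists_solution_of_pair (A := fun i m => L (y i m))
    (fun i => L.contDiff.comp (hy i)) (fun m => by
      rw [pd_clm L (differentiable_infty (hy 1)), pd_clm L (differentiable_infty (hy 0)), hc,
        hcomp, hcomp]
      simp) ((0, 1) : E × ℝ)
  have hd := differentiable_infty hY
  have h2 (m : R2) : (Y m).2 = 1 := by
    have := eq_of_pd_eq_zero (f := fun p => (Y p).2)
      ((ContinuousLinearMap.snd ℝ E ℝ).differentiable.comp hd) (fun i m => ?_) m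
    · rw [this, hY0]
    · refine (pd_clm (ContinuousLinearMap.snd ℝ E ℝ) hd i m).trans ?_
      rw [hY', hL]
      rfl
  refine ⟨fun p => (Y p).1, contDiff_fst.comp hY, fun i m => ?_⟩
  refine (pd_clm (ContinuousLinearMap.fst ℝ E ℝ) hd i m).trans ?_
  rw [hY', hL, h2, one_smul]
  rfl

/-- `hCoord` as a continuous linear map to the coordinate plane. -/
def hCoordL : Mat7 →L[ℝ] R2 :=
  LinearMap.toContinuousLinearMap ((WithLp.linearEquiv 2 ℝ (Fin 2 → ℝ)).symm.toLinearMap ∘ₗ hCoord)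

theorem hCoordL_apply (A : Mat7) (j : Fin 2) : hCoordL A j = hCoord A j := rfl

theorem hCoord_lie_of_tCoord {X N : Mat7} (hX : X ∈ g2) (hX' : S7 * X = -(X * S7))
    (ht : tCoord X = 0) (hN : N ∈ g2) (hN' : S7 * N = N * S7) : hCoord ⁅X, N⁆ = 0 := by
  rw [eq_kMat hN hN', lie_kMat_of_tCoord hX hX' ht, hCoord_pMat]

theorem rootOf_apply (X : Mat7) (r : Fin 6) :
    rootOf X r = hCoord X 0 * root 0 r + hCoord X 1 * root 1 r := rfl

/-- `pMat 0` as a linear map. -/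
def pMatₗ : (Fin 6 → ℝ) →ₗ[ℝ] Mat7 where
  toFun := pMat 0
  map_add' t t' := by rw [← pMat_add, add_zero]
  map_smul' c t := by rw [RingHom.id_apply, ← pMat_smul, smul_zero]

theorem contDiff_pMat {t : R2 → Fin 6 → ℝ} (ht : ContDiff ℝ ∞ t) :
    ContDiff ℝ ∞ fun p => pMat 0 (t p) :=
  (LinearMap.toContinuousLinearMap pMatₗ).contDiff.comp ht

/-- The action of the span of `b₁, b₂` on the associative plane. -/
theorem act_pMat_of_fixed (h : Fin 2 → ℝ) {w : R7} (hw : act S7 w = w) :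
    act (pMat h 0) w = !₂[-(h 0 * w 4), 0, -((h 0 + h 1) * w 6), -(h 1 * w 5), 0, 0, 0] := by
  rw [act_S7_eq_self_iff] at hw
  ext i
  fin_cases i <;> simp [Matrix.mulVec, dotProduct, Fin.sum_univ_seven, pMat, hw]; ring

/-- The action of the span of `b₁, b₂` on the coassociative plane. -/
theorem act_pMat_of_neg (h : Fin 2 → ℝ) (c : R7) (hc : act S7 c = -c) :
    act (pMat h 0) c = !₂[0, 0, 0, 0, h 0 * c 0, h 1 * c 3, (h 0 + h 1) * c 2] := by
  rw [act_S7_eq_neg_iff] at hc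
  ext i
  fin_cases i <;> simp [Matrix.mulVec, dotProduct, Fin.sum_univ_seven, pMat, hc]

/-- A nondegenerate abelian surface has an adapted frame whose `𝔭`-part takes values in the span
of `b₁, b₂`. -/
theorem exists_normal_frame {φ : R2 → R7} (h : IsImmersedSurface φ) (hn : IsNondegenerate φ)
    (ha : IsAbelian φ) : ∃ (F : R2 → Mat7) (γ κ : Fin 2 → R2 → Mat7), ContDiff ℝ ∞ F ∧
      (∀ m, F m ∈ G2) ∧ (∀ i m, pd i φ m ∈ framePlane (F m)) ∧ (∀ i, ContDiff ℝ ∞ (γ i)) ∧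
      (∀ i, ContDiff ℝ ∞ (κ i)) ∧ (∀ i m, pd i F m = F m * (γ i m + κ i m)) ∧
      (∀ m, IsTorusPair fun i => γ i m) ∧ (∀ i m, tCoord (γ i m) = 0) ∧ (∀ i m, κ i m ∈ g2) ∧
      ∀ i m, S7 * κ i m = κ i m * S7 := by
  obtain ⟨F, β, hF, hG, hφ, hβ, hpd, hβg, hβo, hβc, hβi⟩ := exists_parallel_frame h hn ha
  have htor (m : R2) : IsTorusPair fun i => β i m := ⟨fun i => hβg i m, fun i => hβo i m, hβc m, hβi m⟩
  obtain ⟨Ψ, η, hΨ, hΨK, hη, hηg, hηe, hΨ', ht⟩ := exists_torus_gauge hβ htor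
  have hΨT := contDiff_matrix_transpose hΨ
  have hΨΨ (m : R2) : (Ψ m)ᵀ * Ψ m = 1 := transpose_mul_self_of_mem_G2 (hΨK m).1
  refine ⟨fun m => F m * (Ψ m)ᵀ, fun i m => Ψ m * β i m * (Ψ m)ᵀ, fun i m => Ψ m * η i m * (Ψ m)ᵀ,
    contDiff_matrix_mul hF hΨT, fun m => mul_mem_G2 (hG m) (transpose_mem_G2 (hΨK m).1),
    fun i m => ?_, fun i => contDiff_matrix_mul (contDiff_matrix_mul hΨ (hβ i)) hΨT,
    fun i => contDiff_matrix_mul (contDiff_matrix_mul hΨ (hη i)) hΨT, fun i m => ?_, fun m => ?_, ht,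
    fun i m => conj_mem_g2' (hΨK m).1 (hηg i m), fun i m => ?_⟩
  · have h1 : pd i φ m ∈ framePlane (F m) := by
      have : gaussMap φ m ≤ framePlane (F m) := by
        rw [← hφ]
        exact le_sInf fun V hV => hV.2
      exact gaussMap_le_iff.1 this i
    rw [mem_framePlane_iff (hG m)] at h1
    rw [mem_framePlane_iff (mul_mem_G2 (hG m) (transpose_mem_G2 (hΨK m).1)), Matrix.transpose_mul,
      Matrix.transpose_transpose, act_mul, ← act_mul S7, (hΨK m).2, act_mul, h1]
  · rw [pd_mul (differentiable_infty hF) (differentiable_infty hΨT),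
      pd_transpose (differentiable_infty hΨ), hpd, hΨ', Matrix.transpose_neg, Matrix.transpose_mul,
      (hηg i m).1]
    calc F m * β i m * (Ψ m)ᵀ + F m * -(-η i m * (Ψ m)ᵀ)
        = F m * 1 * (β i m + η i m) * (Ψ m)ᵀ := by noncomm_ring
      _ = _ := by rw [← hΨΨ m]; noncomm_ring
  · have := (htor m).conj (transpose_mem_K (hΨK m))
    simpa only [Matrix.transpose_transpose] using this
  · exact S7_mul_mul_of_even (S7_mul_mul_of_even (hΨK m).2 (hηe i m)) (transpose_mem_K (hΨK m)).2

/-- The consequences of the structure equations for the `𝔭`-part. -/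
theorem closed_and_symm_of_normal_frame {F : R2 → Mat7} {γ κ : Fin 2 → R2 → Mat7}
    (hF : ContDiff ℝ ∞ F) (hG : ∀ m, F m ∈ G2) (hγ : ∀ i, ContDiff ℝ ∞ (γ i))
    (hκ : ∀ i, ContDiff ℝ ∞ (κ i)) (hpd : ∀ i m, pd i F m = F m * (γ i m + κ i m))
    (htor : ∀ m, IsTorusPair fun i => γ i m) (ht : ∀ i m, tCoord (γ i m) = 0)
    (hκg : ∀ i m, κ i m ∈ g2) (hκe : ∀ i m, S7 * κ i m = κ i m * S7) (m : R2) :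
    hCoord (pd 0 (γ 1) m) = hCoord (pd 1 (γ 0) m) ∧
      rootOf (γ 0 m) * kCoord (κ 1 m) = rootOf (γ 1 m) * kCoord (κ 0 m) := by
  have hγd (i : Fin 2) := differentiable_infty (hγ i)
  have hκd (i : Fin 2) := differentiable_infty (hκ i)
  have hodd (i : Fin 2) (m : R2) : S7 * γ i m = -(γ i m * S7) := (htor m).odd i
  have hg (i : Fin 2) (m : R2) : γ i m ∈ g2 := (htor m).mem_g2 i
  have hflat := isFlatPair_of_frame (A := fun i m => γ i m + κ i m)
    (fun i => (hγd i).add (hκd i)) hF hpd (fun m => transpose_mul_self_of_mem_G2 (hG m)) m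
  rw [pd_matrix_add (hγd 1) (hκd 1), pd_matrix_add (hγd 0) (hκd 0)] at hflat
  have hκp (i j : Fin 2) : S7 * pd i (κ j) m = pd i (κ j) m * S7 := by
    rw [← pd_const_mul _ (hκd j), ← pd_mul_const (hκd j)]
    simp only [hκe]
  -- The odd part of the Maurer–Cartan equation. The brackets of two odd and of two even terms are
  -- even and belong to the other equation.
  have hX := (eq_zero_of_add_eq_zero7
    (X := pd 0 (γ 1) m - pd 1 (γ 0) m + (⁅γ 0 m, κ 1 m⁆ - ⁅γ 1 m, κ 0 m⁆))
    (Y := pd 0 (κ 1) m - pd 1 (κ 0) m + (⁅γ 0 m, γ 1 m⁆ + ⁅κ 0 m, κ 1 m⁆)) (by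
      simp only [Matrix.mul_add, Matrix.mul_sub, Matrix.add_mul, Matrix.sub_mul,
        S7_mul_pd_odd (hγd _) (hodd _), S7_mul_lie_of_odd_even (hodd _ m) (hκe _ m)]
      abel) (by
      simp only [Matrix.mul_add, Matrix.mul_sub, Matrix.add_mul, Matrix.sub_mul, hκp,
        S7_mul_lie_of_odd (hodd _ m) (hodd _ m), S7_mul_lie_of_even (hκe _ m) (hκe _ m)]) (by
      rw [← hflat]
      simp only [Ring.lie_def]
      noncomm_ring)).1
  have hh (i j : Fin 2) : hCoord ⁅γ i m, κ j m⁆ = 0 :=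
    hCoord_lie_of_tCoord (hg i m) (hodd i m) (ht i m) (hκg j m) (hκe j m)
  have htl (i j : Fin 2) : tCoord ⁅γ i m, κ j m⁆ = -(rootOf (γ i m) * kCoord (κ j m)) := by
    conv_lhs => rw [eq_kMat (hκg j m) (hκe j m), lie_kMat_of_tCoord (hg i m) (hodd i m) (ht i m),
      tCoord_pMat]
  have htp (i j : Fin 2) : tCoord (pd i (γ j) m) = 0 := by
    rw [← pd_tCoord (hγd j)]
    simp only [ht]
    exact pd_const _ _ _
  constructor
  · have h1 := congrArg hCoord hX
    rw [map_add, map_sub, map_sub, hh, hh, map_zero, sub_zero, add_zero] at h1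
    exact sub_eq_zero.1 h1
  · have h1 := congrArg tCoord hX
    rw [map_add, map_sub, map_sub, htp, htp, htl, htl, map_zero, sub_zero, zero_add] at h1
    exact neg_injective (sub_eq_zero.1 h1)

/-- The symmetry of the second derivatives of the surface in a normal frame. -/
theorem symm_translation {F : R2 → Mat7} {γ κ : Fin 2 → R2 → Mat7} {φ : R2 → R7}
    {τ : Fin 2 → R2 → R7} (hF : ContDiff ℝ ∞ F) (hG : ∀ m, F m ∈ G2)
    (hpd : ∀ i m, pd i F m = F m * (γ i m + κ i m)) (hodd : ∀ i m, S7 * γ i m = -(γ i m * S7))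
    (hκe : ∀ i m, S7 * κ i m = κ i m * S7) (hφ : ContDiff ℝ ∞ φ) (hτ : ∀ i, ContDiff ℝ ∞ (τ i))
    (hφτ : ∀ i m, pd i φ m = act (F m) (τ i m)) (hτS : ∀ i m, act S7 (τ i m) = τ i m) (m : R2) :
    act (γ 0 m) (τ 1 m) = act (γ 1 m) (τ 0 m) := by
  have hτd (i : Fin 2) := differentiable_infty (hτ i)
  have hFd := differentiable_infty hF
  have hc := pd_comm hφ 0 1 m
  have hf (i : Fin 2) : pd i φ = fun p => act (F p) (τ i p) := funext (hφτ i)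
  rw [hf 0, hf 1, pd_act hFd (hτd 1), pd_act hFd (hτd 0), hpd, hpd, act_mul, act_mul,
    ← act_map_add, ← act_map_add] at hc
  have hc' := congrArg (act (F m)ᵀ) hc
  rw [act_transpose_act (hG m), act_transpose_act (hG m), act_add, act_add] at hc'
  have hpS (i j : Fin 2) : act S7 (pd i (τ j) m) = pd i (τ j) m := by
    have h1 := pd_act (differentiable_const S7) (hτd j) i m
    simp only [hτS] at h1
    rw [pd_matrix_const] at h1
    have h0 : act (0 : Mat7) (τ j m) = 0 := by simp [act]
    rw [h0, zero_add] at h1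
    exact h1.symm
  have hκS (i j : Fin 2) : act S7 (act (κ i m) (τ j m)) = act (κ i m) (τ j m) := by
    rw [← act_mul, hκe, act_mul, hτS]
  have hγS (i j : Fin 2) : act S7 (act (γ i m) (τ j m)) = -act (γ i m) (τ j m) := by
    rw [← act_mul, hodd, act_neg, act_mul, hτS]
  -- Applying `S7` changes the sign of the terms with `γ` only, so a subtraction isolates them.
  have hs := congrArg (act S7) hc'
  simp only [act_map_add, hpS, hκS, hγS] at hs
  have h2 : (2 : ℝ) • (act (γ 0 m) (τ 1 m) - act (γ 1 m) (τ 0 m)) =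
      ((act (γ 0 m) (τ 1 m) + act (κ 0 m) (τ 1 m) + pd 0 (τ 1) m) -
        (act (γ 1 m) (τ 0 m) + act (κ 1 m) (τ 0 m) + pd 1 (τ 0) m)) -
      ((-act (γ 0 m) (τ 1 m) + act (κ 0 m) (τ 1 m) + pd 0 (τ 1) m) -
        (-act (γ 1 m) (τ 0 m) + act (κ 1 m) (τ 0 m) + pd 1 (τ 0) m)) := by module
  rw [sub_eq_zero.2 hs, sub_eq_zero.2 hc', sub_zero, smul_eq_zero] at h2
  exact sub_eq_zero.1 (h2.resolve_left two_ne_zero)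

theorem evenPart_eq_lie (x : R2 → R2) (A : R2 → Mat7) (i : Fin 2) (m : R2) :
    evenPart x A i m = ⁅oddPart x i m, A m⁆ := by
  simp only [evenPart, oddPart, Fin.sum_univ_two, Ring.lie_def, Matrix.mul_add, Matrix.add_mul,
    Matrix.mul_smul, Matrix.smul_mul]
  module

theorem translationPart_eq_act (x : R2 → R2) (c : R2 → R7) (i : Fin 2) (m : R2) :
    translationPart x c i m = act (oddPart x i m) (c m) := by
  simp only [translationPart, oddPart, Fin.sum_univ_two, act_add, act_smul]

theorem contDiff_rootOf {A : R2 → Mat7} (hA : ContDiff ℝ ∞ A) (r : Fin 6) :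
    ContDiff ℝ ∞ fun m => rootOf (A m) r :=
  contDiff_pi.1 ((LinearMap.toContinuousLinearMap rootOf).contDiff.comp hA) r

/-- The flatness of the family follows from the existence of a frame. -/
theorem Integrates.isAffineSystem {F : R2 → Mat7} {φ : R2 → R7} {x : R2 → R2} {v : R2 → Mat8 ℝ}
    (h : Integrates F φ x v) (hx : ContDiff ℝ ∞ x) (hv : ContDiff ℝ ∞ v)
    (hb : ∀ m, Function.Bijective (fderiv ℝ x m)) (hp : ∀ m, v m ∈ pHat) : IsAffineSystem x v := by
  refine ⟨hx, hv, hb, hp, (flat_family_iff hx hv hp).2 ?_⟩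
  refine isFlatPair_of_frame (fun i => (differentiable_infty (contDiff_pForm hx i)).add
    (differentiable_infty (contDiff_kForm hx hv i)))
    (contDiff_affineMatrix h.smooth_F h.smooth_φ) h.pd_affineMatrix
    (Ψ := fun m => affineMatrix (F m)ᵀ (-act (F m)ᵀ (φ m))) fun m => ?_
  rw [affineMatrix_mul, transpose_mul_self_of_mem_G2 (h.mem_G2 m), add_neg_cancel, affineMatrix_one]

/-- Nondegenerate abelian surfaces come from solutions of the affine system. -/
theorem exists_isAffineSystem {φ : R2 → R7} (h : IsImmersedSurface φ) (hn : IsNondegenerate φ)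
    (ha : IsAbelian φ) : ∃ (x : R2 → R2) (v : R2 → Mat8 ℝ) (F : R2 → Mat7),
      IsAffineSystem x v ∧ IsAdaptedFrame F φ ∧ Integrates F φ x v := by
  obtain ⟨F, γ, κ, hF, hG, hφF, hγ, hκ, hpd, htor, ht, hκg, hκe⟩ := exists_normal_frame h hn ha
  have hstr := closed_and_symm_of_normal_frame hF hG hγ hκ hpd htor ht hκg hκe
  have hodd (i : Fin 2) (m : R2) : S7 * γ i m = -(γ i m * S7) := (htor m).odd i
  have hg (i : Fin 2) (m : R2) : γ i m ∈ g2 := (htor m).mem_g2 i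
  have hγp (i : Fin 2) (m : R2) : γ i m = pMat (hCoord (γ i m)) 0 := by
    conv_lhs => rw [eq_pMat (hg i m) (hodd i m), ht]
  have hys (i : Fin 2) : ContDiff ℝ ∞ fun m => hCoordL (γ i m) := hCoordL.contDiff.comp (hγ i)
  -- The coefficients of the odd part with respect to `b₁, b₂` form a closed one-form; its primitive
  -- provides the coordinates.
  obtain ⟨x, hx, hxy⟩ := exists_primitive hys (fun m => by
    have e (i j : Fin 2) : pd i (fun m => hCoordL (γ j m)) m = hCoordL (pd i (γ j) m) :=
      pd_clm hCoordL (differentiable_infty (hγ j)) i m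
    rw [e, e]
    ext j
    exact congrFun (hstr m).1 j)
  have hxo (i : Fin 2) (m : R2) : oddPart x i m = γ i m := by
    rw [oddPart, Fin.sum_univ_two, hxy, hCoordL_apply, hCoordL_apply,
      ← eq_of_tCoord_eq_zero (hg i m) (hodd i m) (ht i m)]
  have hbij (m : R2) : Function.Bijective (fderiv ℝ x m) := by
    have hinj : Function.Injective (fderiv ℝ x m : R2 →ₗ[ℝ] R2) := by
      rw [injective_iff_map_eq_zero]
      intro u hu
      refine (htor m).independent u ?_
      have : fderiv ℝ x m u = 0 := hu
      have h1 : u 0 • γ 0 m + u 1 • γ 1 m = fderiv ℝ x m u 0 • b7 0 + fderiv ℝ x m u 1 • b7 1 := by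
        rw [fderiv_apply_eq, fderiv_apply_eq, ← hxo, ← hxo, oddPart, oddPart, Fin.sum_univ_two,
          Fin.sum_univ_two]
        module
      rw [h1, this]
      simp
    exact ⟨hinj, LinearMap.injective_iff_surjective.1 hinj⟩
  let ρ : Fin 2 → Fin 6 → R2 → ℝ := fun i r m => rootOf (γ i m) r
  have hρ (i : Fin 2) (r : Fin 6) : ContDiff ℝ ∞ (ρ i r) := contDiff_rootOf (hγ i) r
  have hρ0 (r : Fin 6) (m : R2) : ρ 0 r m ^ 2 + ρ 1 r m ^ 2 ≠ 0 :=
    (htor m).rootOf_ne_zero (fun i => ht i m) r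
  -- The smooth common solution `z` of `ρ 0 r * z = f 0` and `ρ 1 r * z = f 1`, available when the
  -- data are symmetric because no root vanishes on the whole torus.
  let quot : Fin 6 → (Fin 2 → R2 → ℝ) → R2 → ℝ := fun r f m =>
    (ρ 0 r m * f 0 m + ρ 1 r m * f 1 m) / (ρ 0 r m ^ 2 + ρ 1 r m ^ 2)
  have hquot {r : Fin 6} {f : Fin 2 → R2 → ℝ} (hf : ∀ i, ContDiff ℝ ∞ (f i)) :
      ContDiff ℝ ∞ (quot r f) :=
    (((hρ 0 r).mul (hf 0)).add ((hρ 1 r).mul (hf 1))).div (((hρ 0 r).pow 2).add ((hρ 1 r).pow 2))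
      (hρ0 r)
  have hquot' {r : Fin 6} {f : Fin 2 → R2 → ℝ} {m : R2} (hf : ρ 0 r m * f 1 m = ρ 1 r m * f 0 m)
      (i : Fin 2) : ρ i r m * quot r f m = f i m := by
    have := eq_mul_div_of_symm (hρ0 r m) hf
    fin_cases i
    · exact this.1.symm
    · exact this.2.symm
  -- Root components of `v`. Its component in the span of `b₁, b₂` drops out of `[bᵢ, v]` and is set
  -- to zero in `pMat 0`.
  let t : R2 → Fin 6 → ℝ := fun m r => quot r (fun i m => kCoord (κ i m) r) m
  have hts : ContDiff ℝ ∞ t := contDiff_pi.2 fun r => hquot fun i =>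
    contDiff_pi.1 (contDiff_kCoord (hκ i)) r
  have heven (i : Fin 2) (m : R2) : evenPart x (fun m => pMat 0 (t m)) i m = κ i m := by
    rw [evenPart_eq_lie, hxo, lie_pMat_of_tCoord (hg i m) (hodd i m) (ht i m),
      eq_kMat (hκg i m) (hκe i m)]
    congr 1
    funext r
    exact hquot' (r := r) (f := fun i m => kCoord (κ i m) r) (m := m) (congrFun (hstr m).2 r) i
  let τ : Fin 2 → R2 → R7 := fun i m => act (F m)ᵀ (pd i φ m)
  have hτ (i : Fin 2) : ContDiff ℝ ∞ (τ i) :=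
    contDiff_act (contDiff_matrix_transpose hF) (contDiff_pd h.1 i)
  have hφτ (i : Fin 2) (m : R2) : pd i φ m = act (F m) (τ i m) := (act_act_transpose (hG m) _).symm
  have hτS (i : Fin 2) (m : R2) : act S7 (τ i m) = τ i m := 
    (mem_framePlane_iff (hG m) _).1 (hφF i m)
  have hsym (m : R2) := symm_translation hF hG hpd hodd hκe h.1 hτ hφτ hτS m
  have hτc (i : Fin 2) (j : Fin 7) : ContDiff ℝ ∞ fun m => τ i m j := contDiff_euclidean.1 (hτ i) j
  -- The roots with index 0, 1, 2 are the weights on the coordinate planes with index pairs `(0,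
  -- 4)`, `(3, 5)`, `(2, 6)`.
  have hρe (i : Fin 2) (m : R2) : ρ i 0 m = hCoord (γ i m) 0 ∧ ρ i 1 m = hCoord (γ i m) 1 ∧
      ρ i 2 m = hCoord (γ i m) 0 + hCoord (γ i m) 1 := by
    simp [ρ, rootOf_apply, root]
  have hsymρ (m : R2) : ρ 0 0 m * τ 1 m 4 = ρ 1 0 m * τ 0 m 4 ∧
      ρ 0 1 m * τ 1 m 5 = ρ 1 1 m * τ 0 m 5 ∧ ρ 0 2 m * τ 1 m 6 = ρ 1 2 m * τ 0 m 6 := by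
    have h1 := hsym m
    rw [hγp 0 m, hγp 1 m, act_pMat_of_fixed _ (hτS 0 m), act_pMat_of_fixed _ (hτS 1 m)] at h1
    have h2 (j : Fin 7) := congrArg (fun w : R7 => w j) h1
    obtain ⟨e1, e2, e3⟩ := hρe 0 m
    obtain ⟨e4, e5, e6⟩ := hρe 1 m
    rw [e1, e2, e3, e4, e5, e6]
    refine ⟨?_, ?_, ?_⟩
    · simpa using h2 0
    · simpa using h2 3
    · simpa using h2 2
  -- The coordinate with index 1 has weight zero, does not affect the translation part and is set to
  -- zero.
  let c : R2 → R7 := fun m => !₂[quot 0 (fun i m => τ i m 4) m, 0, quot 2 (fun i m => τ i m 6) m,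
    quot 1 (fun i m => τ i m 5) m, 0, 0, 0]
  have hcs : ContDiff ℝ ∞ c := by
    rw [contDiff_euclidean]
    intro j
    fin_cases j
    · exact hquot fun i => hτc i 4
    · exact contDiff_const
    · exact hquot fun i => hτc i 6
    · exact hquot fun i => hτc i 5
    · exact contDiff_const
    · exact contDiff_const
    · exact contDiff_const
  have hcS (m : R2) : act S7 (c m) = -c m := by
    rw [act_S7_eq_neg_iff]
    simp [c]
  have htrans (i : Fin 2) (m : R2) : translationPart x c i m = τ i m := by
    obtain ⟨e1, e2, e3⟩ := hρe i m
    obtain ⟨s1, s2, s3⟩ := hsymρ m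
    obtain ⟨z0, z1, z2, z3⟩ := (act_S7_eq_self_iff _).1 (hτS i m)
    rw [translationPart_eq_act, hxo, hγp i m, act_pMat_of_neg _ _ (hcS m), ← e3, ← e1, ← e2]
    have q1 := hquot' (f := fun i m => τ i m 4) s1 i
    have q2 := hquot' (f := fun i m => τ i m 5) s2 i
    have q3 := hquot' (f := fun i m => τ i m 6) s3 i
    ext j
    fin_cases j
    · exact z0.symm
    · exact z1.symm
    · exact z2.symm
    · exact z3.symm
    · exact q1
    · exact q2
    · exact q3
  have hint : Integrates F φ x fun m => affineLie (pMat 0 (t m)) (c m) := by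
    refine (integrates_iff (A := fun m => pMat 0 (t m)) (c := c) fun m => rfl).2
      ⟨hF, h.1, hG, fun i m => ?_, fun i m => ?_⟩
    · rw [hpd, heven, hxo]
    · rw [htrans, hφτ]
  have hp (m : R2) : affineLie (pMat 0 (t m)) (c m) ∈ pHat :=
    mem_pHat_iff.2 ⟨_, _, pMat_mem_g2 _ _, S7_mul_pMat _ _, hcS m, rfl⟩
  exact ⟨x, _, F, hint.isAffineSystem hx (contDiff_affineLie (contDiff_pMat hts) hcs) hbij hp,
    hint.isAdaptedFrame hp h, hint⟩

end NormalFrame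

end G2Surface

end

open G2Surface in
theorem mainTheorem11 :
    -- a surface is nondegenerate and abelian iff it comes from a family of flat connections
    (∀ φ : R2 → R7, IsImmersedSurface φ →
      ((IsNondegenerate φ ∧ IsAbelian φ) ↔
        ∃ (x : R2 → R2) (v : R2 → Mat8 ℝ) (F : R2 → Mat7),
          IsAffineSystem x v ∧ IsAdaptedFrame F φ ∧ Integrates F φ x v)) ∧
    -- every family of flat connections defines such a surface
    (∀ (x : R2 → R2) (v : R2 → Mat8 ℝ), IsAffineSystem x v →
      (∃ (F : R2 → Mat7) (φ : R2 → R7), Integrates F φ x v) ∧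
      ∀ (F : R2 → Mat7) (φ : R2 → R7), Integrates F φ x v →
        (IsImmersedSurface φ ↔ HasInjectiveTranslationPart x v) ∧
        (IsImmersedSurface φ → IsAdaptedFrame F φ ∧ IsNondegenerate φ ∧ IsAbelian φ)) ∧
    -- surfaces up to rigid motion correspond to families up to constant conjugation
    (∀ (x x' : R2 → R2) (v v' : R2 → Mat8 ℝ) (F F' : R2 → Mat7) (φ φ' : R2 → R7),
      IsAffineSystem x v → IsAffineSystem x' v' →
      Integrates F φ x v → Integrates F' φ' x' v' → IsImmersedSurface φ →
      (AreCongruent φ φ' ↔ ConjugateFamilies x v x' v')) := by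
  refine ⟨fun φ hφ => ⟨fun h => exists_isAffineSystem hφ h.1 h.2, ?_⟩, fun x v hs => ?_, ?_⟩
  · rintro ⟨x, v, F, hs, hF, hint⟩
    exact hint.isNondegenerate_and_isAbelian hs hF
  · refine ⟨hs.exists_integrates, fun F φ hint => ⟨hint.isImmersedSurface_iff hs.mem_pHat, ?_⟩⟩
    intro hφ
    have hF := hint.isAdaptedFrame hs.mem_pHat hφ
    exact ⟨hF, hint.isNondegenerate_and_isAbelian hs hF⟩
  · intro x x' v v' F F' φ φ' hs hs' h h' hφ
    exact ⟨conjugateFamilies_of_areCongruent hs hs' h h' hφ,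
      areCongruent_of_conjugateFamilies hs hs' h h'⟩
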